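/- Let $R=\mathbf Z_{(2)}$ be the localization of $\mathbf Z$ at the prime ideal $(2)$ and let $\mathrm B_R(S_3,S_3)$ be the double Burnside $R$-algebra of the symmetric group $S_3$: the $R$-module freely generated by the isomorphism classes $[M]$ of finite $(S_3,S_3)$-bisets modulo the relations $[M\sqcup N]=[M]+[N]$, with multiplication $[M]\cdot[N]=[M\times_{S_3}N]$, where $M\times_{S_3}N$ is the set of orbits of $S_3$ on $M\times N$ under $g(m,n)=(mg^{-1},gn)$. Let $A_R$ be the $R$-algebra of all matrices $$a=\begin{bmatrix} s&0&0&t\\0&u&0&v\\0&0&w&0\\x&y&0&z\end{bmatrix},\qquad s\in R^{3\times 3},\ t\in R^{3\times 1},\ x\in R^{1\times 3},\ u,v,w,y\in R,\ z=z_1+z_2\eta+z_3\xi\in R[\eta,\xi]/(\eta^2,\eta\xi,\xi^2),$$ with componentwise addition and with the product of $a$ and $a'$ having the entries $ss'$, $st'+tz_1'$, $uu'$, $uv'+vz_1'$, $ww'$, $xs'+z_1x'$, $yu'+z_1y'$ and $zz'+(xt')\,\eta+yv'(\xi-12\eta)$ in the places of $s,t,u,v,w,x,y,z$, respectively. Let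 $\Lambda_{(2)}\subseteq A_R$ be the $R$-subalgebra of all $a$ with $$2w-2z_1\equiv_8 z_2,\quad z_2\equiv_4 z_3\equiv_4 0,\quad x_1\equiv_4x_2\equiv_4x_3\equiv_4 0,\quad y\equiv_2 t_1\equiv_2t_2\equiv_2t_3\equiv_2v\equiv_2 0 .$$ In $\Lambda_{(2)}$ consider the following elements, given by their only nonzero entries: $e_3$ ($s_{3,3}=1$), $e_4$ ($u=1$), $e_5$ ($w=1$, $z=1$), $\tau_1$ ($x_3=4$), $\tau_2$ ($t_3=2$), $\tau_3$ ($y=2$), $\tau_4$ ($v=2$), $\tau_7$ ($z=2+4\eta$). Let $\Lambda'_{(2)}=(e_3+e_4+e_5)\Lambda_{(2)}(e_3+e_4+e_5)$. Let $\Psi$ be the quiver with vertices $\tilde e_3,\tilde e_4,\tilde e_5$ and arrows $\tilde\tau_1:\tilde e_5\to\tilde e_3$, $\tilde\tau_2:\tilde e_3\to\tilde e_5$, $\tilde\tau_3:\tilde e_5\to\tilde e_4$, $\tilde\tau_4:\tilde e_4\to\tilde e_5$, $\tilde\tau_7:\tilde e_5\to\tilde e_5$. In the path algebra $R\Psi$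 the product $pq$ of paths is "first $p$, then $q$". Let $I$ be the two-sided ideal of $R\Psi$ generated by $$\tilde\tau_2\tilde\tau_1,\ \tilde\tau_2\tilde\tau_3,\ \tilde\tau_2\tilde\tau_7-2\tilde\tau_2,\ \tilde\tau_4\tilde\tau_1,\ \tilde\tau_4\tilde\tau_3,\ \tilde\tau_4\tilde\tau_7-2\tilde\tau_4,\ \tilde\tau_7\tilde\tau_1-2\tilde\tau_1,\ \tilde\tau_7\tilde\tau_3-2\tilde\tau_3,\ \tilde\tau_7^2-2\tilde\tau_7-\tilde\tau_1\tilde\tau_2 .$$ Then $\mathrm B_R(S_3,S_3)\cong\Lambda_{(2)}$ as $R$-algebras, and there is an isomorphism of $R$-algebras $$\Lambda'_{(2)}\xrightarrow{\ \sim\ }R\Psi/I,\qquad e_i\mapsto\tilde e_i+I\ (i\in\{3,4,5\}),\quad \tau_j\mapsto\tilde\tau_j+I\ (j\in\{1,2,3,4,7\}).$$ Moreover, $\mathrm B_R(S_3,S_3)$ is Morita equivalent, as an $R$-algebra, to $\Lambda'_{(2)}$ and hence to $R\Psi/I$. -/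

import Mathlib

/-! ### Bisets

A `(G, G)`-biset is a type `X` with a left action of `G` (`MulAction G X`) and a right action of `G`
(`MulAction Gᵐᵒᵖ X`, with `x · g = MulOpposite.op g • x`) that commute (`SMulCommClass G Gᵐᵒᵖ X`). -/

/-- Isomorphisms of `(G, G)`-bisets: bijections compatible with both actions. -/
structure BisetIso (G : Type*) [Group G] (X Y : Type*) [MulAction G X] [MulAction Gᵐᵒᵖ X]
    [MulAction G Y] [MulAction Gᵐᵒᵖ Y] extends X ≃ Y where
  map_left : ∀ (g : G) (x : X), toFun (g • x) = g • toFun x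
  map_right : ∀ (g : Gᵐᵒᵖ) (x : X), toFun (g • x) = g • toFun x

namespace BisetIso

variable {G : Type*} [Group G] {X Y Z : Type*} [MulAction G X] [MulAction Gᵐᵒᵖ X]
  [MulAction G Y] [MulAction Gᵐᵒᵖ Y] [MulAction G Z] [MulAction Gᵐᵒᵖ Z]

def refl (G : Type*) [Group G] (X : Type*) [MulAction G X] [MulAction Gᵐᵒᵖ X] :
    BisetIso G X X where
  toEquiv := Equiv.refl X
  map_left _ _ := rfl
  map_right _ _ := rfl

def symm (e : BisetIso G X Y) : BisetIso G Y X where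
  toEquiv := e.toEquiv.symm
  map_left g y := e.toEquiv.injective <| by
    have := e.map_left g (e.toEquiv.symm y)
    simp_all
  map_right g y := e.toEquiv.injective <| by
    have := e.map_right g (e.toEquiv.symm y)
    simp_all

def trans (e : BisetIso G X Y) (f : BisetIso G Y Z) : BisetIso G X Z where
  toEquiv := e.toEquiv.trans f.toEquiv
  map_left g x := by
    have h1 := e.map_left g x
    have h2 := f.map_left g (e.toEquiv x)
    simp_all
  map_right g x := by
    have h1 := e.map_right g x
    have h2 := f.map_right g (e.toEquiv x)
    simp_all

end BisetIso

/-! ### The tensor product of bisets -/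

section Tensor

variable (G : Type*) [Group G]

/-- The orbit relation of the left `G`-action `g · (m, n) = (m g⁻¹, g n)` on `M × N`. -/
def bisetTensorSetoid (M N : Type*) [MulAction Gᵐᵒᵖ M] [MulAction G N] : Setoid (M × N) where
  r p q := ∃ g : G, q = (MulOpposite.op g⁻¹ • p.1, g • p.2)
  iseqv :=
    { refl := fun p => ⟨1, by simp⟩
      symm := by
        rintro ⟨m, n⟩ ⟨m', n'⟩ ⟨g, hg⟩
        obtain ⟨rfl, rfl⟩ := Prod.mk.inj hg
        exact ⟨g⁻¹, by simp [smul_smul]⟩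
      trans := by
        rintro ⟨m, n⟩ ⟨m', n'⟩ ⟨m'', n''⟩ ⟨g, hg⟩ ⟨h, hh⟩
        obtain ⟨rfl, rfl⟩ := Prod.mk.inj hg
        obtain ⟨rfl, rfl⟩ := Prod.mk.inj hh
        exact ⟨h * g, by simp [smul_smul]⟩ }

/-- The tensor product `M ×_G N`: the set of `G`-orbits on `M × N`. -/
def BisetTensor (M N : Type*) [MulAction Gᵐᵒᵖ M] [MulAction G N] : Type _ :=
  Quotient (bisetTensorSetoid G M N)

namespace BisetTensor

variable {G}
variable {M N : Type*} [MulAction G M] [MulAction Gᵐᵒᵖ M] [SMulCommClass G Gᵐᵒᵖ M]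
  [MulAction G N] [MulAction Gᵐᵒᵖ N] [SMulCommClass G Gᵐᵒᵖ N]

/-- The class of `(m, n)` in the tensor product. -/
def mk (G : Type*) [Group G] {M N : Type*} [MulAction Gᵐᵒᵖ M] [MulAction G N] (m : M) (n : N) :
    BisetTensor G M N :=
  Quotient.mk (bisetTensorSetoid G M N) (m, n)

theorem ind {M N : Type*} [MulAction Gᵐᵒᵖ M] [MulAction G N] {p : BisetTensor G M N → Prop}
    (h : ∀ m n, p (mk G m n)) (x : BisetTensor G M N) : p x :=
  Quotient.ind (fun q => h q.1 q.2) x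

/-- Functions out of the tensor product are balanced functions of two variables. -/
def lift {M N : Type*} [MulAction Gᵐᵒᵖ M] [MulAction G N] {Z : Type*} (f : M → N → Z)
    (hf : ∀ (g : G) m n, f (MulOpposite.op g⁻¹ • m) (g • n) = f m n) (x : BisetTensor G M N) : Z :=
  Quotient.lift (fun q : M × N => f q.1 q.2)
    (by rintro ⟨m, n⟩ ⟨m', n'⟩ ⟨g, hg⟩
        obtain ⟨rfl, rfl⟩ := Prod.mk.inj hg
        exact (hf g m n).symm) x

@[simp] theorem lift_mk {M N : Type*} [MulAction Gᵐᵒᵖ M] [MulAction G N] {Z : Type*}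
    (f : M → N → Z) (hf : ∀ (g : G) m n, f (MulOpposite.op g⁻¹ • m) (g • n) = f m n) (m : M)
    (n : N) : lift f hf (mk G m n) = f m n := rfl

theorem mk_smul_smul {M N : Type*} [MulAction Gᵐᵒᵖ M] [MulAction G N] (g : G) (m : M) (n : N) :
    mk G (MulOpposite.op g⁻¹ • m) (g • n) = mk G m n :=
  (Quotient.sound (s := bisetTensorSetoid G M N) ⟨g, rfl⟩ : mk G m n = _).symm

theorem mk_op_smul {M N : Type*} [MulAction Gᵐᵒᵖ M] [MulAction G N] (g : G) (m : M) (n : N) :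
    mk G (MulOpposite.op g • m) n = mk G m (g • n) := by
  rw [← mk_smul_smul g (MulOpposite.op g • m) n, smul_smul, ← MulOpposite.op_mul]
  simp

/-- The left action `h · (m ⊗ n) = (h m) ⊗ n`. -/
instance : MulAction G (BisetTensor G M N) where
  smul h := lift (fun m n => mk G (h • m) n) fun g m n => by
    rw [smul_comm h (MulOpposite.op g⁻¹) m, mk_smul_smul]
  one_smul := ind fun m n => congrArg (mk G · n) (one_smul G m)
  mul_smul h k := ind fun m n => congrArg (mk G · n) (mul_smul h k m)

/-- The right action `(m ⊗ n) · h = m ⊗ (n h)`. -/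
instance : MulAction Gᵐᵒᵖ (BisetTensor G M N) where
  smul h := lift (fun m n => mk G m (h • n)) fun g m n => by
    rw [← smul_comm g h n, mk_smul_smul]
  one_smul := ind fun m n => congrArg (mk G m) (one_smul Gᵐᵒᵖ n)
  mul_smul h k := ind fun m n => congrArg (mk G m) (mul_smul h k n)

theorem smul_mk (h : G) (m : M) (n : N) : h • mk G m n = mk G (h • m) n := rfl

theorem op_smul_mk (h : Gᵐᵒᵖ) (m : M) (n : N) : h • mk G m n = mk G m (h • n) := rfl

instance : SMulCommClass G Gᵐᵒᵖ (BisetTensor G M N) where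
  smul_comm _ _ := ind fun _ _ => rfl

instance [Finite M] [Finite N] : Finite (BisetTensor G M N) :=
  inferInstanceAs (Finite (Quotient _))

/-- The tensor product is functorial for isomorphisms. -/
def congr {M' N' : Type*} [MulAction G M'] [MulAction Gᵐᵒᵖ M'] [SMulCommClass G Gᵐᵒᵖ M']
    [MulAction G N'] [MulAction Gᵐᵒᵖ N'] [SMulCommClass G Gᵐᵒᵖ N']
    (e : BisetIso G M M') (f : BisetIso G N N') :
    BisetIso G (BisetTensor G M N) (BisetTensor G M' N') where
  toFun := lift (fun m n => mk G (e.toFun m) (f.toFun n)) fun g m n => by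
    rw [e.map_right, f.map_left, mk_smul_smul]
  invFun := lift (fun m n => mk G (e.symm.toFun m) (f.symm.toFun n)) fun g m n => by
    rw [e.symm.map_right, f.symm.map_left, mk_smul_smul]
  left_inv := ind fun m n => congrArg₂ (mk G) (e.left_inv m) (f.left_inv n)
  right_inv := ind fun m n => congrArg₂ (mk G) (e.right_inv m) (f.right_inv n)
  map_left g := ind fun m n => congrArg (mk G · _) (e.map_left g m)
  map_right g := ind fun m n => congrArg (mk G _) (f.map_right g n)

/-- Associativity of the tensor product. -/
def assoc {L : Type*} [MulAction G L] [MulAction Gᵐᵒᵖ L] [SMulCommClass G Gᵐᵒᵖ L] :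
    BisetIso G (BisetTensor G (BisetTensor G M N) L) (BisetTensor G M (BisetTensor G N L)) where
  toFun := lift (fun p l => lift (fun m n => mk G m (mk G n l))
      (fun g m n => by rw [← smul_mk, mk_smul_smul]) p)
    fun g p l => by
      induction p using ind with | _ m n => exact congrArg (mk G m) (mk_smul_smul g n l)
  invFun := lift (fun m p => lift (fun n l => mk G (mk G m n) l)
      (fun g n l => by rw [← op_smul_mk, mk_smul_smul]) p)
    fun g m p => by
      induction p using ind with | _ n l => exact congrArg (mk G · l) (mk_smul_smul g m n)
  left_inv := ind fun p l => by induction p using ind with | _ m n => rfl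
  right_inv := ind fun m p => by induction p using ind with | _ n l => rfl
  map_left g := ind fun p l => by induction p using ind with | _ m n => rfl
  map_right g := ind fun p l => by induction p using ind with | _ m n => rfl

/-- `G ×_G M ≅ M`. -/
def oneTensor : BisetIso G (BisetTensor G G M) M where
  toFun := lift (fun g m => g • m) fun g h m => by simp [smul_smul]
  invFun m := mk G 1 m
  left_inv := ind fun g m => by
    have := mk_op_smul g (1 : G) m
    simpa using this.symm
  right_inv m := one_smul G m
  map_left g := ind fun h m => mul_smul g h m
  map_right g := ind fun h m => smul_comm h g m

/-- `M ×_G G ≅ M`. -/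
def tensorOne : BisetIso G (BisetTensor G M G) M where
  toFun := lift (fun m g => MulOpposite.op g • m) fun g m h => by simp [smul_smul]
  invFun m := mk G m 1
  left_inv := ind fun m g => by
    have := mk_op_smul g m (1 : G)
    simpa using this
  right_inv m := one_smul Gᵐᵒᵖ m
  map_left g := ind fun m h => (smul_comm g (MulOpposite.op h) m).symm
  map_right g := ind fun m h => by
    change MulOpposite.op (h * g.unop) • m = g • (MulOpposite.op h • m)
    rw [smul_smul]; rfl

/-- `(M ⊔ M') ×_G N ≅ (M ×_G N) ⊔ (M' ×_G N)`. -/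
def sumTensor {M' : Type*} [MulAction G M'] [MulAction Gᵐᵒᵖ M'] [SMulCommClass G Gᵐᵒᵖ M'] :
    BisetIso G (BisetTensor G (M ⊕ M') N) (BisetTensor G M N ⊕ BisetTensor G M' N) where
  toFun := lift (fun p n => p.elim (fun m => .inl (mk G m n)) (fun m => .inr (mk G m n)))
    fun g p n => by
      rcases p with m | m
      · exact congrArg Sum.inl (mk_smul_smul g m n)
      · exact congrArg Sum.inr (mk_smul_smul g m n)
  invFun := Sum.elim
    (lift (fun m n => mk G (.inl m) n) fun g m n => by
      rw [← Sum.smul_inl, mk_smul_smul])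
    (lift (fun m n => mk G (.inr m) n) fun g m n => by
      rw [← Sum.smul_inr, mk_smul_smul])
  left_inv := ind fun p n => by rcases p with m | m <;> rfl
  right_inv := by
    rintro (p | p) <;> induction p using ind with | _ m n => rfl
  map_left g := ind fun p n => by rcases p with m | m <;> rfl
  map_right g := ind fun p n => by rcases p with m | m <;> rfl

/-- `M ×_G (N ⊔ N') ≅ (M ×_G N) ⊔ (M ×_G N')`. -/
def tensorSum {N' : Type*} [MulAction G N'] [MulAction Gᵐᵒᵖ N'] [SMulCommClass G Gᵐᵒᵖ N'] :
    BisetIso G (BisetTensor G M (N ⊕ N')) (BisetTensor G M N ⊕ BisetTensor G M N') where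
  toFun := lift (fun m p => p.elim (fun n => .inl (mk G m n)) (fun n => .inr (mk G m n)))
    fun g m p => by
      rcases p with n | n
      · exact congrArg Sum.inl (mk_smul_smul g m n)
      · exact congrArg Sum.inr (mk_smul_smul g m n)
  invFun := Sum.elim
    (lift (fun m n => mk G m (.inl n)) fun g m n => by
      rw [← Sum.smul_inl, mk_smul_smul])
    (lift (fun m n => mk G m (.inr n)) fun g m n => by
      rw [← Sum.smul_inr, mk_smul_smul])
  left_inv := ind fun m p => by rcases p with n | n <;> rfl
  right_inv := by
    rintro (p | p) <;> induction p using ind with | _ m n => rfl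
  map_left g := ind fun m p => by rcases p with n | n <;> rfl
  map_right g := ind fun m p => by rcases p with n | n <;> rfl

end BisetTensor

end Tensor

/-! ### Isomorphism classes of finite bisets -/

/-- A finite `(G, G)`-biset, with underlying set `{0, …, card - 1}`. Every finite biset is
isomorphic to one of these, see `FinBiset.of`. -/
structure FinBiset (G : Type*) [Group G] where
  card : ℕ
  [left : MulAction G (Fin card)]
  [right : MulAction Gᵐᵒᵖ (Fin card)]
  [comm : SMulCommClass G Gᵐᵒᵖ (Fin card)]

namespace FinBiset

attribute [instance] FinBiset.left FinBiset.right FinBiset.comm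

variable (G : Type*) [Group G]

/-- The copy on `{0, …, n - 1}` of an arbitrary finite biset `X`. -/
noncomputable def of (X : Type*) [Finite X] [MulAction G X] [MulAction Gᵐᵒᵖ X]
    [SMulCommClass G Gᵐᵒᵖ X] : FinBiset G :=
  letI e := (Finite.equivFin X).symm
  letI := e.mulAction G
  letI := e.mulAction Gᵐᵒᵖ
  haveI : SMulCommClass G Gᵐᵒᵖ (Fin (Nat.card X)) :=
    ⟨fun g h x => e.injective (by simp [Equiv.smul_def, smul_comm])⟩
  ⟨Nat.card X⟩

/-- `FinBiset.of G X` is isomorphic to `X`. -/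
noncomputable def ofIso (X : Type*) [Finite X] [MulAction G X] [MulAction Gᵐᵒᵖ X]
    [SMulCommClass G Gᵐᵒᵖ X] : BisetIso G X (Fin (of G X).card) where
  toEquiv := Finite.equivFin X
  map_left g x := by
    change _ = (Finite.equivFin X) (g • (Finite.equivFin X).symm (Finite.equivFin X x))
    simp
  map_right g x := by
    change _ = (Finite.equivFin X) (g • (Finite.equivFin X).symm (Finite.equivFin X x))
    simp

instance setoid : Setoid (FinBiset G) where
  r M N := Nonempty (BisetIso G (Fin M.card) (Fin N.card))
  iseqv := ⟨fun _ => ⟨.refl G _⟩, fun ⟨e⟩ => ⟨e.symm⟩, fun ⟨e⟩ ⟨f⟩ => ⟨e.trans f⟩⟩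

end FinBiset

/-- The isomorphism classes of finite `(G, G)`-bisets. -/
def BisetClass (G : Type*) [Group G] : Type _ := Quotient (FinBiset.setoid G)

namespace BisetClass

variable (G : Type*) [Group G]

/-- The isomorphism class of a finite biset. -/
noncomputable def mk (X : Type*) [Finite X] [MulAction G X] [MulAction Gᵐᵒᵖ X]
    [SMulCommClass G Gᵐᵒᵖ X] : BisetClass G :=
  Quotient.mk (FinBiset.setoid G) (FinBiset.of G X)

variable {G}

theorem mk_eq_mk_iff {X Y : Type*} [Finite X] [MulAction G X] [MulAction Gᵐᵒᵖ X]
    [SMulCommClass G Gᵐᵒᵖ X] [Finite Y] [MulAction G Y] [MulAction Gᵐᵒᵖ Y]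
    [SMulCommClass G Gᵐᵒᵖ Y] : mk G X = mk G Y ↔ Nonempty (BisetIso G X Y) := by
  refine ⟨fun h => ?_, fun ⟨e⟩ => ?_⟩
  · obtain ⟨e⟩ := Quotient.exact h
    exact ⟨((FinBiset.ofIso G X).trans e).trans (FinBiset.ofIso G Y).symm⟩
  · exact Quotient.sound ⟨((FinBiset.ofIso G X).symm.trans e).trans (FinBiset.ofIso G Y)⟩

theorem quot_mk_eq (M : FinBiset G) :
    (Quotient.mk (FinBiset.setoid G) M : BisetClass G) = mk G (Fin M.card) :=
  Quotient.sound ⟨FinBiset.ofIso G (Fin M.card)⟩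

theorem ind {p : BisetClass G → Prop} (h : ∀ M : FinBiset G, p (mk G (Fin M.card)))
    (x : BisetClass G) : p x :=
  Quotient.ind (fun M => by rw [quot_mk_eq]; exact h M) x

/-- Multiplication of isomorphism classes: `[M] · [N] = [M ×_G N]`. -/
noncomputable instance : Mul (BisetClass G) where
  mul := Quotient.lift₂ (fun M N => mk G (BisetTensor G (Fin M.card) (Fin N.card)))
    fun _ _ _ _ ⟨e⟩ ⟨f⟩ => mk_eq_mk_iff.2 ⟨BisetTensor.congr e f⟩

theorem mk_mul_mk (X Y : Type*) [Finite X] [MulAction G X] [MulAction Gᵐᵒᵖ X]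
    [SMulCommClass G Gᵐᵒᵖ X] [Finite Y] [MulAction G Y] [MulAction Gᵐᵒᵖ Y]
    [SMulCommClass G Gᵐᵒᵖ Y] : mk G X * mk G Y = mk G (BisetTensor G X Y) :=
  mk_eq_mk_iff.2 ⟨BisetTensor.congr (FinBiset.ofIso G X).symm (FinBiset.ofIso G Y).symm⟩

variable [Finite G]

/-- The unit is the class of the regular biset `G`. -/
noncomputable instance : Monoid (BisetClass G) where
  one := mk G G
  one_mul := ind fun M => by
    change mk G G * _ = _
    rw [mk_mul_mk, mk_eq_mk_iff]
    exact ⟨BisetTensor.oneTensor⟩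
  mul_one := ind fun M => by
    change _ * mk G G = _
    rw [mk_mul_mk, mk_eq_mk_iff]
    exact ⟨BisetTensor.tensorOne⟩
  mul_assoc := ind fun M => ind fun N => ind fun L => by
    rw [mk_mul_mk, mk_mul_mk, mk_mul_mk, mk_mul_mk, mk_eq_mk_iff]
    exact ⟨BisetTensor.assoc⟩

theorem one_def : (1 : BisetClass G) = mk G G := rfl

end BisetClass

/-! ### The double Burnside algebra -/

section DoubleBurnside

variable (R : Type*) [CommRing R] (G : Type*) [Group G] [Finite G]

/-- The submodule of the free `R`-module on the isomorphism classes of finite bisets that is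
generated by the elements `[M ⊔ N] - [M] - [N]`. -/
noncomputable def burnsideRelations : Submodule R (MonoidAlgebra R (BisetClass G)) :=
  Submodule.span R {x | ∃ M N : FinBiset G,
    x = MonoidAlgebra.of R _ (BisetClass.mk G (Fin M.card ⊕ Fin N.card))
      - MonoidAlgebra.of R _ (BisetClass.mk G (Fin M.card))
      - MonoidAlgebra.of R _ (BisetClass.mk G (Fin N.card))}

variable {G}

theorem burnsideRelations_mem (X Y : Type*) [Finite X] [MulAction G X] [MulAction Gᵐᵒᵖ X]
    [SMulCommClass G Gᵐᵒᵖ X] [Finite Y] [MulAction G Y] [MulAction Gᵐᵒᵖ Y]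
    [SMulCommClass G Gᵐᵒᵖ Y] :
    MonoidAlgebra.of R _ (BisetClass.mk G (X ⊕ Y)) - MonoidAlgebra.of R _ (BisetClass.mk G X)
      - MonoidAlgebra.of R _ (BisetClass.mk G Y) ∈ burnsideRelations R G := by
  refine Submodule.subset_span ⟨FinBiset.of G X, FinBiset.of G Y, ?_⟩
  have e := FinBiset.ofIso G X
  have f := FinBiset.ofIso G Y
  rw [BisetClass.mk_eq_mk_iff.2 ⟨e⟩, BisetClass.mk_eq_mk_iff.2 ⟨f⟩]
  congr 3
  refine BisetClass.mk_eq_mk_iff.2 ⟨⟨Equiv.sumCongr e.toEquiv f.toEquiv, ?_, ?_⟩⟩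
  · rintro g (x | y)
    · exact congrArg Sum.inl (e.map_left g x)
    · exact congrArg Sum.inr (f.map_left g y)
  · rintro g (x | y)
    · exact congrArg Sum.inl (e.map_right g x)
    · exact congrArg Sum.inr (f.map_right g y)

theorem burnsideRelations_mul_left (a x : MonoidAlgebra R (BisetClass G))
    (hx : x ∈ burnsideRelations R G) : a * x ∈ burnsideRelations R G := by
  induction hx using Submodule.span_induction with
  | zero => simp
  | add x y _ _ hx hy => rw [mul_add]; exact add_mem hx hy
  | smul r x _ hx => rw [mul_smul_comm]; exact Submodule.smul_mem _ r hx
  | mem x hx =>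
    obtain ⟨M, N, rfl⟩ := hx
    induction a using MonoidAlgebra.induction_on with
    | of b =>
      induction b using BisetClass.ind with | _ L
      rw [mul_sub, mul_sub, ← map_mul, ← map_mul, ← map_mul, BisetClass.mk_mul_mk,
        BisetClass.mk_mul_mk, BisetClass.mk_mul_mk, BisetClass.mk_eq_mk_iff.2
        ⟨BisetTensor.tensorSum⟩]
      exact burnsideRelations_mem R _ _
    | add a b ha hb => rw [add_mul]; exact add_mem ha hb
    | smul r a ha => rw [smul_mul_assoc]; exact Submodule.smul_mem _ r ha

theorem burnsideRelations_mul_right (x a : MonoidAlgebra R (BisetClass G))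
    (hx : x ∈ burnsideRelations R G) : x * a ∈ burnsideRelations R G := by
  induction hx using Submodule.span_induction with
  | zero => simp
  | add x y _ _ hx hy => rw [add_mul]; exact add_mem hx hy
  | smul r x _ hx => rw [smul_mul_assoc]; exact Submodule.smul_mem _ r hx
  | mem x hx =>
    obtain ⟨M, N, rfl⟩ := hx
    induction a using MonoidAlgebra.induction_on with
    | of b =>
      induction b using BisetClass.ind with | _ L
      rw [sub_mul, sub_mul, ← map_mul, ← map_mul, ← map_mul, BisetClass.mk_mul_mk,
        BisetClass.mk_mul_mk, BisetClass.mk_mul_mk, BisetClass.mk_eq_mk_iff.2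
        ⟨BisetTensor.sumTensor⟩]
      exact burnsideRelations_mem R _ _
    | add a b ha hb => rw [mul_add]; exact add_mem ha hb
    | smul r a ha => rw [mul_smul_comm]; exact Submodule.smul_mem _ r ha

variable (G)

/-- The submodule of relations is a two-sided ideal of the monoid algebra on the isomorphism
classes of finite bisets, as the tensor product distributes over disjoint unions. -/
noncomputable def burnsideIdeal : TwoSidedIdeal (MonoidAlgebra R (BisetClass G)) :=
  TwoSidedIdeal.mk' (burnsideRelations R G) (zero_mem _) add_mem neg_mem
    (fun {a x} => burnsideRelations_mul_left R a x)
    (fun {x a} => burnsideRelations_mul_right R x a)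

/-- The double Burnside algebra `B_R(G, G)`: the free `R`-module on the isomorphism classes of finite
`(G, G)`-bisets modulo the relations `[M ⊔ N] = [M] + [N]`, with `[M] · [N] = [M ×_G N]`. -/
abbrev DoubleBurnside : Type _ := (burnsideIdeal R G).ringCon.Quotient

end DoubleBurnside

/-! ### Path algebras

The path algebra of a quiver with finitely many vertices has the paths as an `R`-basis; the product
`p q` of two paths is the path "first `p`, then `q`" if `p` ends where `q` starts, and zero
otherwise. -/

/-- All paths of a quiver. -/
abbrev QuiverPath (V : Type*) [Quiver V] : Type _ := Σ i j : V, Quiver.Path i j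

/-- The path algebra `R V` of a quiver `V`, as the free module on the paths. -/
def PathAlgebra (R : Type*) [CommRing R] (V : Type*) [Quiver V] : Type _ := QuiverPath V →₀ R

namespace PathAlgebra

variable (R : Type*) [CommRing R] {V : Type*} [Quiver V]

noncomputable instance : AddCommGroup (PathAlgebra R V) :=
  inferInstanceAs (AddCommGroup (QuiverPath V →₀ R))

noncomputable instance : Module R (PathAlgebra R V) :=
  inferInstanceAs (Module R (QuiverPath V →₀ R))

/-- The basis element belonging to a path. -/
noncomputable def ofPath {i j : V} (p : Quiver.Path i j) : PathAlgebra R V :=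
  Finsupp.single (⟨i, j, p⟩ : QuiverPath V) (1 : R)

/-- The trivial path at a vertex. -/
noncomputable def vertex (i : V) : PathAlgebra R V := ofPath R (Quiver.Path.nil : Quiver.Path i i)

/-- The path of length one given by an arrow. -/
noncomputable def arrow {i j : V} (f : i ⟶ j) : PathAlgebra R V := ofPath R f.toPath

open scoped Classical in
/-- The product of two paths: their concatenation if they are composable, zero otherwise. -/
noncomputable def pathMul (p q : QuiverPath V) : QuiverPath V →₀ R :=
  if h : p.2.1 = q.1 then Finsupp.single ⟨p.1, q.2.1, p.2.2.comp (q.2.2.cast h.symm rfl)⟩ 1 else 0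

/-- The bilinear extension of the product of paths. -/
noncomputable def mulBilin :
    (QuiverPath V →₀ R) →ₗ[R] (QuiverPath V →₀ R) →ₗ[R] (QuiverPath V →₀ R) :=
  Finsupp.linearCombination R fun p => Finsupp.linearCombination R fun q => pathMul R p q

noncomputable instance : Mul (PathAlgebra R V) := ⟨fun a b => mulBilin R a b⟩

theorem ofPath_mul_ofPath_eq_pathMul {i j k l : V} (p : Quiver.Path i j) (q : Quiver.Path k l) :
    ofPath R p * ofPath R q = pathMul R ⟨i, j, p⟩ ⟨k, l, q⟩ := by
  change mulBilin R (Finsupp.single ⟨i, j, p⟩ 1) (Finsupp.single ⟨k, l, q⟩ 1) = _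
  rw [mulBilin, Finsupp.linearCombination_single, one_smul, Finsupp.linearCombination_single,
    one_smul]

theorem ofPath_mul_ofPath {i j k : V} (p : Quiver.Path i j) (q : Quiver.Path j k) :
    ofPath R p * ofPath R q = ofPath R (p.comp q) := by
  rw [ofPath_mul_ofPath_eq_pathMul, pathMul, dif_pos rfl]
  rfl

theorem ofPath_mul_ofPath_of_ne {i j k l : V} (p : Quiver.Path i j) (q : Quiver.Path k l)
    (h : j ≠ k) : ofPath R p * ofPath R q = 0 := by
  rw [ofPath_mul_ofPath_eq_pathMul, pathMul, dif_neg h]; rfl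

theorem induction {P : PathAlgebra R V → Prop} (a : PathAlgebra R V) (zero : P 0)
    (add : ∀ a b, P a → P b → P (a + b)) (smul : ∀ (r : R) a, P a → P (r • a))
    (path : ∀ {i j : V} (p : Quiver.Path i j), P (ofPath R p)) : P a := by
  refine Finsupp.induction_linear a zero add fun p r => ?_
  have h : r • (Finsupp.single p 1 : QuiverPath V →₀ R) = Finsupp.single p r := by simp
  rw [← h]
  exact smul r _ (path p.2.2)

protected theorem add_mul (a b c : PathAlgebra R V) : (a + b) * c = a * c + b * c :=
  LinearMap.map_add₂ (mulBilin R) a b c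

protected theorem mul_add (a b c : PathAlgebra R V) : a * (b + c) = a * b + a * c :=
  map_add (mulBilin R a) b c

protected theorem zero_mul (a : PathAlgebra R V) : 0 * a = 0 :=
  LinearMap.map_zero₂ (mulBilin R) a

protected theorem mul_zero (a : PathAlgebra R V) : a * 0 = 0 :=
  map_zero (mulBilin R a)

protected theorem smul_mul (r : R) (a b : PathAlgebra R V) : r • a * b = r • (a * b) :=
  LinearMap.map_smul₂ (mulBilin R) r a b

protected theorem mul_smul (r : R) (a b : PathAlgebra R V) : a * r • b = r • (a * b) :=
  map_smul (mulBilin R a) r b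

protected theorem mul_assoc (a b c : PathAlgebra R V) : a * b * c = a * (b * c) := by
  induction a using induction with
  | zero => simp only [PathAlgebra.zero_mul]
  | add a a' h h' => simp only [PathAlgebra.add_mul, h, h']
  | smul r a h => simp only [PathAlgebra.smul_mul, h]
  | path p =>
  induction b using induction with
  | zero => simp only [PathAlgebra.zero_mul, PathAlgebra.mul_zero]
  | add a a' h h' => simp only [PathAlgebra.add_mul, PathAlgebra.mul_add, h, h']
  | smul r a h => simp only [PathAlgebra.smul_mul, PathAlgebra.mul_smul, h]
  | path q =>
  induction c using induction with
  | zero => simp only [PathAlgebra.mul_zero]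
  | add a a' h h' => simp only [PathAlgebra.mul_add, h, h']
  | smul r a h => simp only [PathAlgebra.mul_smul, h]
  | @path i j s =>
  rename_i i₁ j₁ i₂ j₂
  by_cases h₁ : j₁ = i₂
  · subst h₁
    by_cases h₂ : j₂ = i
    · subst h₂
      simp only [ofPath_mul_ofPath, Quiver.Path.comp_assoc]
    · rw [ofPath_mul_ofPath, ofPath_mul_ofPath_of_ne R _ _ h₂, ofPath_mul_ofPath_of_ne R _ _ h₂,
        PathAlgebra.mul_zero]
  · rw [ofPath_mul_ofPath_of_ne R _ _ h₁, PathAlgebra.zero_mul]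
    by_cases h₂ : j₂ = i
    · subst h₂
      rw [ofPath_mul_ofPath, ofPath_mul_ofPath_of_ne R _ _ h₁]
    · rw [ofPath_mul_ofPath_of_ne R _ _ h₂, PathAlgebra.mul_zero]

noncomputable instance : NonUnitalRing (PathAlgebra R V) where
  left_distrib := PathAlgebra.mul_add R
  right_distrib := PathAlgebra.add_mul R
  zero_mul := PathAlgebra.zero_mul R
  mul_zero := PathAlgebra.mul_zero R
  mul_assoc := PathAlgebra.mul_assoc R

variable [Fintype V]

noncomputable instance : One (PathAlgebra R V) := ⟨∑ i, vertex R i⟩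

theorem one_def : (1 : PathAlgebra R V) = ∑ i, vertex R i := rfl

protected theorem one_mul (a : PathAlgebra R V) : 1 * a = a := by
  induction a using induction with
  | zero => exact PathAlgebra.mul_zero R 1
  | add a b h h' => rw [PathAlgebra.mul_add, h, h']
  | smul r a h => rw [PathAlgebra.mul_smul, h]
  | @path i j p =>
    rw [one_def, Finset.sum_mul, Finset.sum_eq_single i]
    · exact (ofPath_mul_ofPath R _ p).trans (by rw [Quiver.Path.nil_comp])
    · exact fun k _ hk => ofPath_mul_ofPath_of_ne R _ p hk
    · simp

protected theorem mul_one (a : PathAlgebra R V) : a * 1 = a := by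
  induction a using induction with
  | zero => exact PathAlgebra.zero_mul R 1
  | add a b h h' => rw [PathAlgebra.add_mul, h, h']
  | smul r a h => rw [PathAlgebra.smul_mul, h]
  | @path i j p =>
    rw [one_def, Finset.mul_sum, Finset.sum_eq_single j]
    · exact (ofPath_mul_ofPath R p _).trans (by rw [Quiver.Path.comp_nil])
    · exact fun k _ hk => ofPath_mul_ofPath_of_ne R p _ hk.symm
    · simp

noncomputable instance : Ring (PathAlgebra R V) where
  __ := (inferInstance : NonUnitalRing (PathAlgebra R V))
  one_mul := PathAlgebra.one_mul R
  mul_one := PathAlgebra.mul_one R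

noncomputable instance : Algebra R (PathAlgebra R V) :=
  Algebra.ofModule (PathAlgebra.smul_mul R) (PathAlgebra.mul_smul R)

end PathAlgebra

/-! ### The quiver and its relations -/

/-- The vertices of the quiver. -/
inductive PsiVertex
  | e3 | e4 | e5
  deriving DecidableEq

instance : Fintype PsiVertex := ⟨{.e3, .e4, .e5}, fun i => by cases i <;> simp⟩

/-- The arrows of the quiver: `τ₁ : e₅ → e₃`, `τ₂ : e₃ → e₅`, `τ₃ : e₅ → e₄`, `τ₄ : e₄ → e₅`,
`τ₇ : e₅ → e₅`. -/
inductive PsiArrow : PsiVertex → PsiVertex → Type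
  | t1 : PsiArrow .e5 .e3
  | t2 : PsiArrow .e3 .e5
  | t3 : PsiArrow .e5 .e4
  | t4 : PsiArrow .e4 .e5
  | t7 : PsiArrow .e5 .e5

instance : Quiver PsiVertex := ⟨PsiArrow⟩

namespace Psi

variable (R : Type*) [CommRing R]

noncomputable def t1 : PathAlgebra R PsiVertex := PathAlgebra.arrow R (V := PsiVertex) PsiArrow.t1
noncomputable def t2 : PathAlgebra R PsiVertex := PathAlgebra.arrow R (V := PsiVertex) PsiArrow.t2
noncomputable def t3 : PathAlgebra R PsiVertex := PathAlgebra.arrow R (V := PsiVertex) PsiArrow.t3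
noncomputable def t4 : PathAlgebra R PsiVertex := PathAlgebra.arrow R (V := PsiVertex) PsiArrow.t4
noncomputable def t7 : PathAlgebra R PsiVertex := PathAlgebra.arrow R (V := PsiVertex) PsiArrow.t7

/-- The ideal `I` of relations. -/
noncomputable def ideal : TwoSidedIdeal (PathAlgebra R PsiVertex) :=
  TwoSidedIdeal.span
    {t2 R * t1 R, t2 R * t3 R, t2 R * t7 R - 2 * t2 R,
     t4 R * t1 R, t4 R * t3 R, t4 R * t7 R - 2 * t4 R,
     t7 R * t1 R - 2 * t1 R, t7 R * t3 R - 2 * t3 R, t7 R ^ 2 - 2 * t7 R - t1 R * t2 R}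

/-- The path algebra modulo relations `R Ψ / I`. -/
abbrev PsiQuot : Type _ := (ideal R).ringCon.Quotient

/-- The residue class `a + I`. -/
noncomputable def toQuot (a : PathAlgebra R PsiVertex) : PsiQuot R := (ideal R).ringCon.mk' a

end Psi

/-! ### The order `A_R` and its suborder given by congruences -/

/-- The elements of `A_R`, written as matrices
```
[ s  0  0  t                ]
[ 0  u  0  v                ]
[ 0  0  w  0                ]
[ x  y  0  z₁ + z₂ η + z₃ ξ ]
```
with a `3 × 3` block `s`, a column `t` and a row `x` of length `3`, and with the last entry in
`R[η, ξ]/(η², η ξ, ξ²)`. -/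
@[ext] structure OrderA (R : Type*) where
  s : Matrix (Fin 3) (Fin 3) R
  t : Fin 3 → R
  u : R
  v : R
  w : R
  x : Fin 3 → R
  y : R
  z1 : R
  z2 : R
  z3 : R

namespace OrderA

variable {R : Type*} [CommRing R]

instance : Zero (OrderA R) := ⟨⟨0, 0, 0, 0, 0, 0, 0, 0, 0, 0⟩⟩

instance : One (OrderA R) := ⟨⟨1, 0, 1, 0, 1, 0, 0, 1, 0, 0⟩⟩

instance : Add (OrderA R) :=
  ⟨fun a b => ⟨a.s + b.s, a.t + b.t, a.u + b.u, a.v + b.v, a.w + b.w, a.x + b.x, a.y + b.y,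
    a.z1 + b.z1, a.z2 + b.z2, a.z3 + b.z3⟩⟩

instance : Neg (OrderA R) :=
  ⟨fun a => ⟨-a.s, -a.t, -a.u, -a.v, -a.w, -a.x, -a.y, -a.z1, -a.z2, -a.z3⟩⟩

instance : SMul R (OrderA R) :=
  ⟨fun r a => ⟨r • a.s, r • a.t, r * a.u, r * a.v, r * a.w, r • a.x, r * a.y, r * a.z1, r * a.z2,
    r * a.z3⟩⟩

/-- The multiplication is matrix multiplication, where a product of a column and a row, or of `v` and
`y`, is zero in the upper left part, where `η` and `ξ` act as zero on rows and columns, and where the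
products of a row `x` with a column `t`, and of `y` with `v`, are
`x t η` and `y v (ξ - 12 η)`, respectively. -/
instance : Mul (OrderA R) :=
  ⟨fun a b =>
    { s := a.s * b.s
      t := a.s.mulVec b.t + b.z1 • a.t
      u := a.u * b.u
      v := a.u * b.v + a.v * b.z1
      w := a.w * b.w
      x := Matrix.vecMul a.x b.s + a.z1 • b.x
      y := a.y * b.u + a.z1 * b.y
      z1 := a.z1 * b.z1
      z2 := a.z1 * b.z2 + a.z2 * b.z1 + a.x ⬝ᵥ b.t - 12 * (a.y * b.v)
      z3 := a.z1 * b.z3 + a.z3 * b.z1 + a.y * b.v }⟩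

section Lemmas

variable (a b : OrderA R) (r : R)

@[simp] theorem zero_s : (0 : OrderA R).s = 0 := rfl
@[simp] theorem zero_t : (0 : OrderA R).t = 0 := rfl
@[simp] theorem zero_u : (0 : OrderA R).u = 0 := rfl
@[simp] theorem zero_v : (0 : OrderA R).v = 0 := rfl
@[simp] theorem zero_w : (0 : OrderA R).w = 0 := rfl
@[simp] theorem zero_x : (0 : OrderA R).x = 0 := rfl
@[simp] theorem zero_y : (0 : OrderA R).y = 0 := rfl
@[simp] theorem zero_z1 : (0 : OrderA R).z1 = 0 := rfl
@[simp] theorem zero_z2 : (0 : OrderA R).z2 = 0 := rfl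
@[simp] theorem zero_z3 : (0 : OrderA R).z3 = 0 := rfl
@[simp] theorem one_s : (1 : OrderA R).s = 1 := rfl
@[simp] theorem one_t : (1 : OrderA R).t = 0 := rfl
@[simp] theorem one_u : (1 : OrderA R).u = 1 := rfl
@[simp] theorem one_v : (1 : OrderA R).v = 0 := rfl
@[simp] theorem one_w : (1 : OrderA R).w = 1 := rfl
@[simp] theorem one_x : (1 : OrderA R).x = 0 := rfl
@[simp] theorem one_y : (1 : OrderA R).y = 0 := rfl
@[simp] theorem one_z1 : (1 : OrderA R).z1 = 1 := rfl
@[simp] theorem one_z2 : (1 : OrderA R).z2 = 0 := rfl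
@[simp] theorem one_z3 : (1 : OrderA R).z3 = 0 := rfl
@[simp] theorem add_s : (a + b).s = a.s + b.s := rfl
@[simp] theorem add_t : (a + b).t = a.t + b.t := rfl
@[simp] theorem add_u : (a + b).u = a.u + b.u := rfl
@[simp] theorem add_v : (a + b).v = a.v + b.v := rfl
@[simp] theorem add_w : (a + b).w = a.w + b.w := rfl
@[simp] theorem add_x : (a + b).x = a.x + b.x := rfl
@[simp] theorem add_y : (a + b).y = a.y + b.y := rfl
@[simp] theorem add_z1 : (a + b).z1 = a.z1 + b.z1 := rfl
@[simp] theorem add_z2 : (a + b).z2 = a.z2 + b.z2 := rfl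
@[simp] theorem add_z3 : (a + b).z3 = a.z3 + b.z3 := rfl
@[simp] theorem neg_s : (-a).s = -a.s := rfl
@[simp] theorem neg_t : (-a).t = -a.t := rfl
@[simp] theorem neg_u : (-a).u = -a.u := rfl
@[simp] theorem neg_v : (-a).v = -a.v := rfl
@[simp] theorem neg_w : (-a).w = -a.w := rfl
@[simp] theorem neg_x : (-a).x = -a.x := rfl
@[simp] theorem neg_y : (-a).y = -a.y := rfl
@[simp] theorem neg_z1 : (-a).z1 = -a.z1 := rfl
@[simp] theorem neg_z2 : (-a).z2 = -a.z2 := rfl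
@[simp] theorem neg_z3 : (-a).z3 = -a.z3 := rfl
@[simp] theorem smul_s : (r • a).s = r • a.s := rfl
@[simp] theorem smul_t : (r • a).t = r • a.t := rfl
@[simp] theorem smul_u : (r • a).u = r * a.u := rfl
@[simp] theorem smul_v : (r • a).v = r * a.v := rfl
@[simp] theorem smul_w : (r • a).w = r * a.w := rfl
@[simp] theorem smul_x : (r • a).x = r • a.x := rfl
@[simp] theorem smul_y : (r • a).y = r * a.y := rfl
@[simp] theorem smul_z1 : (r • a).z1 = r * a.z1 := rfl
@[simp] theorem smul_z2 : (r • a).z2 = r * a.z2 := rfl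
@[simp] theorem smul_z3 : (r • a).z3 = r * a.z3 := rfl
@[simp] theorem mul_s : (a * b).s = a.s * b.s := rfl
@[simp] theorem mul_t : (a * b).t = a.s.mulVec b.t + b.z1 • a.t := rfl
@[simp] theorem mul_u : (a * b).u = a.u * b.u := rfl
@[simp] theorem mul_v : (a * b).v = a.u * b.v + a.v * b.z1 := rfl
@[simp] theorem mul_w : (a * b).w = a.w * b.w := rfl
@[simp] theorem mul_x : (a * b).x = Matrix.vecMul a.x b.s + a.z1 • b.x := rfl
@[simp] theorem mul_y : (a * b).y = a.y * b.u + a.z1 * b.y := rfl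
@[simp] theorem mul_z1 : (a * b).z1 = a.z1 * b.z1 := rfl
@[simp] theorem mul_z2 : (a * b).z2 =
    a.z1 * b.z2 + a.z2 * b.z1 + a.x ⬝ᵥ b.t - 12 * (a.y * b.v) := rfl
@[simp] theorem mul_z3 : (a * b).z3 = a.z1 * b.z3 + a.z3 * b.z1 + a.y * b.v := rfl

end Lemmas

instance : AddCommGroup (OrderA R) where
  add_assoc a b c := by ext <;> simp [add_assoc]
  zero_add a := by ext <;> simp
  add_zero a := by ext <;> simp
  add_comm a b := by ext <;> simp [add_comm]
  neg_add_cancel a := by ext <;> simp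
  nsmul := nsmulRec
  zsmul := zsmulRec

instance : Module R (OrderA R) where
  one_smul a := by ext <;> simp
  mul_smul r r' a := by ext <;> simp [mul_assoc]
  smul_zero r := by ext <;> simp
  smul_add r a b := by ext <;> simp [mul_add]
  add_smul r r' a := by ext <;> simp [add_mul]
  zero_smul a := by ext <;> simp

instance : Ring (OrderA R) where
  __ := (inferInstance : AddCommGroup (OrderA R))
  left_distrib a b c := by
    ext <;> simp [mul_add, Matrix.mulVec_add, add_smul, Matrix.vecMul_add, smul_add,
      dotProduct_add] <;> ring
  right_distrib a b c := by
    ext <;> simp [add_mul, Matrix.add_mulVec, add_smul, Matrix.add_vecMul, smul_add,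
      add_dotProduct] <;> ring
  zero_mul a := by ext <;> simp
  mul_zero a := by ext <;> simp
  mul_assoc a b c := by
    ext <;> simp [Matrix.mulVec, Matrix.vecMul, dotProduct, Fin.sum_univ_three,
      Matrix.mul_apply] <;> ring
  one_mul a := by ext <;> simp
  mul_one a := by ext <;> simp

instance : Algebra R (OrderA R) :=
  Algebra.ofModule
    (fun r a b => by
      ext <;> simp [Matrix.mulVec, Matrix.vecMul, dotProduct, Fin.sum_univ_three,
        Matrix.mul_apply] <;> ring)
    (fun r a b => by
      ext <;> simp [Matrix.mulVec, Matrix.vecMul, dotProduct, Fin.sum_univ_three,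
        Matrix.mul_apply] <;> ring)

end OrderA

/-- The suborder `Λ` of `A_R` given by the congruences
`2w - 2z₁ ≡ z₂ mod 8`, `z₂ ≡ z₃ ≡ 0 mod 4`, `xᵢ ≡ 0 mod 4`, `y ≡ tᵢ ≡ v ≡ 0 mod 2`. -/
def Lambda (R : Type*) [CommRing R] : Subalgebra R (OrderA R) where
  carrier := {a | 8 ∣ (2 * a.w - 2 * a.z1) - a.z2 ∧ 4 ∣ a.z2 - a.z3 ∧ 4 ∣ a.z3 ∧
    (∀ i, 4 ∣ a.x i) ∧ 2 ∣ a.y ∧ (∀ i, 2 ∣ a.t i) ∧ 2 ∣ a.v}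
  add_mem' := by
    rintro a b ⟨⟨k, ha⟩, ha2, ha3, hax, hay, hat, hav⟩ ⟨⟨l, hb⟩, hb2, hb3, hbx, hby, hbt, hbv⟩
    refine ⟨⟨k + l, ?_⟩, ?_, dvd_add ha3 hb3, fun i => dvd_add (hax i) (hbx i), dvd_add hay hby,
      fun i => dvd_add (hat i) (hbt i), dvd_add hav hbv⟩
    · simp only [OrderA.add_w, OrderA.add_z1, OrderA.add_z2]
      linear_combination ha + hb
    · simpa only [OrderA.add_z2, OrderA.add_z3, add_sub_add_comm] using dvd_add ha2 hb2
  mul_mem' := by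
    rintro a b ⟨⟨k, ha⟩, ⟨a2, ha2⟩, ⟨a3, ha3⟩, hax, ⟨ay, hay⟩, hat, ⟨av, hav⟩⟩
      ⟨⟨l, hb⟩, ⟨b2, hb2⟩, ⟨b3, hb3⟩, hbx, ⟨by', hby⟩, hbt, ⟨bv, hbv⟩⟩
    have hXT : ∃ c, a.x ⬝ᵥ b.t = 8 * c := by
      refine Finset.dvd_sum fun i _ => ?_
      have := mul_dvd_mul (hax i) (hbt i)
      norm_num at this
      exact this
    obtain ⟨c, hc⟩ := hXT
    have ha2' : a.z2 = 4 * (a2 + a3) := by linear_combination ha2 + ha3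
    have hb2' : b.z2 = 4 * (b2 + b3) := by linear_combination hb2 + hb3
    refine ⟨⟨a.z1 * l + (a2 + a3) * (b2 + b3) + 2 * (a2 + a3) * l + k * b.w - c + 6 * ay * bv, ?_⟩,
      ⟨a.z1 * (b2 + b3) + (a2 + a3) * b.z1 + 2 * c - 13 * (ay * bv) - a.z1 * b3 - a3 * b.z1, ?_⟩,
      ⟨a.z1 * b3 + a3 * b.z1 + ay * bv, ?_⟩, fun i => ?_, ?_, fun i => ?_, ?_⟩
    · simp only [OrderA.mul_w, OrderA.mul_z1, OrderA.mul_z2, hc, hay, hbv]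
      rw [ha2'] at ha ⊢
      rw [hb2'] at hb ⊢
      linear_combination b.w * ha + (a.z1 + 2 * (a2 + a3)) * hb
    · simp only [OrderA.mul_z2, OrderA.mul_z3, hc, hay, hbv, ha2', hb2', ha3, hb3]
      ring
    · simp only [OrderA.mul_z3, hay, hbv, ha3, hb3]
      ring
    · have h : 4 ∣ Matrix.vecMul a.x b.s i := by
        simp only [Matrix.vecMul, dotProduct]
        exact Finset.dvd_sum fun j _ => Dvd.dvd.mul_right (hax j) _
      exact dvd_add h (Dvd.dvd.mul_left (hbx i) _)
    · exact dvd_add (Dvd.dvd.mul_right ⟨ay, hay⟩ _) (Dvd.dvd.mul_left ⟨by', hby⟩ _)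
    · have h : 2 ∣ a.s.mulVec b.t i := by
        simp only [Matrix.mulVec, dotProduct]
        exact Finset.dvd_sum fun j _ => Dvd.dvd.mul_left (hbt j) _
      exact dvd_add h (Dvd.dvd.mul_left (hat i) _)
    · exact dvd_add (Dvd.dvd.mul_left ⟨bv, hbv⟩ _) (Dvd.dvd.mul_right ⟨av, hav⟩ _)
  algebraMap_mem' r := by
    rw [Algebra.algebraMap_eq_smul_one]
    simp

/-! ### The corner algebra -/

/-- A corner `e A e` of an `R`-algebra `A` at an idempotent `e` is an `R`-algebra. -/
instance cornerAlgebra {R A : Type*} [CommRing R] [Ring A] [Algebra R A] {e : A}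
    (he : IsIdempotentElem e) : Algebra R he.Corner :=
  letI : Module R he.Corner :=
    { smul := fun r a => ⟨r • a.1, by
        obtain ⟨b, hb⟩ := a.2
        exact ⟨r • b, by simp only [mul_smul_comm, smul_mul_assoc, ← hb]⟩⟩
      one_smul := fun a => Subtype.ext (one_smul R a.1)
      mul_smul := fun r r' a => Subtype.ext (mul_smul r r' a.1)
      smul_zero := fun r => Subtype.ext (smul_zero r)
      smul_add := fun r a b => Subtype.ext (smul_add r a.1 b.1)
      add_smul := fun r r' a => Subtype.ext (add_smul r r' a.1)
      zero_smul := fun a => Subtype.ext (zero_smul R a.1) }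
  Algebra.ofModule (fun r a b => Subtype.ext (smul_mul_assoc r a.1 b.1))
    (fun r a b => Subtype.ext (mul_smul_comm r a.1 b.1))

namespace Lambda

variable (R : Type*) [CommRing R]

/-- `e₃`: the only nonzero entry is a `1` at position `(3, 3)` of the block `s`. -/
def e3 : Lambda R :=
  ⟨⟨Matrix.single 2 2 1, 0, 0, 0, 0, 0, 0, 0, 0, 0⟩, by simp [Lambda]⟩

/-- `e₄`: the only nonzero entry is `u = 1`. -/
def e4 : Lambda R := ⟨⟨0, 0, 1, 0, 0, 0, 0, 0, 0, 0⟩, by simp [Lambda]⟩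

/-- `e₅`: the only nonzero entries are `w = 1` and `z₁ = 1`. -/
def e5 : Lambda R := ⟨⟨0, 0, 0, 0, 1, 0, 0, 1, 0, 0⟩, by simp [Lambda]⟩

/-- `τ₁`: the only nonzero entry is `x₃ = 4`. -/
def t1 : Lambda R :=
  ⟨⟨0, 0, 0, 0, 0, ![0, 0, 4], 0, 0, 0, 0⟩, by simp [Lambda, Fin.forall_fin_succ]⟩

/-- `τ₂`: the only nonzero entry is `t₃ = 2`. -/
def t2 : Lambda R :=
  ⟨⟨0, ![0, 0, 2], 0, 0, 0, 0, 0, 0, 0, 0⟩, by simp [Lambda, Fin.forall_fin_succ]⟩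

/-- `τ₃`: the only nonzero entry is `y = 2`. -/
def t3 : Lambda R := ⟨⟨0, 0, 0, 0, 0, 0, 2, 0, 0, 0⟩, by simp [Lambda]⟩

/-- `τ₄`: the only nonzero entry is `v = 2`. -/
def t4 : Lambda R := ⟨⟨0, 0, 0, 2, 0, 0, 0, 0, 0, 0⟩, by simp [Lambda]⟩

/-- `τ₇`: the only nonzero entry is the last one, which is `2 + 4 η`. -/
def t7 : Lambda R := ⟨⟨0, 0, 0, 0, 0, 0, 0, 2, 4, 0⟩, ⟨⟨-1, by norm_num⟩, by simp⟩⟩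

/-- The idempotent `e₃ + e₄ + e₅`. -/
def e345 : Lambda R := e3 R + e4 R + e5 R

theorem e345_idem : IsIdempotentElem (e345 R) := by
  refine Subtype.ext ?_
  change ((e3 R : OrderA R) + e4 R + e5 R) * (e3 R + e4 R + e5 R) = e3 R + e4 R + e5 R
  ext i j <;> simp [e3, e4, e5]

/-- The corner algebra `Λ' = (e₃ + e₄ + e₅) Λ (e₃ + e₄ + e₅)`. -/
abbrev Corner : Type _ := (e345_idem R).Corner

/-- An element `a` of `Λ` with `(e₃ + e₄ + e₅) a (e₃ + e₄ + e₅) = a`, as an element of `Λ'`. -/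
def toCorner (a : Lambda R) (ha : e345 R * a * e345 R = a) : Corner R := ⟨a, a, ha⟩

namespace Corner

/-- `e₃` as an element of `Λ'`. -/
def e3 : Corner R := toCorner R (Lambda.e3 R) <| Subtype.ext <| by
  change ((Lambda.e3 R : OrderA R) + Lambda.e4 R + Lambda.e5 R) * Lambda.e3 R *
    (Lambda.e3 R + Lambda.e4 R + Lambda.e5 R) = Lambda.e3 R
  ext i <;> simp [Lambda.e3, Lambda.e4, Lambda.e5]

/-- `e₄` as an element of `Λ'`. -/
def e4 : Corner R := toCorner R (Lambda.e4 R) <| Subtype.ext <| by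
  change ((Lambda.e3 R : OrderA R) + Lambda.e4 R + Lambda.e5 R) * Lambda.e4 R *
    (Lambda.e3 R + Lambda.e4 R + Lambda.e5 R) = Lambda.e4 R
  ext i <;> simp [Lambda.e3, Lambda.e4, Lambda.e5]

/-- `e₅` as an element of `Λ'`. -/
def e5 : Corner R := toCorner R (Lambda.e5 R) <| Subtype.ext <| by
  change ((Lambda.e3 R : OrderA R) + Lambda.e4 R + Lambda.e5 R) * Lambda.e5 R *
    (Lambda.e3 R + Lambda.e4 R + Lambda.e5 R) = Lambda.e5 R
  ext i <;> simp [Lambda.e3, Lambda.e4, Lambda.e5]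

/-- `τ₁` as an element of `Λ'`. -/
def t1 : Corner R := toCorner R (Lambda.t1 R) <| Subtype.ext <| by
  change ((Lambda.e3 R : OrderA R) + Lambda.e4 R + Lambda.e5 R) * Lambda.t1 R *
    (Lambda.e3 R + Lambda.e4 R + Lambda.e5 R) = Lambda.t1 R
  ext i <;> simp [Lambda.e3, Lambda.e4, Lambda.e5, Lambda.t1]
  fin_cases i <;> simp [Matrix.vecMul, dotProduct, Matrix.single]

/-- `τ₂` as an element of `Λ'`. -/
def t2 : Corner R := toCorner R (Lambda.t2 R) <| Subtype.ext <| by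
  change ((Lambda.e3 R : OrderA R) + Lambda.e4 R + Lambda.e5 R) * Lambda.t2 R *
    (Lambda.e3 R + Lambda.e4 R + Lambda.e5 R) = Lambda.t2 R
  ext i <;> simp [Lambda.e3, Lambda.e4, Lambda.e5, Lambda.t2]
  fin_cases i <;> simp [Matrix.mulVec, dotProduct, Matrix.single]

/-- `τ₃` as an element of `Λ'`. -/
def t3 : Corner R := toCorner R (Lambda.t3 R) <| Subtype.ext <| by
  change ((Lambda.e3 R : OrderA R) + Lambda.e4 R + Lambda.e5 R) * Lambda.t3 R *
    (Lambda.e3 R + Lambda.e4 R + Lambda.e5 R) = Lambda.t3 R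
  ext i <;> simp [Lambda.e3, Lambda.e4, Lambda.e5, Lambda.t3]

/-- `τ₄` as an element of `Λ'`. -/
def t4 : Corner R := toCorner R (Lambda.t4 R) <| Subtype.ext <| by
  change ((Lambda.e3 R : OrderA R) + Lambda.e4 R + Lambda.e5 R) * Lambda.t4 R *
    (Lambda.e3 R + Lambda.e4 R + Lambda.e5 R) = Lambda.t4 R
  ext i <;> simp [Lambda.e3, Lambda.e4, Lambda.e5, Lambda.t4]

/-- `τ₇` as an element of `Λ'`. -/
def t7 : Corner R := toCorner R (Lambda.t7 R) <| Subtype.ext <| by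
  change ((Lambda.e3 R : OrderA R) + Lambda.e4 R + Lambda.e5 R) * Lambda.t7 R *
    (Lambda.e3 R + Lambda.e4 R + Lambda.e5 R) = Lambda.t7 R
  ext i <;> simp [Lambda.e3, Lambda.e4, Lambda.e5, Lambda.t7]

end Corner

end Lambda

/-! ### The base ring -/

instance span_two_isPrime : (Ideal.span {(2 : ℤ)}).IsPrime :=
  (Ideal.span_singleton_prime two_ne_zero).2 Int.prime_two

/-- The localization of `ℤ` at the prime ideal `(2)`. -/
abbrev ZLocTwo : Type := Localization.AtPrime (Ideal.span {(2 : ℤ)})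

/-! ### Morita equivalence with the corner at a full idempotent -/

section Corner

universe u v

open CategoryTheory

variable {A : Type u} [Ring A] {e : A}

/-- The part `e M` of an `A`-module `M` on which the idempotent `e` acts as the identity. -/
def idemPart (e : A) (M : Type v) [AddCommGroup M] [Module A M] : AddSubgroup M where
  carrier := {m | e • m = m}
  zero_mem' := smul_zero e
  add_mem' {a b} ha hb := by
    change e • (a + b) = a + b
    rw [smul_add, show e • a = a from ha, show e • b = b from hb]
  neg_mem' {a} ha := by
    change e • -a = -a
    rw [smul_neg, show e • a = a from ha]

namespace idemPart

variable {M : Type v} [AddCommGroup M] [Module A M]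

theorem mem_iff {m : M} : m ∈ idemPart e M ↔ e • m = m := Iff.rfl

theorem smul_coe (m : idemPart e M) : e • (m : M) = m := m.2

theorem corner_mul_left (he : IsIdempotentElem e) (c : he.Corner) : e * c.1 = c.1 :=
  ((Subsemigroup.mem_corner_iff he).1 c.2).1

theorem corner_mul_right (he : IsIdempotentElem e) (c : he.Corner) : c.1 * e = c.1 :=
  ((Subsemigroup.mem_corner_iff he).1 c.2).2

/-- `e M` is a module over the corner `e A e`. -/
instance (he : IsIdempotentElem e) : Module he.Corner (idemPart e M) where
  smul c m := ⟨c.1 • (m : M), by rw [mem_iff, smul_smul, corner_mul_left]⟩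
  one_smul m := Subtype.ext m.2
  mul_smul c d m := Subtype.ext (mul_smul c.1 d.1 (m : M))
  smul_zero c := Subtype.ext (smul_zero c.1)
  smul_add c m m' := Subtype.ext (smul_add c.1 (m : M) m')
  add_smul c d m := Subtype.ext (add_smul c.1 d.1 (m : M))
  zero_smul m := Subtype.ext (zero_smul A (m : M))

theorem corner_smul_coe (he : IsIdempotentElem e) (c : he.Corner) (m : idemPart e M) :
    ((c • m : idemPart e M) : M) = c.1 • (m : M) := rfl

/-- The projection `m ↦ e m` onto `e M`. -/
def proj (he : IsIdempotentElem e) (m : M) : idemPart e M :=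
  ⟨e • m, by rw [mem_iff, smul_smul, he.eq]⟩

end idemPart

open idemPart

variable (he : IsIdempotentElem e)

/-- The functor `M ↦ e M` from `A`-modules to `e A e`-modules. -/
def cornerFunctor : ModuleCat.{v} A ⥤ ModuleCat.{v} he.Corner where
  obj M := ModuleCat.of he.Corner (idemPart e M)
  map {M M'} f := ModuleCat.ofHom
    { toFun := fun m => ⟨f.hom (m : M), by rw [mem_iff, ← map_smul, smul_coe]⟩
      map_add' := fun m m' => Subtype.ext (map_add f.hom (m : M) m')
      map_smul' := fun c m => Subtype.ext (map_smul f.hom c.1 (m : M)) }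

theorem cornerFunctor_map_coe {M M' : ModuleCat.{v} A} (f : M ⟶ M') (m : idemPart e M) :
    (((cornerFunctor he).map f).hom m : idemPart e M').1 = f.hom m.1 := rfl

section Full

variable {ι : Type} [Fintype ι] (a b : ι → A) (hab : ∑ i, a i * e * b i = 1)

include hab

theorem eq_sum_smul_proj {M : Type v} [AddCommGroup M] [Module A M] (m : M) :
    m = ∑ i, a i • (proj he (b i • m) : M) := by
  conv_lhs => rw [← one_smul A m, ← hab, Finset.sum_smul]
  exact Finset.sum_congr rfl fun i _ => by simp only [proj, smul_smul, mul_assoc]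

theorem cornerFunctor_faithful : (cornerFunctor.{u, v} he).Faithful where
  map_injective {M M'} f g h := by
    ext m
    rw [eq_sum_smul_proj he a b hab m, map_sum, map_sum]
    refine Finset.sum_congr rfl fun i _ => ?_
    rw [map_smul, map_smul, ← cornerFunctor_map_coe he f, ← cornerFunctor_map_coe he g, h]

theorem exists_linearMap_extending {M M' : Type v} [AddCommGroup M] [Module A M] [AddCommGroup M']
    [Module A M'] (g : idemPart e M →ₗ[he.Corner] idemPart e M') :
    ∃ f : M →ₗ[A] M', ∀ m : idemPart e M, f m = g m := by
  have key : ∀ (i : ι) (c : A) (m : M), (g (proj he (b i • c • m)) : M')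
      = ∑ j, (e * b i * c * a j * e) • (g (proj he (b j • m)) : M') := by
    intro i c m
    let d : ι → he.Corner := fun j => ⟨e * (b i * c * a j) * e, _, rfl⟩
    have h : proj he (b i • c • m) = ∑ j, d j • proj he (b j • m) := by
      refine Subtype.ext ?_
      conv_lhs => rw [eq_sum_smul_proj he a b hab m]
      rw [AddSubgroup.val_finsetSum]
      simp only [proj, Finset.smul_sum]
      refine Finset.sum_congr rfl fun j _ => ?_
      rw [corner_smul_coe]
      simp only [smul_smul, d]
      congr 1
      simp only [mul_assoc]
      rw [← mul_assoc e e, he.eq]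
    rw [h, map_sum, AddSubgroup.val_finsetSum]
    refine Finset.sum_congr rfl fun j _ => ?_
    rw [map_smul, corner_smul_coe]
    simp only [d, mul_assoc]
  refine ⟨{ toFun := fun m => ∑ i, a i • (g (proj he (b i • m)) : M'), map_add' := ?_,
            map_smul' := ?_ }, fun m => ?_⟩
  · intro m m'
    rw [← Finset.sum_add_distrib]
    refine Finset.sum_congr rfl fun i _ => ?_
    have : proj he (b i • (m + m')) = proj he (b i • m) + proj he (b i • m') :=
      Subtype.ext (by simp [proj])
    rw [this, map_add, ← smul_add]
    rfl
  · intro c m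
    simp only [key, RingHom.id_apply, Finset.smul_sum]
    rw [Finset.sum_comm]
    refine Finset.sum_congr rfl fun j _ => ?_
    simp only [smul_smul]
    rw [← Finset.sum_smul]
    conv_rhs => rw [← smul_coe (e := e) (g (proj he (b j • m))), smul_smul]
    congr 1
    have h : ∑ i, a i * (e * b i * c * a j * e) = (∑ i, a i * e * b i) * (c * a j * e) := by
      rw [Finset.sum_mul]
      exact Finset.sum_congr rfl fun i _ => by simp only [mul_assoc]
    rw [h, hab, one_mul, mul_assoc]
  · have h : ∀ i, (g (proj he (b i • (m : M))) : M') = (e * b i * e) • (g m : M') := fun i => by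
      let d : he.Corner := ⟨e * b i * e, _, rfl⟩
      have : proj he (b i • (m : M)) = d • m := by
        refine Subtype.ext ?_
        rw [corner_smul_coe]
        conv_lhs => rw [← smul_coe m]
        simp only [proj, smul_smul, mul_assoc, d]
      rw [this, map_smul, corner_smul_coe]
    change ∑ i, a i • (g (proj he (b i • (m : M))) : M') = (g m : M')
    simp only [h, smul_smul]
    rw [← Finset.sum_smul]
    conv_rhs => rw [← smul_coe (e := e) (g m)]
    congr 1
    calc ∑ i, a i * (e * b i * e) = (∑ i, a i * e * b i) * e := by
          rw [Finset.sum_mul]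
          exact Finset.sum_congr rfl fun i _ => by simp only [mul_assoc]
      _ = e := by rw [hab, one_mul]

theorem cornerFunctor_full : (cornerFunctor.{u, v} he).Full where
  map_surjective {M M'} g := by
    obtain ⟨f, hf⟩ := exists_linearMap_extending he a b hab (M := M) (M' := M') g.hom
    exact ⟨ModuleCat.ofHom f, ModuleCat.hom_ext (LinearMap.ext fun m => Subtype.ext (hf m))⟩

end Full

/-- The `A`-module of `e A e`-linear maps from `e A` to an `e A e`-module `N`. -/
def CornerCoind (N : Type v) [AddCommGroup N] [Module he.Corner N] : Type _ :=
  idemPart e A →ₗ[he.Corner] N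

namespace CornerCoind

variable {N : Type v} [AddCommGroup N] [Module he.Corner N]

instance : AddCommGroup (CornerCoind he N) :=
  inferInstanceAs (AddCommGroup (idemPart e A →ₗ[he.Corner] N))

/-- Right multiplication by `a` on `e A`. -/
def mulRight (a : A) : idemPart e A →ₗ[he.Corner] idemPart e A where
  toFun x := ⟨x.1 * a, by rw [mem_iff, smul_eq_mul, ← mul_assoc]; exact congrArg (· * a) x.2⟩
  map_add' x y := Subtype.ext (add_mul x.1 y.1 a)
  map_smul' c x := Subtype.ext (mul_assoc c.1 x.1 a)

instance : Module A (CornerCoind he N) where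
  smul a f := f.comp (mulRight he a)
  one_smul f := LinearMap.ext fun x => congrArg f.toFun (Subtype.ext (mul_one x.1))
  mul_smul a a' f := LinearMap.ext fun x => congrArg f.toFun (Subtype.ext (mul_assoc x.1 a a').symm)
  smul_zero _ := LinearMap.zero_comp _
  smul_add _ _ _ := LinearMap.add_comp _ _ _
  add_smul a a' f := LinearMap.ext fun x =>
    (congrArg f.toFun (Subtype.ext (mul_add x.1 a a'))).trans (f.map_add' _ _)
  zero_smul f := LinearMap.ext fun x =>
    (congrArg f.toFun (Subtype.ext (mul_zero x.1) : mulRight he 0 x = 0)).trans (LinearMap.map_zero f)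

/-- The value of a coinduced element at `x`. -/
def eval (f : CornerCoind he N) (x : idemPart e A) : N :=
  (show idemPart e A →ₗ[he.Corner] N from f) x

variable {he} in
theorem ext {f g : CornerCoind he N} (h : ∀ x, f.eval he x = g.eval he x) : f = g :=
  LinearMap.ext h

theorem eval_smul (f : CornerCoind he N) (c : he.Corner) (x : idemPart e A) :
    f.eval he (c • x) = c • f.eval he x :=
  LinearMap.map_smul (show idemPart e A →ₗ[he.Corner] N from f) c x

theorem smul_eval (a : A) (f : CornerCoind he N) (x : idemPart e A) :
    (a • f).eval he x = f.eval he (mulRight he a x) := rfl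

/-- The element `e` of `e A`. -/
def unit : idemPart e A := ⟨e, he.eq⟩

/-- Evaluation at `e` identifies the `e`-part of the coinduced module with `N`. -/
noncomputable def evalEquiv : idemPart e (CornerCoind he N) ≃ₗ[he.Corner] N :=
  LinearEquiv.ofBijective
    { toFun := fun f => f.1.eval he (unit he)
      map_add' := fun f g => rfl
      map_smul' := fun c f => by
        have h : mulRight he c.1 (unit he) = c • unit he := Subtype.ext <| by
          change e * c.1 = c.1 * e
          rw [corner_mul_left, corner_mul_right]
        change f.1.eval he (mulRight he c.1 (unit he)) = c • f.1.eval he (unit he)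
        rw [h]
        exact eval_smul he f.1 c _ } <| by
    let r : idemPart e A →ₗ[he.Corner] he.Corner :=
      { toFun := fun x => ⟨x.1 * e, x.1, by
          change e * x.1 * e = x.1 * e
          rw [show e * x.1 = x.1 from x.2]⟩
        map_add' := fun x y => Subtype.ext (add_mul x.1 y.1 e)
        map_smul' := fun c x => Subtype.ext (mul_assoc c.1 x.1 e) }
    have hr : ∀ x : idemPart e A, mulRight he e x = r x • unit he := fun x => Subtype.ext <| by
      change x.1 * e = x.1 * e * e
      rw [mul_assoc, he.eq]
    constructor
    · intro f g h
      refine Subtype.ext (ext fun x => ?_)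
      have hf : ∀ f : idemPart e (CornerCoind he N), f.1.eval he x = r x • f.1.eval he (unit he) := by
        intro f
        conv_lhs => rw [← smul_coe f]
        rw [smul_eval, hr]
        exact eval_smul he f.1 _ _
      exact (hf f).trans ((congrArg (r x • ·) h).trans (hf g).symm)
    · intro n
      let f : CornerCoind he N := (LinearMap.toSpanSingleton he.Corner N n).comp r
      refine ⟨⟨f, ext fun x => ?_⟩, ?_⟩
      · change r (mulRight he e x) • n = r x • n
        congr 1
        exact Subtype.ext (by change x.1 * e * e = x.1 * e; rw [mul_assoc, he.eq])
      · have : r (unit he) = 1 := Subtype.ext he.eq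
        change r (unit he) • n = n
        rw [this, one_smul]

end CornerCoind

theorem cornerFunctor_essSurj : (cornerFunctor.{u, u} he).EssSurj where
  mem_essImage N := ⟨ModuleCat.of A (CornerCoind he N), ⟨(CornerCoind.evalEquiv he).toModuleIso⟩⟩

open scoped ModuleCat.Algebra in
/-- If `e` is an idempotent of `A` with `A e A = A`, then `A` and `e A e` are Morita equivalent. -/
theorem IsMoritaEquivalent.corner (R : Type*) [CommRing R] [Algebra R A] {ι : Type} [Fintype ι]
    (a b : ι → A) (hab : ∑ i, a i * e * b i = 1) : IsMoritaEquivalent R A he.Corner := by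
  have := cornerFunctor_faithful.{u, u} he a b hab
  have := cornerFunctor_full.{u, u} he a b hab
  have := cornerFunctor_essSurj he
  have : (cornerFunctor.{u, u} he).IsEquivalence := {}
  refine ⟨⟨⟨(cornerFunctor.{u, u} he).asEquivalence, ⟨fun {X Y} f r => ?_⟩⟩⟩⟩
  refine ModuleCat.hom_ext (LinearMap.ext fun (m : idemPart e X) => Subtype.ext ?_)
  have h : (algebraMap R he.Corner r).1 = e * algebraMap R A r := by
    rw [Algebra.algebraMap_eq_smul_one, Algebra.algebraMap_eq_smul_one, mul_smul_comm, mul_one]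
    rfl
  change algebraMap R A r • f.hom m.1 = (algebraMap R he.Corner r).1 • f.hom m.1
  rw [h, ← Algebra.commutes, mul_smul, ← map_smul f.hom e m.1, smul_coe]

end Corner

/-! ### Algebra homomorphisms out of path algebras -/

namespace PathAlgebra

variable {R : Type*} [CommRing R] {V : Type*} [Quiver V] {A : Type*} [Ring A] [Algebra R A]

/-- The value of a path under an assignment of vertices and arrows. -/
def evalPath (ε : V → A) (α : ∀ {i j : V}, (i ⟶ j) → A) {i : V} : ∀ {j : V}, Quiver.Path i j → A
  | _, .nil => ε i
  | _, .cons p f => evalPath ε α p * α f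

section

variable {ε : V → A} {α : ∀ {i j : V}, (i ⟶ j) → A}

theorem evalPath_mul_vertex (hε : ∀ i, ε i * ε i = ε i)
    (hr : ∀ {i j : V} (f : i ⟶ j), α f * ε j = α f) {i j : V} (p : Quiver.Path i j) :
    evalPath ε α p * ε j = evalPath ε α p := by
  cases p with
  | nil => exact hε i
  | cons p f => rw [evalPath, mul_assoc, hr]

theorem vertex_mul_evalPath (hε : ∀ i, ε i * ε i = ε i) {i j : V} (p : Quiver.Path i j) :
    ε i * evalPath ε α p = evalPath ε α p := by
  induction p with
  | nil => exact hε i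
  | cons p f h => rw [evalPath, ← mul_assoc, h]

theorem evalPath_comp (hε : ∀ i, ε i * ε i = ε i)
    (hr : ∀ {i j : V} (f : i ⟶ j), α f * ε j = α f) {i j k : V} (p : Quiver.Path i j)
    (q : Quiver.Path j k) :
    evalPath ε α (p.comp q) = evalPath ε α p * evalPath ε α q := by
  induction q with
  | nil => exact (evalPath_mul_vertex hε hr p).symm
  | cons q f h => rw [Quiver.Path.comp_cons, evalPath, evalPath, h, mul_assoc]

end

variable (R) in
/-- The linear extension of the evaluation of paths. -/
noncomputable def liftLinear (ε : V → A) (α : ∀ {i j : V}, (i ⟶ j) → A) : PathAlgebra R V →ₗ[R] A :=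
  (Finsupp.linearCombination R fun p : QuiverPath V => evalPath ε α p.2.2 :)

theorem liftLinear_ofPath (ε : V → A) (α : ∀ {i j : V}, (i ⟶ j) → A) {i j : V}
    (p : Quiver.Path i j) : liftLinear R ε α (ofPath R p) = evalPath ε α p :=
  (Finsupp.linearCombination_single R _ _).trans (one_smul R _)

/-- The right multiplication by an arrow extends a path. -/
theorem ofPath_mul_arrow {i j k : V} (p : Quiver.Path i j) (f : j ⟶ k) :
    ofPath R p * arrow R f = ofPath R (p.cons f) :=
  ofPath_mul_ofPath R p f.toPath

variable [Fintype V]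

variable (R) in
/-- The algebra homomorphism from a path algebra belonging to a complete system of orthogonal
idempotents, indexed by the vertices, and to elements, indexed by the arrows, in the corresponding
Peirce components. -/
noncomputable def lift (ε : V → A) (α : ∀ {i j : V}, (i ⟶ j) → A) (hε : ∀ i, ε i * ε i = ε i)
    (hε' : ∀ i j, i ≠ j → ε i * ε j = 0) (h1 : ∑ i, ε i = 1)
    (hr : ∀ {i j : V} (f : i ⟶ j), α f * ε j = α f) : PathAlgebra R V →ₐ[R] A :=
  AlgHom.ofLinearMap (liftLinear R ε α)
    (by
      rw [one_def, map_sum, ← h1]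
      exact Finset.sum_congr rfl fun i _ => liftLinear_ofPath ε α Quiver.Path.nil)
    (by
      intro a b
      induction a using induction with
      | zero => rw [zero_mul, map_zero, zero_mul]
      | add a a' h h' => rw [add_mul, map_add, map_add, add_mul, h, h']
      | smul r a h => rw [smul_mul_assoc, map_smul, map_smul, smul_mul_assoc, h]
      | @path i j p =>
      induction b using induction with
      | zero => rw [mul_zero, map_zero, mul_zero]
      | add a a' h h' => rw [mul_add, map_add, map_add, mul_add, h, h']
      | smul r a h => rw [mul_smul_comm, map_smul, map_smul, mul_smul_comm, h]
      | @path k l q =>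
      simp only [liftLinear_ofPath]
      by_cases hjk : j = k
      · subst hjk
        rw [ofPath_mul_ofPath, liftLinear_ofPath, evalPath_comp hε hr]
      · rw [ofPath_mul_ofPath_of_ne R p q hjk, map_zero, ← evalPath_mul_vertex hε hr p,
          ← vertex_mul_evalPath hε q, mul_assoc, ← mul_assoc (ε j), hε' j k hjk, zero_mul, mul_zero])

theorem lift_ofPath (ε : V → A) (α : ∀ {i j : V}, (i ⟶ j) → A) (hε : ∀ i, ε i * ε i = ε i)
    (hε' : ∀ i j, i ≠ j → ε i * ε j = 0) (h1 : ∑ i, ε i = 1)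
    (hr : ∀ {i j : V} (f : i ⟶ j), α f * ε j = α f) {i j : V} (p : Quiver.Path i j) :
    lift R ε α hε hε' h1 hr (ofPath R p) = evalPath ε α p :=
  liftLinear_ofPath ε α p

theorem lift_vertex (ε : V → A) (α : ∀ {i j : V}, (i ⟶ j) → A) (hε : ∀ i, ε i * ε i = ε i)
    (hε' : ∀ i j, i ≠ j → ε i * ε j = 0) (h1 : ∑ i, ε i = 1)
    (hr : ∀ {i j : V} (f : i ⟶ j), α f * ε j = α f) (i : V) :
    lift R ε α hε hε' h1 hr (vertex R i) = ε i :=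
  lift_ofPath ε α hε hε' h1 hr _

theorem lift_arrow (ε : V → A) (α : ∀ {i j : V}, (i ⟶ j) → A) (hε : ∀ i, ε i * ε i = ε i)
    (hε' : ∀ i j, i ≠ j → ε i * ε j = 0) (h1 : ∑ i, ε i = 1)
    (hr : ∀ {i j : V} (f : i ⟶ j), α f * ε j = α f) {i j : V} (f : i ⟶ j)
    (hl : ε i * α f = α f) :
    lift R ε α hε hε' h1 hr (arrow R f) = α f :=
  (lift_ofPath ε α hε hε' h1 hr _).trans hl

end PathAlgebra

/-! ### The corner algebra as a quotient of the path algebra -/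

namespace Lambda.Corner

section

variable (R : Type*) [CommRing R]

/-- The idempotents of `Λ'` that correspond to the vertices of the quiver. -/
def vertexElem : PsiVertex → Corner R
  | .e3 => e3 R
  | .e4 => e4 R
  | .e5 => e5 R

/-- The elements of `Λ'` that correspond to the arrows of the quiver. -/
def arrowElem : ∀ {i j : PsiVertex}, (i ⟶ j) → Corner R
  | _, _, .t1 => t1 R
  | _, _, .t2 => t2 R
  | _, _, .t3 => t3 R
  | _, _, .t4 => t4 R
  | _, _, .t7 => t7 R

variable {R}

/-- The matrix of an element of `Λ'`. -/
def toOrder (a : Corner R) : OrderA R := a.1.1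

theorem toOrder_injective : Function.Injective (toOrder (R := R)) :=
  fun _ _ h => Subtype.ext (Subtype.ext h)

@[simp] theorem toOrder_add (a b : Corner R) : (a + b).toOrder = a.toOrder + b.toOrder := rfl
@[simp] theorem toOrder_neg (a : Corner R) : (-a).toOrder = -a.toOrder := rfl
@[simp] theorem toOrder_mul (a b : Corner R) : (a * b).toOrder = a.toOrder * b.toOrder := rfl
@[simp] theorem toOrder_zero : (0 : Corner R).toOrder = 0 := rfl
@[simp] theorem toOrder_smul (r : R) (a : Corner R) : (r • a).toOrder = r • a.toOrder := rfl

variable (R)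

@[simp] theorem toOrder_e3 : (e3 R).toOrder = ⟨Matrix.single 2 2 1, 0, 0, 0, 0, 0, 0, 0, 0, 0⟩ := rfl
@[simp] theorem toOrder_e4 : (e4 R).toOrder = ⟨0, 0, 1, 0, 0, 0, 0, 0, 0, 0⟩ := rfl
@[simp] theorem toOrder_e5 : (e5 R).toOrder = ⟨0, 0, 0, 0, 1, 0, 0, 1, 0, 0⟩ := rfl
@[simp] theorem toOrder_t1 : (t1 R).toOrder = ⟨0, 0, 0, 0, 0, ![0, 0, 4], 0, 0, 0, 0⟩ := rfl
@[simp] theorem toOrder_t2 : (t2 R).toOrder = ⟨0, ![0, 0, 2], 0, 0, 0, 0, 0, 0, 0, 0⟩ := rfl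
@[simp] theorem toOrder_t3 : (t3 R).toOrder = ⟨0, 0, 0, 0, 0, 0, 2, 0, 0, 0⟩ := rfl
@[simp] theorem toOrder_t4 : (t4 R).toOrder = ⟨0, 0, 0, 2, 0, 0, 0, 0, 0, 0⟩ := rfl
@[simp] theorem toOrder_t7 : (t7 R).toOrder = ⟨0, 0, 0, 0, 0, 0, 0, 2, 4, 0⟩ := rfl

theorem vertexElem_mul_self (i : PsiVertex) :
    vertexElem R i * vertexElem R i = vertexElem R i := by
  apply toOrder_injective
  cases i <;> ext <;> simp [vertexElem]

theorem vertexElem_mul_of_ne (i j : PsiVertex) (h : i ≠ j) :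
    vertexElem R i * vertexElem R j = 0 := by
  apply toOrder_injective
  cases i <;> cases j <;> first | exact absurd rfl h | (ext <;> simp [vertexElem])

theorem sum_vertexElem : ∑ i, vertexElem R i = 1 := by
  change ∑ i ∈ ({.e3, .e4, .e5} : Finset PsiVertex), vertexElem R i = 1
  rw [Finset.sum_insert (by simp), Finset.sum_insert (by simp), Finset.sum_singleton, ← add_assoc]
  rfl

theorem arrowElem_mul_vertexElem {i j : PsiVertex} (f : i ⟶ j) :
    arrowElem R f * vertexElem R j = arrowElem R f := by
  apply toOrder_injective
  change PsiArrow i j at f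
  cases f <;> ext k <;> simp [vertexElem, arrowElem] <;>
    fin_cases k <;> simp [Matrix.vecMul, dotProduct, Matrix.single]

theorem vertexElem_mul_arrowElem {i j : PsiVertex} (f : i ⟶ j) :
    vertexElem R i * arrowElem R f = arrowElem R f := by
  apply toOrder_injective
  change PsiArrow i j at f
  cases f <;> ext k <;> simp [vertexElem, arrowElem] <;>
    fin_cases k <;> simp [Matrix.mulVec, dotProduct, Matrix.single]

/-- The homomorphism `R Ψ → Λ'`. -/
noncomputable def ofPathAlgebra : PathAlgebra R PsiVertex →ₐ[R] Corner R :=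
  PathAlgebra.lift R (vertexElem R) (arrowElem R) (vertexElem_mul_self R) (vertexElem_mul_of_ne R)
    (sum_vertexElem R) (arrowElem_mul_vertexElem R)

end

end Lambda.Corner

namespace Psi

variable (R : Type*) [CommRing R]

/-- The quotient map `R Ψ → R Ψ / I`. -/
noncomputable def quotHom : PathAlgebra R PsiVertex →ₐ[R] PsiQuot R := (ideal R).ringCon.mkₐ R

theorem quotHom_eq_zero {a : PathAlgebra R PsiVertex} (h : a ∈ ideal R) : quotHom R a = 0 :=
  (RingCon.eq _).2 ((TwoSidedIdeal.mem_iff _ _).1 h)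

local notation "E₃" => quotHom R (PathAlgebra.vertex R PsiVertex.e3)
local notation "E₄" => quotHom R (PathAlgebra.vertex R PsiVertex.e4)
local notation "E₅" => quotHom R (PathAlgebra.vertex R PsiVertex.e5)
local notation "T₁" => quotHom R (t1 R)
local notation "T₂" => quotHom R (t2 R)
local notation "T₃" => quotHom R (t3 R)
local notation "T₄" => quotHom R (t4 R)
local notation "T₇" => quotHom R (t7 R)

theorem quotHom_t2_mul_t1 : T₂ * T₁ = 0 := by
  rw [← map_mul]
  exact quotHom_eq_zero R (TwoSidedIdeal.subset_span (by simp))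

theorem quotHom_t2_mul_t3 : T₂ * T₃ = 0 := by
  rw [← map_mul]
  exact quotHom_eq_zero R (TwoSidedIdeal.subset_span (by simp))

theorem quotHom_t4_mul_t1 : T₄ * T₁ = 0 := by
  rw [← map_mul]
  exact quotHom_eq_zero R (TwoSidedIdeal.subset_span (by simp))

theorem quotHom_t4_mul_t3 : T₄ * T₃ = 0 := by
  rw [← map_mul]
  exact quotHom_eq_zero R (TwoSidedIdeal.subset_span (by simp))

theorem quotHom_two_mul (a : PathAlgebra R PsiVertex) : quotHom R (2 * a) = (2 : R) • quotHom R a := by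
  rw [two_mul, map_add, two_smul]

theorem quotHom_t2_mul_t7 : T₂ * T₇ = (2 : R) • T₂ := by
  rw [← map_mul, ← quotHom_two_mul, ← sub_eq_zero, ← map_sub]
  exact quotHom_eq_zero R (TwoSidedIdeal.subset_span (by simp))

theorem quotHom_t4_mul_t7 : T₄ * T₇ = (2 : R) • T₄ := by
  rw [← map_mul, ← quotHom_two_mul, ← sub_eq_zero, ← map_sub]
  exact quotHom_eq_zero R (TwoSidedIdeal.subset_span (by simp))

theorem quotHom_t7_mul_t1 : T₇ * T₁ = (2 : R) • T₁ := by
  rw [← map_mul, ← quotHom_two_mul, ← sub_eq_zero, ← map_sub]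
  exact quotHom_eq_zero R (TwoSidedIdeal.subset_span (by simp))

theorem quotHom_t7_mul_t3 : T₇ * T₃ = (2 : R) • T₃ := by
  rw [← map_mul, ← quotHom_two_mul, ← sub_eq_zero, ← map_sub]
  exact quotHom_eq_zero R (TwoSidedIdeal.subset_span (by simp))

theorem quotHom_t7_mul_t7 : T₇ * T₇ = (2 : R) • T₇ + T₁ * T₂ := by
  rw [← map_mul, ← map_mul, ← quotHom_two_mul, ← sub_eq_zero, ← sub_sub, ← map_sub, ← map_sub,
    ← pow_two]
  exact quotHom_eq_zero R (TwoSidedIdeal.subset_span (by simp))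

theorem vertex_mul_arrow {i j : PsiVertex} (f : i ⟶ j) :
    quotHom R (PathAlgebra.vertex R i) * quotHom R (PathAlgebra.arrow R f)
      = quotHom R (PathAlgebra.arrow R f) := by
  rw [← map_mul]
  exact congrArg _ ((PathAlgebra.ofPath_mul_ofPath R _ _).trans (by rw [Quiver.Path.nil_comp]; rfl))

/-- A basis of `R Ψ / I`. -/
noncomputable def basisElem : Fin 10 → PsiQuot R :=
  ![E₃, E₄, E₅, T₁, T₂, T₃, T₄, T₇, T₁ * T₂, T₃ * T₄]

/-- Representatives of those basis elements of `R Ψ / I` that end at a given vertex. -/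
def endingAt : PsiVertex → Set (PsiQuot R)
  | .e3 => {E₃, T₁}
  | .e4 => {E₄, T₃}
  | .e5 => {E₅, T₂, T₄, T₇, T₁ * T₂, T₃ * T₄}

theorem mul_arrow_mem {i j : PsiVertex} (f : i ⟶ j) {a : PsiQuot R} (ha : a ∈ endingAt R i) :
    a * quotHom R (PathAlgebra.arrow R f) ∈ Submodule.span R (endingAt R j) := by
  have mem : ∀ {j} {b : PsiQuot R}, b ∈ endingAt R j → b ∈ Submodule.span R (endingAt R j) :=
    fun h => Submodule.subset_span h
  change PsiArrow i j at f
  cases f with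
  | t1 =>
    change a * T₁ ∈ _
    rcases ha with rfl | rfl | rfl | rfl | rfl | rfl
    · rw [show E₅ * T₁ = T₁ from vertex_mul_arrow R _]; exact mem (by simp [endingAt])
    · rw [quotHom_t2_mul_t1]; exact zero_mem _
    · rw [quotHom_t4_mul_t1]; exact zero_mem _
    · rw [quotHom_t7_mul_t1]; exact Submodule.smul_mem _ _ (mem (by simp [endingAt]))
    · rw [mul_assoc, quotHom_t2_mul_t1, mul_zero]; exact zero_mem _
    · rw [mul_assoc, quotHom_t4_mul_t1, mul_zero]; exact zero_mem _
  | t2 =>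
    change a * T₂ ∈ _
    rcases ha with rfl | rfl
    · rw [show E₃ * T₂ = T₂ from vertex_mul_arrow R _]; exact mem (by simp [endingAt])
    · exact mem (by simp [endingAt])
  | t3 =>
    change a * T₃ ∈ _
    rcases ha with rfl | rfl | rfl | rfl | rfl | rfl
    · rw [show E₅ * T₃ = T₃ from vertex_mul_arrow R _]; exact mem (by simp [endingAt])
    · rw [quotHom_t2_mul_t3]; exact zero_mem _
    · rw [quotHom_t4_mul_t3]; exact zero_mem _
    · rw [quotHom_t7_mul_t3]; exact Submodule.smul_mem _ _ (mem (by simp [endingAt]))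
    · rw [mul_assoc, quotHom_t2_mul_t3, mul_zero]; exact zero_mem _
    · rw [mul_assoc, quotHom_t4_mul_t3, mul_zero]; exact zero_mem _
  | t4 =>
    change a * T₄ ∈ _
    rcases ha with rfl | rfl
    · rw [show E₄ * T₄ = T₄ from vertex_mul_arrow R _]; exact mem (by simp [endingAt])
    · exact mem (by simp [endingAt])
  | t7 =>
    change a * T₇ ∈ _
    rcases ha with rfl | rfl | rfl | rfl | rfl | rfl
    · rw [show E₅ * T₇ = T₇ from vertex_mul_arrow R _]; exact mem (by simp [endingAt])
    · rw [quotHom_t2_mul_t7]; exact Submodule.smul_mem _ _ (mem (by simp [endingAt]))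
    · rw [quotHom_t4_mul_t7]; exact Submodule.smul_mem _ _ (mem (by simp [endingAt]))
    · rw [quotHom_t7_mul_t7]
      exact add_mem (Submodule.smul_mem _ _ (mem (by simp [endingAt]))) (mem (by simp [endingAt]))
    · rw [mul_assoc, quotHom_t2_mul_t7, mul_smul_comm]
      exact Submodule.smul_mem _ _ (mem (by simp [endingAt]))
    · rw [mul_assoc, quotHom_t4_mul_t7, mul_smul_comm]
      exact Submodule.smul_mem _ _ (mem (by simp [endingAt]))

theorem quotHom_ofPath_mem {i j : PsiVertex} (p : Quiver.Path i j) :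
    quotHom R (PathAlgebra.ofPath R p) ∈ Submodule.span R (endingAt R j) := by
  induction p with
  | nil => exact Submodule.subset_span (by cases i <;> exact Or.inl rfl)
  | @cons j k p f h =>
    rw [← PathAlgebra.ofPath_mul_arrow, map_mul]
    refine Submodule.span_induction (fun a ha => mul_arrow_mem R f ha) ?_ (fun a b _ _ ha hb => ?_)
      (fun r a _ ha => ?_) h
    · rw [zero_mul]; exact zero_mem _
    · rw [add_mul]; exact add_mem ha hb
    · rw [smul_mul_assoc]; exact Submodule.smul_mem _ _ ha

theorem endingAt_subset (j : PsiVertex) : endingAt R j ⊆ Set.range (basisElem R) := by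
  cases j
  · rintro _ (rfl | rfl)
    exacts [⟨0, rfl⟩, ⟨3, rfl⟩]
  · rintro _ (rfl | rfl)
    exacts [⟨1, rfl⟩, ⟨5, rfl⟩]
  · rintro _ (rfl | rfl | rfl | rfl | rfl | rfl)
    exacts [⟨2, rfl⟩, ⟨4, rfl⟩, ⟨6, rfl⟩, ⟨7, rfl⟩, ⟨8, rfl⟩, ⟨9, rfl⟩]

theorem exists_eq_sum_basisElem (a : PsiQuot R) : ∃ c : Fin 10 → R, ∑ k, c k • basisElem R k = a := by
  rw [← Submodule.mem_span_range_iff_exists_fun]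
  obtain ⟨a, rfl⟩ : ∃ b, quotHom R b = a := RingCon.mk'_surjective _ a
  induction a using PathAlgebra.induction with
  | zero => rw [map_zero]; exact zero_mem _
  | add a b ha hb => rw [map_add]; exact add_mem ha hb
  | smul r a ha => rw [map_smul]; exact Submodule.smul_mem _ _ ha
  | path p => exact Submodule.span_mono (endingAt_subset R _) (quotHom_ofPath_mem R p)

end Psi

namespace Lambda.Corner

open Psi

variable (R : Type*) [CommRing R]

@[simp] theorem ofPathAlgebra_vertex (i : PsiVertex) :
    ofPathAlgebra R (PathAlgebra.vertex R i) = vertexElem R i :=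
  PathAlgebra.lift_vertex _ _ _ _ _ _ i

theorem ofPathAlgebra_arrow {i j : PsiVertex} (f : i ⟶ j) :
    ofPathAlgebra R (PathAlgebra.arrow R f) = arrowElem R f :=
  PathAlgebra.lift_arrow _ _ _ _ _ _ f (vertexElem_mul_arrowElem R f)

@[simp] theorem ofPathAlgebra_t1 : ofPathAlgebra R (Psi.t1 R) = t1 R := ofPathAlgebra_arrow R _
@[simp] theorem ofPathAlgebra_t2 : ofPathAlgebra R (Psi.t2 R) = t2 R := ofPathAlgebra_arrow R _
@[simp] theorem ofPathAlgebra_t3 : ofPathAlgebra R (Psi.t3 R) = t3 R := ofPathAlgebra_arrow R _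
@[simp] theorem ofPathAlgebra_t4 : ofPathAlgebra R (Psi.t4 R) = t4 R := ofPathAlgebra_arrow R _
@[simp] theorem ofPathAlgebra_t7 : ofPathAlgebra R (Psi.t7 R) = t7 R := ofPathAlgebra_arrow R _

theorem ideal_le_ker : Psi.ideal R ≤ TwoSidedIdeal.ker (ofPathAlgebra R) := by
  rw [Psi.ideal, TwoSidedIdeal.span_le]
  intro a ha
  rw [SetLike.mem_coe, TwoSidedIdeal.mem_ker]
  apply toOrder_injective
  rcases ha with rfl | rfl | rfl | rfl | rfl | rfl | rfl | rfl | rfl <;>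
  · simp only [map_sub, map_mul, two_mul, pow_two, map_add, ofPathAlgebra_t1,
      ofPathAlgebra_t2, ofPathAlgebra_t3, ofPathAlgebra_t4, ofPathAlgebra_t7, toOrder_neg,
      toOrder_mul, toOrder_add, toOrder_t1, toOrder_t2, toOrder_t3, toOrder_t4, toOrder_t7,
      toOrder_zero, sub_eq_add_neg]
    ext k <;> simp [dotProduct, Fin.sum_univ_three] <;> try (fin_cases k <;> simp) <;> norm_num
    all_goals try ring

/-- The homomorphism `R Ψ / I → Λ'`. -/
noncomputable def ofPsiQuot : PsiQuot R →ₐ[R] Corner R :=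
  (Psi.ideal R).ringCon.liftₐ (ofPathAlgebra R)
    (TwoSidedIdeal.ringCon_le_iff.1 (ideal_le_ker R))

@[simp] theorem ofPsiQuot_quotHom (a : PathAlgebra R PsiVertex) :
    ofPsiQuot R (quotHom R a) = ofPathAlgebra R a := rfl

theorem toOrder_ofPsiQuot_sum (c : Fin 10 → R) :
    (ofPsiQuot R (∑ k, c k • basisElem R k)).toOrder =
      ⟨Matrix.single 2 2 (c 0), ![0, 0, 2 * c 4], c 1, 2 * c 6, c 2, ![0, 0, 4 * c 3], 2 * c 5,
        c 2 + 2 * c 7, 4 * c 7 + 8 * c 8 - 48 * c 9, 4 * c 9⟩ := by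
  have h : ∑ k, c k • basisElem R k = c 0 • quotHom R (PathAlgebra.vertex R PsiVertex.e3)
      + c 1 • quotHom R (PathAlgebra.vertex R PsiVertex.e4)
      + c 2 • quotHom R (PathAlgebra.vertex R PsiVertex.e5) + c 3 • quotHom R (Psi.t1 R)
      + c 4 • quotHom R (Psi.t2 R) + c 5 • quotHom R (Psi.t3 R) + c 6 • quotHom R (Psi.t4 R)
      + c 7 • quotHom R (Psi.t7 R) + c 8 • (quotHom R (Psi.t1 R) * quotHom R (Psi.t2 R))
      + c 9 • (quotHom R (Psi.t3 R) * quotHom R (Psi.t4 R)) := by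
    simp only [Fin.sum_univ_succ, Finset.univ_eq_empty, Finset.sum_empty, add_zero, ← add_assoc]
    rfl
  rw [h]
  simp only [map_add, map_smul, map_mul, ofPsiQuot_quotHom, ofPathAlgebra_vertex, ofPathAlgebra_t1,
    ofPathAlgebra_t2, ofPathAlgebra_t3, ofPathAlgebra_t4, ofPathAlgebra_t7, vertexElem, toOrder_add,
    toOrder_smul, toOrder_mul, toOrder_e3, toOrder_e4, toOrder_e5, toOrder_t1, toOrder_t2,
    toOrder_t3, toOrder_t4, toOrder_t7]
  ext k
  case s l => fin_cases k <;> fin_cases l <;> simp [Matrix.single]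
  case t => fin_cases k <;> simp [mul_comm]
  case x => fin_cases k <;> simp [mul_comm]
  all_goals simp [dotProduct, Fin.sum_univ_three]
  all_goals ring

theorem ofPsiQuot_injective [IsDomain R] (h2 : (2 : R) ≠ 0) :
    Function.Injective (ofPsiQuot R) := by
  rw [injective_iff_map_eq_zero]
  intro a ha
  obtain ⟨c, rfl⟩ := exists_eq_sum_basisElem R a
  have h := toOrder_ofPsiQuot_sum R c
  rw [ha, toOrder_zero] at h
  have h4 : (4 : R) ≠ 0 := by
    have : (4 : R) = 2 * 2 := by norm_num
    rw [this]; exact mul_ne_zero h2 h2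
  have h8 : (8 : R) ≠ 0 := by
    have : (8 : R) = 4 * 2 := by norm_num
    rw [this]; exact mul_ne_zero h4 h2
  have c0 : c 0 = 0 := by simpa using (congrArg (fun a => a.s 2 2) h).symm
  have c1 : c 1 = 0 := by simpa using (congrArg (fun a => a.u) h).symm
  have c2 : c 2 = 0 := by simpa using (congrArg (fun a => a.w) h).symm
  have c3 : c 3 = 0 := by simpa [h4] using (congrArg (fun a => a.x 2) h).symm
  have c4 : c 4 = 0 := by simpa [h2] using (congrArg (fun a => a.t 2) h).symm
  have c5 : c 5 = 0 := by simpa [h2] using (congrArg (fun a => a.y) h).symm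
  have c6 : c 6 = 0 := by simpa [h2] using (congrArg (fun a => a.v) h).symm
  have c7 : c 7 = 0 := by simpa [h2, c2] using (congrArg (fun a => a.z1) h).symm
  have c9 : c 9 = 0 := by simpa [h4] using (congrArg (fun a => a.z3) h).symm
  have c8 : c 8 = 0 := by simpa [h8, c7, c9] using (congrArg (fun a => a.z2) h).symm
  refine Finset.sum_eq_zero fun k _ => ?_
  have : c k = 0 := by fin_cases k <;> assumption
  rw [this, zero_smul]

theorem ofPsiQuot_surjective [IsDomain R] (h2 : (2 : R) ≠ 0) :
    Function.Surjective (ofPsiQuot R) := by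
  intro a
  obtain ⟨⟨k, hk⟩, ⟨d, hd⟩, ⟨c, hc⟩, hx, ⟨y, hy⟩, ht, ⟨v, hv⟩⟩ := a.1.2
  obtain ⟨x, hx⟩ := hx 2
  obtain ⟨t, ht⟩ := ht 2
  obtain ⟨b, hb⟩ := a.2
  have hb : a.toOrder = ((e3 R).toOrder + (e4 R).toOrder + (e5 R).toOrder) * b.1 *
    ((e3 R).toOrder + (e4 R).toOrder + (e5 R).toOrder) := congrArg Subtype.val hb.symm
  refine ⟨∑ i, (![a.toOrder.s 2 2, a.toOrder.u, a.toOrder.w, x, t, y, v, -(c + d + 2 * k),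
    c + d + k + 6 * c, c] i) • basisElem R i, toOrder_injective ?_⟩
  rw [toOrder_ofPsiQuot_sum]
  have hz1 : a.toOrder.z1 = a.toOrder.w + 2 * -(c + d + 2 * k) := by
    refine mul_left_cancel₀ h2 ?_
    change a.1.1.z2 - a.1.1.z3 = _ at hd
    change a.1.1.z3 = _ at hc
    change 2 * a.1.1.w - 2 * a.1.1.z1 - a.1.1.z2 = _ at hk
    change 2 * a.1.1.z1 = 2 * (a.1.1.w + _)
    linear_combination -hk - hd - hc
  have hs : ∀ i j, (i ≠ 2 ∨ j ≠ 2) → a.toOrder.s i j = 0 := by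
    intro i j h
    rw [hb]
    rcases h with h | h
    · fin_cases i <;> first | exact absurd rfl h |
        simp [Matrix.mul_apply, Matrix.single, Fin.sum_univ_three]
    · fin_cases j <;> first | exact absurd rfl h |
        simp [Matrix.mul_apply, Matrix.single]
  have ht' : ∀ i, i ≠ 2 → a.toOrder.t i = 0 := by
    intro i h
    rw [hb]
    fin_cases i <;> first | exact absurd rfl h |
      simp [Matrix.mulVec, Matrix.single, dotProduct, Fin.sum_univ_three]
  have hx' : ∀ i, i ≠ 2 → a.toOrder.x i = 0 := by
    intro i h
    rw [hb]
    fin_cases i <;> first | exact absurd rfl h |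
      simp [Matrix.vecMul, Matrix.single, dotProduct]
  ext i
  case s j =>
    change Matrix.single 2 2 (a.toOrder.s 2 2) i j = _
    by_cases h : i ≠ 2 ∨ j ≠ 2
    · rw [hs i j h, Matrix.single_apply_of_ne]
      rcases h with h | h
      · exact fun h' => h h'.1.symm
      · exact fun h' => h h'.2.symm
    · push Not at h
      rw [h.1, h.2]
      simp
  case t =>
    by_cases h : i = 2
    · subst h; exact ht.symm
    · rw [ht' i h]; fin_cases i <;> first | rfl | exact absurd rfl h
  case x =>
    by_cases h : i = 2
    · subst h; exact hx.symm
    · rw [hx' i h]; fin_cases i <;> first | rfl | exact absurd rfl h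
  · rfl
  · exact hv.symm
  · rfl
  · exact hy.symm
  · exact hz1.symm
  · change 4 * -(c + d + 2 * k) + 8 * (c + d + k + 6 * c) - 48 * c = a.1.1.z2
    linear_combination -hd - hc
  · exact hc.symm

/-- The isomorphism `Λ' ≃ R Ψ / I`. -/
noncomputable def equivPsiQuot [IsDomain R] (h2 : (2 : R) ≠ 0) : Corner R ≃ₐ[R] PsiQuot R :=
  (AlgEquiv.ofBijective (ofPsiQuot R) ⟨ofPsiQuot_injective R h2, ofPsiQuot_surjective R h2⟩).symm

theorem equivPsiQuot_eq_iff [IsDomain R] (h2 : (2 : R) ≠ 0) (a : Corner R)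
    (b : PathAlgebra R PsiVertex) : equivPsiQuot R h2 a = toQuot R b ↔ a = ofPathAlgebra R b := by
  rw [equivPsiQuot, AlgEquiv.symm_apply_eq]
  rfl

end Lambda.Corner

/-! ### The idempotent is full -/

namespace Lambda

variable (R : Type*) [CommRing R]

/-- The matrix unit at position `(i, j)` of the block `s`. -/
def unitS (i j : Fin 3) : Lambda R :=
  ⟨⟨Matrix.single i j 1, 0, 0, 0, 0, 0, 0, 0, 0, 0⟩, by simp [Lambda]⟩

theorem e345_full : ∑ i, (![1, unitS R 0 2, unitS R 1 2] : Fin 3 → Lambda R) i * e345 R *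
    (![1, unitS R 2 0, unitS R 2 1] : Fin 3 → Lambda R) i = 1 := by
  refine Subtype.ext ?_
  simp only [Fin.sum_univ_three, Matrix.cons_val_zero, Matrix.cons_val_one, Matrix.cons_val_two,
    Matrix.head_cons, Matrix.tail_cons, one_mul, mul_one]
  change ((e3 R : OrderA R) + e4 R + e5 R) + (unitS R 0 2 : OrderA R) * (e3 R + e4 R + e5 R) *
    unitS R 2 0 + (unitS R 1 2 : OrderA R) * (e3 R + e4 R + e5 R) * unitS R 2 1 = 1
  ext i
  case s j =>
    fin_cases i <;> fin_cases j <;>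
      simp [e3, e4, e5, unitS, Matrix.mul_apply, Fin.sum_univ_three, Matrix.single]
  all_goals simp [e3, e4, e5, unitS]

theorem isMoritaEquivalent_corner : IsMoritaEquivalent R (Lambda R) (Corner R) :=
  IsMoritaEquivalent.corner (e345_idem R) R _ _ (e345_full R)

end Lambda

open MulOpposite (op unop)

/-! ### Stabilizers of points of bisets -/

section Stab

variable {G : Type*} [Group G]

open scoped Classical in
/-- The relation `g x = x h` on `G`, for a point `x` of a biset. -/
noncomputable def stabRel {X : Type*} [MulAction G X] [MulAction Gᵐᵒᵖ X] (x : X)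
    (g h : G) : Bool :=
  @decide (g • x = op h • x) (Classical.propDecidable _)

theorem stabRel_iff {X : Type*} [MulAction G X] [MulAction Gᵐᵒᵖ X] {x : X} {g h : G} :
    stabRel x g h = true ↔ g • x = op h • x := by
  simp [stabRel]

namespace BoolRel

/-- The conjugate of a relation. -/
def conj (a b : G) (A : G → G → Bool) (g h : G) : Bool := A (a⁻¹ * g * a) (b⁻¹ * h * b)

theorem conj_conj (a b c d : G) (A : G → G → Bool) :
    conj a b (conj c d A) = conj (a * c) (b * d) A := by
  funext g h
  simp [conj, mul_assoc]

theorem exists_conj {a : G} {p : G → Prop} : (∃ g, p (a⁻¹ * g * a)) ↔ ∃ g, p g :=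
  ⟨fun ⟨_, h⟩ => ⟨_, h⟩, fun ⟨g, h⟩ => ⟨a * g * a⁻¹, by simpa [mul_assoc] using h⟩⟩

variable [Fintype G]

/-- The composition of two relations. -/
def comp (A B : G → G → Bool) (g k : G) : Bool := decide (∃ m, A g m = true ∧ B m k = true)

theorem comp_iff {A B : G → G → Bool} {g k : G} :
    comp A B g k = true ↔ ∃ m, A g m = true ∧ B m k = true := decide_eq_true_iff

theorem comp_conj (a b c : G) (A B : G → G → Bool) :
    comp (conj a b A) (conj b c B) = conj a c (comp A B) := by
  funext g k
  rw [Bool.eq_iff_iff]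
  simp only [conj, comp_iff]
  constructor
  · rintro ⟨m, h⟩
    exact ⟨_, h⟩
  · rintro ⟨m, h⟩
    refine ⟨b * m * b⁻¹, ?_⟩
    simpa [mul_assoc] using h

/-- The number of elements of a relation. -/
def card (A : G → G → Bool) : ℕ := ∑ g, ∑ h, (A g h).toNat

/-- The number of composable pairs of elements of two relations. -/
def compCard (A B : G → G → Bool) : ℕ := ∑ m, (∑ g, (A g m).toNat) * ∑ k, (B m k).toNat

/-- The size of the domain of a relation. -/
def domCard (A : G → G → Bool) : ℕ := ∑ g, (decide (∃ h, A g h = true)).toNat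

/-- The number of elements that are related to `1`. -/
def kerCard (A : G → G → Bool) : ℕ := ∑ g, (A g 1).toNat

/-- The size of the range of a relation. -/
def ranCard (A : G → G → Bool) : ℕ := ∑ h, (decide (∃ g, A g h = true)).toNat

theorem sum_conj {M : Type*} [AddCommMonoid M] (a : G) (f : G → M) :
    ∑ g, f (a⁻¹ * g * a) = ∑ g, f g := by
  have := Equiv.sum_comp (MulAut.conj a⁻¹).toEquiv f
  simpa using this

theorem card_conj (a b : G) (A : G → G → Bool) : card (conj a b A) = card A := by
  simp only [card, conj]
  rw [sum_conj a fun g => ∑ h, (A g (b⁻¹ * h * b)).toNat]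
  exact Finset.sum_congr rfl fun g _ => sum_conj b fun h => (A g h).toNat

theorem compCard_conj (a b c : G) (A B : G → G → Bool) :
    compCard (conj a b A) (conj b c B) = compCard A B := by
  simp only [compCard, conj]
  rw [sum_conj b fun m => (∑ g, (A (a⁻¹ * g * a) m).toNat) * ∑ k, (B m (c⁻¹ * k * c)).toNat]
  refine Finset.sum_congr rfl fun m _ => ?_
  rw [sum_conj a fun g => (A g m).toNat, sum_conj c fun k => (B m k).toNat]

theorem domCard_conj (a b : G) (A : G → G → Bool) : domCard (conj a b A) = domCard A := by
  unfold domCard conj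
  rw [← sum_conj a fun g => (decide (∃ h, A g h = true)).toNat]
  exact Finset.sum_congr rfl fun g _ => congrArg Bool.toNat (decide_eq_decide.2
    (exists_conj (p := fun h => A (a⁻¹ * g * a) h = true)))

theorem ranCard_conj (a b : G) (A : G → G → Bool) : ranCard (conj a b A) = ranCard A := by
  unfold ranCard conj
  rw [← sum_conj b fun h => (decide (∃ g, A g h = true)).toNat]
  exact Finset.sum_congr rfl fun h _ => congrArg Bool.toNat (decide_eq_decide.2
    (exists_conj (p := fun g => A g (b⁻¹ * h * b) = true)))

theorem kerCard_conj (a b : G) (A : G → G → Bool) : kerCard (conj a b A) = kerCard A := by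
  simp only [kerCard, conj]
  rw [← sum_conj a fun g => (A g 1).toNat]
  simp

end BoolRel

variable {X Y : Type*} [MulAction G X] [MulAction Gᵐᵒᵖ X] [MulAction G Y] [MulAction Gᵐᵒᵖ Y]

theorem stabRel_map (e : BisetIso G X Y) (x : X) : stabRel (e.toFun x) = stabRel (G := G) x := by
  funext g h
  rw [Bool.eq_iff_iff, stabRel_iff, stabRel_iff, ← e.map_left, ← e.map_right]
  exact e.toEquiv.apply_eq_iff_eq

theorem stabRel_inl (x : X) : stabRel (Sum.inl x : X ⊕ Y) = stabRel (G := G) x := by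
  funext g h
  rw [Bool.eq_iff_iff, stabRel_iff, stabRel_iff]
  exact Sum.inl_injective.eq_iff

theorem stabRel_inr (y : Y) : stabRel (Sum.inr y : X ⊕ Y) = stabRel (G := G) y := by
  funext g h
  rw [Bool.eq_iff_iff, stabRel_iff, stabRel_iff]
  exact Sum.inr_injective.eq_iff

variable [SMulCommClass G Gᵐᵒᵖ X] [SMulCommClass G Gᵐᵒᵖ Y]

theorem stabRel_smul (a b : G) (x : X) :
    stabRel (G := G) (a • op b • x) = BoolRel.conj a b⁻¹ (stabRel x) := by
  funext g h
  rw [Bool.eq_iff_iff, stabRel_iff, BoolRel.conj, stabRel_iff]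
  have h1 : g • a • op b • x = a • op b • (a⁻¹ * g * a) • x := by
    rw [← smul_comm (a⁻¹ * g * a) (op b) x, smul_smul, smul_smul]
    simp [mul_assoc]
  have h2 : op h • a • op b • x = a • op b • op (b⁻¹⁻¹ * h * b⁻¹) • x := by
    rw [← smul_comm a (op h) (op b • x), smul_smul (op h), smul_smul (op b) (op _)]
    simp [mul_assoc]
  rw [h1, h2, (MulAction.injective a).eq_iff, (MulAction.injective (op b)).eq_iff]

theorem stabRel_tensor [Fintype G] (x : X) (y : Y) :
    stabRel (G := G) (BisetTensor.mk G x y) = BoolRel.comp (stabRel (G := G) x) (stabRel y) := by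
  funext g k
  rw [Bool.eq_iff_iff, stabRel_iff, BoolRel.comp_iff, BisetTensor.smul_mk, BisetTensor.op_smul_mk]
  constructor
  · intro h
    obtain ⟨m, hm⟩ := Quotient.exact h
    obtain ⟨h1, h2⟩ := Prod.mk.inj hm
    refine ⟨m, stabRel_iff.2 ?_, stabRel_iff.2 h2.symm⟩
    conv_rhs => rw [h1]
    simp
  · rintro ⟨m, h1, h2⟩
    rw [stabRel_iff.1 h1, BisetTensor.mk_op_smul, stabRel_iff.1 h2]

end Stab

/-! ### Sums over the points of a biset -/

namespace BisetClass

section PointSum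

variable {G : Type*} [Group G] {V : Type*} [AddCommMonoid V] (F : (G → G → Bool) → V)

/-- The sum over the points of a biset of a function of their stabilizers. -/
noncomputable def pointSum : BisetClass G → V :=
  Quotient.lift (fun M : FinBiset G => ∑ x : Fin M.card, F (stabRel x)) fun _ _ ⟨e⟩ => by
    rw [← Equiv.sum_comp e.toEquiv]
    exact Finset.sum_congr rfl fun x _ => congrArg F (stabRel_map e x).symm

theorem pointSum_mk (X : Type*) [Fintype X] [MulAction G X] [MulAction Gᵐᵒᵖ X]
    [SMulCommClass G Gᵐᵒᵖ X] : pointSum F (mk G X) = ∑ x : X, F (stabRel x) := by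
  change ∑ x : Fin (FinBiset.of G X).card, F (stabRel x) = _
  rw [← Equiv.sum_comp (FinBiset.ofIso G X).toEquiv]
  exact Finset.sum_congr rfl fun x _ => congrArg F (stabRel_map (FinBiset.ofIso G X) x)

theorem pointSum_sum (X Y : Type*) [Finite X] [MulAction G X] [MulAction Gᵐᵒᵖ X]
    [SMulCommClass G Gᵐᵒᵖ X] [Finite Y] [MulAction G Y] [MulAction Gᵐᵒᵖ Y]
    [SMulCommClass G Gᵐᵒᵖ Y] :
    pointSum F (mk G (X ⊕ Y)) = pointSum F (mk G X) + pointSum F (mk G Y) := by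
  have := Fintype.ofFinite X
  have := Fintype.ofFinite Y
  rw [pointSum_mk, pointSum_mk, pointSum_mk, Fintype.sum_sum_type]
  simp only [stabRel_inl, stabRel_inr]

end PointSum

end BisetClass

namespace BisetTensor

variable {G : Type*} [Group G] [Fintype G] {X Y : Type*} [MulAction G X] [MulAction Gᵐᵒᵖ X]
  [SMulCommClass G Gᵐᵒᵖ X] [MulAction G Y] [MulAction Gᵐᵒᵖ Y] [SMulCommClass G Gᵐᵒᵖ Y]

/-- The number of `n` with `x n = x` and `n y = y`. -/
noncomputable def fixCard (G : Type*) [Group G] [Fintype G] {X Y : Type*} [MulAction G X]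
    [MulAction Gᵐᵒᵖ X] [MulAction G Y] [MulAction Gᵐᵒᵖ Y] (x : X) (y : Y) : ℕ :=
  ∑ n : G, (stabRel x 1 n && stabRel y n 1).toNat

theorem compCard_eq_fixCard_mul (x : X) (y : Y) :
    BoolRel.compCard (stabRel (G := G) x) (stabRel y) =
      fixCard G x y * BoolRel.card (stabRel (G := G) (mk G x y)) := by
  have h : ∀ g k : G, ∑ m, (stabRel x g m && stabRel y m k).toNat =
      fixCard G x y * (stabRel (mk G x y) g k).toNat := fun g k => by
    rw [stabRel_tensor]
    by_cases hm : ∃ m, stabRel x g m = true ∧ stabRel y m k = true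
    · rw [BoolRel.comp_iff.2 hm, Bool.toNat_true, mul_one, fixCard]
      obtain ⟨m, hx, hy⟩ := hm
      rw [stabRel_iff] at hx hy
      rw [← Equiv.sum_comp (Equiv.mulLeft m)]
      refine Finset.sum_congr rfl fun n _ => congrArg Bool.toNat ?_
      rw [Bool.eq_iff_iff, Bool.and_eq_true, Bool.and_eq_true]
      simp only [stabRel_iff, Equiv.coe_mulLeft]
      refine and_congr ?_ ?_
      · rw [MulOpposite.op_mul, mul_smul, ← hx, ← smul_comm, one_smul,
          (MulAction.injective g).eq_iff]
      · rw [mul_smul, ← hy, (MulAction.injective m).eq_iff, MulOpposite.op_one, one_smul]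
    · rw [Bool.eq_false_iff.2 fun h => hm (BoolRel.comp_iff.1 h), Bool.toNat_false, mul_zero]
      refine Finset.sum_eq_zero fun m _ => ?_
      rw [Bool.toNat_eq_zero, ← Bool.not_eq_true, Bool.and_eq_true]
      exact fun h => hm ⟨m, h⟩
  rw [BoolRel.card, Finset.mul_sum]
  simp only [Finset.mul_sum, ← h, BoolRel.compCard, Finset.sum_mul]
  rw [Finset.sum_comm]
  conv_rhs => rw [Finset.sum_comm]
  refine Finset.sum_congr rfl fun k _ => ?_
  rw [Finset.sum_comm]
  refine Finset.sum_congr rfl fun g _ => Finset.sum_congr rfl fun m _ => ?_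
  cases stabRel x g m <;> cases stabRel y m k <;> rfl

open scoped Classical in
theorem sum_fixCard_fiber [Fintype X] [Fintype Y] (z : BisetTensor G X Y) :
    ∑ q : X × Y with mk G q.1 q.2 = z, fixCard G q.1 q.2 = Fintype.card G := by
  induction z using BisetTensor.ind with | _ x y
  have h : ∀ q ∈ ({q : X × Y | mk G q.1 q.2 = mk G x y} : Finset (X × Y)), fixCard G q.1 q.2 =
      ∑ n : G, if (op n⁻¹ • x, n • y) = q then 1 else 0 := by
    rintro ⟨x', y'⟩ hq
    obtain ⟨n, hn⟩ := Quotient.exact (Finset.mem_filter.1 hq).2.symm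
    obtain ⟨rfl, rfl⟩ := Prod.mk.inj hn
    rw [fixCard, ← Equiv.sum_comp (Equiv.mulRight n⁻¹)]
    refine Finset.sum_congr rfl fun i _ => ?_
    have h1 : stabRel (op n⁻¹ • x) (1 : G) (i * n⁻¹) = true ↔ op i⁻¹ • x = op n⁻¹ • x := by
      rw [stabRel_iff, one_smul, ← (MulAction.injective (op (n * i⁻¹))).eq_iff, smul_smul,
        smul_smul, smul_smul]
      simp [-MulOpposite.op_inv, ← MulOpposite.op_mul]
    have h2 : stabRel (n • y) (i * n⁻¹) (1 : G) = true ↔ i • y = n • y := by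
      rw [stabRel_iff, MulOpposite.op_one, one_smul, smul_smul, inv_mul_cancel_right]
    rw [Equiv.coe_mulRight]
    split_ifs with hi
    · rw [h1.2 (Prod.mk.inj hi).1, h2.2 (Prod.mk.inj hi).2]
      rfl
    · rw [Bool.toNat_eq_zero, ← Bool.not_eq_true, Bool.and_eq_true, h1, h2]
      exact fun h => hi (Prod.ext h.1 h.2)
  rw [Finset.sum_congr rfl h, Finset.sum_comm, Fintype.card, Finset.card_eq_sum_ones]
  refine Finset.sum_congr rfl fun n _ => ?_
  rw [Finset.sum_ite_eq, if_pos]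
  exact Finset.mem_filter.2 ⟨Finset.mem_univ _, mk_smul_smul n x y⟩

theorem sum_fixCard_smul [Fintype X] [Fintype Y] [Fintype (BisetTensor G X Y)] {V : Type*}
    [AddCommMonoid V] (ψ : BisetTensor G X Y → V) :
    ∑ x : X, ∑ y : Y, fixCard G x y • ψ (mk G x y) = Fintype.card G • ∑ z, ψ z := by
  classical
  rw [← Fintype.sum_prod_type' fun x y => fixCard G x y • ψ (mk G x y),
    ← Finset.sum_fiberwise _ fun q : X × Y => mk G q.1 q.2, Finset.smul_sum]
  refine Finset.sum_congr rfl fun z _ => ?_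
  rw [← sum_fixCard_fiber z, Finset.sum_smul]
  refine Finset.sum_congr rfl fun q hq => ?_
  rw [(Finset.mem_filter.1 hq).2]

end BisetTensor

theorem BisetClass.pointSum_mul {G : Type*} [Group G] [Fintype G] {V : Type*} [AddCommMonoid V]
    (F : (G → G → Bool) → V) (X Y : Type*) [Fintype X] [MulAction G X] [MulAction Gᵐᵒᵖ X]
    [SMulCommClass G Gᵐᵒᵖ X] [Fintype Y] [MulAction G Y] [MulAction Gᵐᵒᵖ Y]
    [SMulCommClass G Gᵐᵒᵖ Y] :
    Fintype.card G • pointSum (fun A => BoolRel.card A • F A) (mk G X * mk G Y) =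
      ∑ x : X, ∑ y : Y, BoolRel.compCard (stabRel (G := G) x) (stabRel y) •
        F (BoolRel.comp (stabRel x) (stabRel y)) := by
  have := Fintype.ofFinite (BisetTensor G X Y)
  rw [mk_mul_mk, pointSum_mk, ← BisetTensor.sum_fixCard_smul]
  refine Finset.sum_congr rfl fun x _ => Finset.sum_congr rfl fun y _ => ?_
  rw [BisetTensor.compCard_eq_fixCard_mul, mul_smul, stabRel_tensor]

/-! ### Transitive bisets -/

/-- The transitive biset `(G × G) / L`, with `g (a, b) h = (g a, h⁻¹ b)`. -/
def CosetBiset {G : Type*} [Group G] (L : Subgroup (G × G)) : Type _ := (G × G) ⧸ L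

namespace CosetBiset

variable {G : Type*} [Group G] (L : Subgroup (G × G))

instance : MulAction G (CosetBiset L) :=
  MulAction.compHom ((G × G) ⧸ L) (MonoidHom.inl G G)

instance : MulAction Gᵐᵒᵖ (CosetBiset L) :=
  MulAction.compHom ((G × G) ⧸ L) ((MonoidHom.inr G G).comp (MulEquiv.inv' G).symm.toMonoidHom)

instance [Finite G] : Finite (CosetBiset L) := inferInstanceAs (Finite ((G × G) ⧸ L))

/-- The coset of `(a, b)`. -/
def mk (a b : G) : CosetBiset L := QuotientGroup.mk (a, b)

theorem ind {p : CosetBiset L → Prop} (h : ∀ a b, p (mk L a b)) (x : CosetBiset L) : p x :=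
  Quotient.inductionOn' x fun q => h q.1 q.2

theorem smul_mk (g a b : G) : g • mk L a b = mk L (g * a) b := by
  change ((g, 1) : G × G) • (QuotientGroup.mk (a, b) : (G × G) ⧸ L) = _
  rw [MulAction.Quotient.smul_mk]
  simp [mk]

theorem op_smul_mk (h a b : G) : op h • mk L a b = mk L a (h⁻¹ * b) := by
  change ((1, h⁻¹) : G × G) • (QuotientGroup.mk (a, b) : (G × G) ⧸ L) = _
  rw [MulAction.Quotient.smul_mk]
  simp [mk]

instance : SMulCommClass G Gᵐᵒᵖ (CosetBiset L) where
  smul_comm g h := ind L fun a b => by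
    rw [← MulOpposite.op_unop h, op_smul_mk, smul_mk, smul_mk, op_smul_mk]

theorem mk_eq_mk {a b c d : G} : mk L a b = mk L c d ↔ (a⁻¹ * c, b⁻¹ * d) ∈ L :=
  QuotientGroup.eq

theorem stabRel_mk_one {g h : G} : stabRel (mk L 1 1) g h = true ↔ (g, h) ∈ L := by
  rw [stabRel_iff, smul_mk, op_smul_mk, mk_eq_mk, ← inv_mem_iff]
  simp

variable {X : Type*} [MulAction G X] [MulAction Gᵐᵒᵖ X] [SMulCommClass G Gᵐᵒᵖ X]
  (x : X) (hL : ∀ g h, stabRel x g h = true ↔ (g, h) ∈ L)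

theorem smul_op_smul_eq_iff (a b c d : G) :
    a • op b⁻¹ • x = c • op d⁻¹ • x ↔ stabRel x (a⁻¹ * c) (b⁻¹ * d) = true := by
  have h : a • op b⁻¹ • x = op d⁻¹ • a • op (b⁻¹ * d) • x := by
    rw [← smul_comm a (op d⁻¹), smul_smul (op d⁻¹), ← MulOpposite.op_mul, mul_inv_cancel_right]
  rw [stabRel_iff, h, smul_comm c (op d⁻¹), (MulAction.injective (op d⁻¹)).eq_iff, mul_smul,
    inv_smul_eq_iff, eq_comm]

/-- The map `(a, b) ↦ a x b⁻¹`. -/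
def toOrbit : CosetBiset L → X :=
  Quotient.lift (fun q : G × G => q.1 • op q.2⁻¹ • x) fun p q h => by
    exact (smul_op_smul_eq_iff x _ _ _ _).2 ((hL _ _).2 (QuotientGroup.leftRel_apply.1 h))

theorem toOrbit_mk (a b : G) : toOrbit L x hL (mk L a b) = a • op b⁻¹ • x := rfl

theorem toOrbit_injective : Function.Injective (toOrbit L x hL) := by
  intro p q h
  induction p using ind with | _ a b
  induction q using ind with | _ c d
  rw [toOrbit_mk, toOrbit_mk] at h
  rw [mk_eq_mk, ← hL, ← smul_op_smul_eq_iff, h]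

theorem toOrbit_smul (g : G) (p : CosetBiset L) :
    toOrbit L x hL (g • p) = g • toOrbit L x hL p := by
  induction p using ind with | _ a b
  rw [smul_mk, toOrbit_mk, toOrbit_mk, mul_smul]

theorem toOrbit_op_smul (h : Gᵐᵒᵖ) (p : CosetBiset L) :
    toOrbit L x hL (h • p) = h • toOrbit L x hL p := by
  induction p using ind with | _ a b
  rw [← MulOpposite.op_unop h, op_smul_mk, toOrbit_mk, toOrbit_mk, ← smul_comm a (op (unop h)),
    smul_smul (op (unop h)), ← MulOpposite.op_mul]
  simp

/-- A transitive biset is isomorphic to `(G × G) / L`, for the stabilizer `L` of a point. -/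
noncomputable def isoOfTransitive (h : ∀ y : X, ∃ a b : G, a • op b⁻¹ • x = y) :
    BisetIso G (CosetBiset L) X where
  toEquiv := Equiv.ofBijective (toOrbit L x hL) ⟨toOrbit_injective L x hL, fun y => by
    obtain ⟨a, b, rfl⟩ := h y
    exact ⟨mk L a b, rfl⟩⟩
  map_left := toOrbit_smul L x hL
  map_right := toOrbit_op_smul L x hL

theorem exists_smul_mk_one (y : CosetBiset L) : ∃ a b : G, a • op b⁻¹ • mk L 1 1 = y := by
  induction y using ind with | _ a b
  exact ⟨a, b, by rw [op_smul_mk, smul_mk]; simp⟩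

end CosetBiset

/-- The stabilizer of a point of a biset. -/
def stabSubgroup {G : Type*} [Group G] {X : Type*} [MulAction G X] [MulAction Gᵐᵒᵖ X]
    [SMulCommClass G Gᵐᵒᵖ X] (x : X) : Subgroup (G × G) where
  carrier := {q | stabRel x q.1 q.2 = true}
  one_mem' := by simp [stabRel_iff]
  mul_mem' {p q} hp hq := by
    rw [Set.mem_ofPred_eq, stabRel_iff] at hp hq ⊢
    rw [Prod.fst_mul, Prod.snd_mul, mul_smul, hq, smul_comm, hp, smul_smul, MulOpposite.op_mul]
  inv_mem' {p} hp := by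
    rw [Set.mem_ofPred_eq, stabRel_iff] at hp ⊢
    rw [Prod.fst_inv, Prod.snd_inv, inv_smul_eq_iff, smul_comm, eq_comm, MulOpposite.op_inv,
      inv_smul_eq_iff, hp]

/-- Every finite biset is a disjoint union of transitive bisets. -/
theorem BisetClass.induction_transitive {G : Type} [Group G] [Finite G] {p : BisetClass G → Prop}
    (empty : ∀ (X : Type) [Finite X] [MulAction G X] [MulAction Gᵐᵒᵖ X] [SMulCommClass G Gᵐᵒᵖ X]
      [IsEmpty X], p (mk G X))
    (coset : ∀ L : Subgroup (G × G), p (mk G (CosetBiset L)))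
    (sum : ∀ (X Y : Type) [Finite X] [MulAction G X] [MulAction Gᵐᵒᵖ X] [SMulCommClass G Gᵐᵒᵖ X]
      [Finite Y] [MulAction G Y] [MulAction Gᵐᵒᵖ Y] [SMulCommClass G Gᵐᵒᵖ Y],
      p (mk G X) → p (mk G Y) → p (mk G (X ⊕ Y)))
    (X : Type) [Finite X] [MulAction G X] [MulAction Gᵐᵒᵖ X] [SMulCommClass G Gᵐᵒᵖ X] :
    p (mk G X) := by
  induction hn : Nat.card X using Nat.strong_induction_on generalizing X with | _ n ih
  rcases isEmpty_or_nonempty X with hX | ⟨⟨x⟩⟩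
  · exact empty X
  let L := stabSubgroup (G := G) x
  have hL : ∀ g h, stabRel x g h = true ↔ (g, h) ∈ L := fun _ _ => Iff.rfl
  let f := CosetBiset.toOrbit L x hL
  let Y := {y : X // y ∉ Set.range f}
  let : MulAction G Y :=
    { smul := fun g y => ⟨g • y.1, fun ⟨z, hz⟩ => y.2 ⟨g⁻¹ • z, by
        exact (CosetBiset.toOrbit_smul L x hL g⁻¹ z).trans (inv_smul_eq_iff.2 hz)⟩⟩
      one_smul := fun y => Subtype.ext (one_smul G y.1)
      mul_smul := fun g h y => Subtype.ext (mul_smul g h y.1) }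
  let : MulAction Gᵐᵒᵖ Y :=
    { smul := fun g y => ⟨g • y.1, fun ⟨z, hz⟩ => y.2 ⟨g⁻¹ • z, by
        exact (CosetBiset.toOrbit_op_smul L x hL g⁻¹ z).trans (inv_smul_eq_iff.2 hz)⟩⟩
      one_smul := fun y => Subtype.ext (one_smul Gᵐᵒᵖ y.1)
      mul_smul := fun g h y => Subtype.ext (mul_smul g h y.1) }
  have : SMulCommClass G Gᵐᵒᵖ Y := ⟨fun g h y => Subtype.ext (smul_comm g h y.1)⟩
  have hY : Nat.card Y < n := by
    rw [← hn]
    exact Finite.card_subtype_lt (x := x) fun hx => hx ⟨CosetBiset.mk L 1 1, by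
      change (1 : G) • op (1 : G)⁻¹ • x = x
      simp⟩
  have e : BisetIso G (CosetBiset L ⊕ Y) X :=
    { toEquiv := Equiv.ofBijective (Sum.elim f Subtype.val) (by
        constructor
        · rintro (a | a) (b | b) hab
          · exact congrArg _ (CosetBiset.toOrbit_injective L x hL hab)
          · exact (b.2 ⟨a, hab⟩).elim
          · exact (a.2 ⟨b, hab.symm⟩).elim
          · exact congrArg _ (Subtype.ext hab)
        · intro y
          by_cases hy : y ∈ Set.range f
          · obtain ⟨z, hz⟩ := hy
            exact ⟨.inl z, hz⟩
          · exact ⟨.inr ⟨y, hy⟩, rfl⟩)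
      map_left := by
        rintro g (a | a)
        · exact CosetBiset.toOrbit_smul L x hL g a
        · rfl
      map_right := by
        rintro g (a | a)
        · exact CosetBiset.toOrbit_op_smul L x hL g a
        · rfl }
  rw [← mk_eq_mk_iff.2 ⟨e⟩]
  exact sum _ _ (coset L) (ih _ hY Y rfl)

/-! ### The symmetric group on three letters -/

/-- The symmetric group on three letters. -/
abbrev SymThree : Type := Equiv.Perm (Fin 3)

namespace SymThree

/-- An enumeration of the elements: the rotations, followed by the reflections. -/
def elem (i : ℕ) : SymThree := finRotate 3 ^ (i % 3) * Equiv.swap 0 1 ^ (i / 3)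

/-- The position of an element in the enumeration. -/
def index (g : SymThree) : ℕ := if g 1 = g 0 + 1 then (g 0).val else (g 0 + 2).val + 3

theorem elem_index : ∀ g, elem (index g) = g := by decide

theorem index_lt : ∀ g, index g < 6 := by decide

theorem index_elem : ∀ i < 6, index (elem i) = i := by decide

/-- The multiplication table, in octal digits. -/
def mulTable (i j : ℕ) : ℕ := (6622054817125761803614952015496 >>> (3 * (6 * i + j))) % 8

/-- The table of conjugates, in octal digits. -/
def conjTable (i j : ℕ) : ℕ := (220670793711428686115948206409352 >>> (3 * (6 * i + j))) % 8

theorem elem_mulTable : ∀ i < 6, ∀ j < 6, elem (mulTable i j) = elem i * elem j := by decide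

theorem elem_conjTable : ∀ i < 6, ∀ j < 6,
    elem (conjTable i j) = elem i * elem j * (elem i)⁻¹ := by decide

theorem mulTable_lt : ∀ i < 6, ∀ j < 6, mulTable i j < 6 := by decide

theorem conjTable_lt : ∀ i < 6, ∀ j < 6, conjTable i j < 6 := by decide

/-- The enumeration as a bijection. -/
def equivFin : Fin 6 ≃ SymThree where
  toFun i := elem i
  invFun g := ⟨index g, index_lt g⟩
  left_inv i := Fin.ext (index_elem i i.2)
  right_inv := elem_index

theorem sum_eq {M : Type*} [AddCommMonoid M] (f : SymThree → M) :
    ∑ g, f g = f (elem 0) + f (elem 1) + f (elem 2) + f (elem 3) + f (elem 4) + f (elem 5) := by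
  rw [← Equiv.sum_comp equivFin, Fin.sum_univ_six]
  rfl

theorem exists_iff {p : SymThree → Prop} : (∃ g, p g) ↔ ∃ i < 6, p (elem i) :=
  ⟨fun ⟨g, h⟩ => ⟨index g, index_lt g, by rwa [elem_index]⟩, fun ⟨i, _, h⟩ => ⟨_, h⟩⟩

/-- The relation on `S₃` that is encoded in the binary digits of a number. -/
def ofMask (L : ℕ) (g h : SymThree) : Bool := L.testBit (6 * index g + index h)

/-- The subgroups of `S₃ × S₃` up to conjugation, as relations. -/
def masks : List ℕ :=
  [1, 33, 7, 63, 1073741825, 35433480225, 7516192775, 67645734975, 4161, 137313, 29127, 262143,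
    1090785345, 35995916385, 7635497415, 68719476735, 34359738369, 60129542151, 34905002049,
    61083775431, 16513, 34630287489]

/-- The multiplication table of `S₃ × S₃`. -/
def pairMul (x y : ℕ) : ℕ := 6 * mulTable (x / 6) (y / 6) + mulTable (x % 6) (y % 6)

/-- The enumeration of `S₃ × S₃`. -/
def pair (x : ℕ) : SymThree × SymThree := (elem (x / 6), elem (x % 6))

theorem exists_pair (q : SymThree × SymThree) : ∃ x < 36, pair x = q := by
  have h1 := index_lt q.1
  have h2 := index_lt q.2
  refine ⟨6 * index q.1 + index q.2, by omega, Prod.ext ?_ ?_⟩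
  · change elem _ = _
    rw [show (6 * index q.1 + index q.2) / 6 = index q.1 by omega, elem_index]
  · change elem _ = _
    rw [show (6 * index q.1 + index q.2) % 6 = index q.2 by omega, elem_index]

theorem ofMask_pair (L x : ℕ) (hx : x < 36) :
    ofMask L (pair x).1 (pair x).2 = L.testBit x := by
  rw [ofMask, pair, index_elem _ (by omega), index_elem _ (by omega), Nat.div_add_mod]

theorem pairMul_lt {x y : ℕ} (hx : x < 36) (hy : y < 36) : pairMul x y < 36 := by
  have h1 := mulTable_lt (x / 6) (by omega) (y / 6) (by omega)
  have h2 := mulTable_lt (x % 6) (by omega) (y % 6) (by omega)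
  unfold pairMul
  omega

theorem pair_pairMul {x y : ℕ} (hx : x < 36) (hy : y < 36) :
    pair (pairMul x y) = pair x * pair y := by
  have h1 := mulTable_lt (x / 6) (by omega) (y / 6) (by omega)
  have h2 := mulTable_lt (x % 6) (by omega) (y % 6) (by omega)
  refine Prod.ext ?_ ?_
  · change elem _ = elem _ * elem _
    rw [pairMul, ← elem_mulTable _ (by omega) _ (by omega)]
    congr 1
    omega
  · change elem _ = elem _ * elem _
    rw [pairMul, ← elem_mulTable _ (by omega) _ (by omega)]
    congr 1
    omega

theorem testBit_pairMul : ∀ L ∈ masks, ∀ x < 36, L.testBit x = true →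
    ∀ y < 36, L.testBit y = true → L.testBit (pairMul x y) = true := by decide +kernel

theorem testBit_zero : ∀ L ∈ masks, L.testBit 0 = true := by decide +kernel

theorem exists_pairMul_eq_zero : ∀ L ∈ masks, ∀ x < 36, L.testBit x = true →
    ∃ y < 36, L.testBit y = true ∧ pairMul x y = 0 := by decide +kernel

/-- The subgroup that is encoded in the binary digits of a number. -/
def maskSubgroup (L : ℕ) (hL : L ∈ masks) : Subgroup (SymThree × SymThree) where
  carrier := {q | ofMask L q.1 q.2 = true}
  one_mem' := testBit_zero L hL
  mul_mem' {p q} hp hq := by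
    obtain ⟨x, hx, rfl⟩ := exists_pair p
    obtain ⟨y, hy, rfl⟩ := exists_pair q
    rw [Set.mem_ofPred_eq, ofMask_pair _ _ hx] at hp
    rw [Set.mem_ofPred_eq, ofMask_pair _ _ hy] at hq
    rw [Set.mem_ofPred_eq, ← pair_pairMul hx hy, ofMask_pair _ _ (pairMul_lt hx hy)]
    exact testBit_pairMul L hL x hx hp y hy hq
  inv_mem' {p} hp := by
    obtain ⟨x, hx, rfl⟩ := exists_pair p
    rw [Set.mem_ofPred_eq, ofMask_pair _ _ hx] at hp
    obtain ⟨y, hy, hLy, h⟩ := exists_pairMul_eq_zero L hL x hx hp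
    have h := pair_pairMul hx hy ▸ congrArg pair h
    rw [inv_eq_of_mul_eq_one_right (b := pair y) h, Set.mem_ofPred_eq, ofMask_pair _ _ hy]
    exact hLy

/-! ### The subgroups of `S₃ × S₃` up to conjugation -/

/-- Evaluate `n`, then apply `k`. -/
def force {α : Type} (n : ℕ) (k : ℕ → α) : α := Nat.rec (k 0) (fun m _ => k (m + 1)) n

@[simp] theorem force_eq {α : Type} (n : ℕ) (k : ℕ → α) : force n k = k n := by
  cases n <;> rfl

/-- Add the products of `x` with the elements of `m` below `n`. -/
def addTranslate (x m acc : ℕ) : ℕ → ℕ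
  | 0 => acc
  | y + 1 => bif m.testBit y then
      force (acc ||| (1 <<< pairMul x y)) fun acc => addTranslate x m acc y
    else addTranslate x m acc y

/-- Add the products of the elements of `m`, the first of them below `n`. -/
def addProducts (m acc : ℕ) : ℕ → ℕ
  | 0 => acc
  | x + 1 => bif m.testBit x then force (addTranslate x m acc 36) fun acc => addProducts m acc x
    else addProducts m acc x

/-- Repeatedly add the products of elements. -/
def addAllProducts (m : ℕ) : ℕ → ℕ
  | 0 => m
  | k + 1 => force (addProducts m m 36) fun m => addAllProducts m k

/-- Add the conjugates of the elements of `m` below `n`. -/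
def addConj (g h m acc : ℕ) : ℕ → ℕ
  | 0 => acc
  | y + 1 => bif m.testBit y then
      force (acc ||| (1 <<< (6 * conjTable g (y / 6) + conjTable h (y % 6)))) fun acc =>
        addConj g h m acc y
    else addConj g h m acc y

/-- Whether `a` has a conjugate in the list of subgroups. -/
def isConjMask (a : ℕ) : Bool :=
  (List.range 36).any fun x => masks.any fun r => (addConj (x / 6) (x % 6) a 0 36).beq r

/-- Whether all subgroups that agree with `a` outside of the last `n` elements are conjugate to a
subgroup in the list. -/
def search : ℕ → ℕ → Bool
  | 0, a => isConjMask a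
  | n + 1, a => bif a.testBit (35 - n) then search n a else
      search n a && force (addTranslate (35 - n) a a 36) fun c =>
        bif (c % 2 ^ (35 - n)).beq (a % 2 ^ (35 - n)) then
          force (addAllProducts c 3) fun c =>
            bif (c % 2 ^ (35 - n)).beq (a % 2 ^ (35 - n)) then search n c else true
        else true

set_option maxRecDepth 100000 in
theorem search_eq_true : search 35 1 = true := by decide +kernel

theorem testBit_or_one_shiftLeft {a k i : ℕ} :
    (a ||| (1 <<< k)).testBit i = true ↔ a.testBit i = true ∨ i = k := by
  rw [Nat.testBit_or, Bool.or_eq_true, Nat.one_shiftLeft, Nat.testBit_two_pow, decide_eq_true_iff,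
    eq_comm (a := k)]

theorem testBit_addTranslate {x m i : ℕ} (n acc : ℕ) :
    (addTranslate x m acc n).testBit i = true ↔
      acc.testBit i = true ∨ ∃ y < n, m.testBit y = true ∧ i = pairMul x y := by
  induction n generalizing acc with
  | zero => simp [addTranslate]
  | succ n ih =>
    rw [addTranslate]
    cases h : m.testBit n
    · rw [cond_false, ih]
      refine or_congr_right ⟨fun ⟨y, hy, h⟩ => ⟨y, by omega, h⟩, fun ⟨y, hy, h'⟩ => ⟨y, ?_, h'⟩⟩
      rcases Nat.lt_succ_iff_lt_or_eq.1 hy with hy | rfl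
      · exact hy
      · rw [h] at h'; exact absurd h'.1 (by simp)
    · rw [cond_true, force_eq, ih, testBit_or_one_shiftLeft, or_assoc]
      refine or_congr_right ⟨?_, fun ⟨y, hy, h'⟩ => ?_⟩
      · rintro (rfl | ⟨y, hy, h⟩)
        · exact ⟨n, by omega, h, rfl⟩
        · exact ⟨y, by omega, h⟩
      · rcases Nat.lt_succ_iff_lt_or_eq.1 hy with hy | rfl
        · exact .inr ⟨y, hy, h'⟩
        · exact .inl h'.2

theorem testBit_addConj {g h m i : ℕ} (n acc : ℕ) :
    (addConj g h m acc n).testBit i = true ↔ acc.testBit i = true ∨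
      ∃ y < n, m.testBit y = true ∧ i = 6 * conjTable g (y / 6) + conjTable h (y % 6) := by
  induction n generalizing acc with
  | zero => simp [addConj]
  | succ n ih =>
    rw [addConj]
    cases h : m.testBit n
    · rw [cond_false, ih]
      refine or_congr_right ⟨fun ⟨y, hy, h⟩ => ⟨y, by omega, h⟩, fun ⟨y, hy, h'⟩ => ⟨y, ?_, h'⟩⟩
      rcases Nat.lt_succ_iff_lt_or_eq.1 hy with hy | rfl
      · exact hy
      · rw [h] at h'; exact absurd h'.1 (by simp)
    · rw [cond_true, force_eq, ih, testBit_or_one_shiftLeft, or_assoc]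
      refine or_congr_right ⟨?_, fun ⟨y, hy, h'⟩ => ?_⟩
      · rintro (rfl | ⟨y, hy, h⟩)
        · exact ⟨n, by omega, h, rfl⟩
        · exact ⟨y, by omega, h⟩
      · rcases Nat.lt_succ_iff_lt_or_eq.1 hy with hy | rfl
        · exact .inr ⟨y, hy, h'⟩
        · exact .inl h'.2

section Sound

variable (H : Subgroup (SymThree × SymThree))

/-- The elements encoded in the binary digits of `m` belong to `H`. -/
def MaskLE (m : ℕ) : Prop := ∀ i, m.testBit i = true → i < 36 ∧ pair i ∈ H

variable {H}

theorem MaskLE.addTranslate {x m acc : ℕ} (hx : x < 36 ∧ pair x ∈ H) (hm : MaskLE H m)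
    (hacc : MaskLE H acc) (n : ℕ) : MaskLE H (addTranslate x m acc n) := by
  intro i hi
  rcases (testBit_addTranslate n acc).1 hi with hi | ⟨y, -, hy, rfl⟩
  · exact hacc i hi
  · have hy := hm y hy
    refine ⟨pairMul_lt hx.1 hy.1, ?_⟩
    rw [pair_pairMul hx.1 hy.1]
    exact mul_mem hx.2 hy.2

theorem MaskLE.addProducts {m acc : ℕ} (hm : MaskLE H m) (hacc : MaskLE H acc) (n : ℕ) :
    MaskLE H (addProducts m acc n) := by
  induction n generalizing acc with
  | zero => exact hacc
  | succ n ih =>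
    rw [SymThree.addProducts]
    cases h : m.testBit n
    · exact ih hacc
    · rw [cond_true, force_eq]
      exact ih (hm.addTranslate (hm n h) hacc 36)

theorem MaskLE.addAllProducts {m : ℕ} (hm : MaskLE H m) (k : ℕ) :
    MaskLE H (addAllProducts m k) := by
  induction k generalizing m with
  | zero => exact hm
  | succ k ih =>
    rw [SymThree.addAllProducts, force_eq]
    exact ih (hm.addProducts hm 36)

theorem testBit_addProducts {m acc i : ℕ} (hi : acc.testBit i = true) (n : ℕ) :
    (addProducts m acc n).testBit i = true := by
  induction n generalizing acc with
  | zero => exact hi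
  | succ n ih =>
    rw [addProducts]
    cases h : m.testBit n
    · exact ih hi
    · rw [cond_true, force_eq]
      exact ih ((testBit_addTranslate _ _).2 (.inl hi))

theorem testBit_addAllProducts {m i : ℕ} (hi : m.testBit i = true) (k : ℕ) :
    (addAllProducts m k).testBit i = true := by
  induction k generalizing m with
  | zero => exact hi
  | succ k ih =>
    rw [addAllProducts, force_eq]
    exact ih (testBit_addProducts hi 36)

theorem mod_beq_mod {a c e : ℕ} (ha : ∀ i < e, pair i ∈ H → a.testBit i = true)
    (hac : ∀ i, a.testBit i = true → c.testBit i = true) (hc : MaskLE H c) :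
    (c % 2 ^ e).beq (a % 2 ^ e) = true := by
  rw [Nat.beq_eq]
  refine Nat.eq_of_testBit_eq fun i => ?_
  rw [Nat.testBit_mod_two_pow, Nat.testBit_mod_two_pow, Bool.eq_iff_iff, Bool.and_eq_true,
    Bool.and_eq_true, decide_eq_true_iff]
  exact and_congr_right fun hi => ⟨fun h => ha i hi (hc i h).2, hac i⟩

theorem exists_isConjMask (n a : ℕ) (hn : n ≤ 35) (h : search n a = true)
    (ha : ∀ i < 36 - n, pair i ∈ H → a.testBit i = true) (haH : MaskLE H a) :
    ∃ a, isConjMask a = true ∧ (∀ i < 36, pair i ∈ H → a.testBit i = true) ∧ MaskLE H a := by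
  induction n generalizing a with
  | zero => exact ⟨a, h, ha, haH⟩
  | succ n ih =>
    have he : 36 - (n + 1) = 35 - n := by omega
    have he' : 36 - n = 35 - n + 1 := by omega
    rw [he] at ha
    rw [he'] at ih
    rw [search] at h
    cases hb : a.testBit (35 - n)
    · rw [hb, cond_false, Bool.and_eq_true] at h
      by_cases hH : pair (35 - n) ∈ H
      · have hc := haH.addTranslate ⟨by omega, hH⟩ haH 36
        have hac := fun i (hi : a.testBit i = true) =>
          (testBit_addTranslate (x := 35 - n) (m := a) 36 a).2 (.inl hi)
        have hce : (addTranslate (35 - n) a a 36).testBit (35 - n) = true := by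
          refine (testBit_addTranslate _ _).2 (.inr ⟨0, by omega, ha 0 (by omega) H.one_mem, ?_⟩)
          have : ∀ x < 36, x = pairMul x 0 := by decide
          exact this _ (by omega)
        have h := h.2
        rw [force_eq, mod_beq_mod ha hac hc, cond_true, force_eq,
          mod_beq_mod ha (fun i hi => testBit_addAllProducts (hac i hi) 3) (hc.addAllProducts 3),
          cond_true] at h
        refine ih _ (by omega) h (fun i hi hiH => ?_) (hc.addAllProducts 3)
        rcases Nat.lt_succ_iff_lt_or_eq.1 hi with hi | rfl
        · exact testBit_addAllProducts (hac i (ha i hi hiH)) 3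
        · exact testBit_addAllProducts hce 3
      · refine ih a (by omega) h.1 (fun i hi hiH => ?_) haH
        rcases Nat.lt_succ_iff_lt_or_eq.1 hi with hi | rfl
        · exact ha i hi hiH
        · exact absurd hiH hH
    · rw [hb, cond_true] at h
      refine ih a (by omega) h (fun i hi hiH => ?_) haH
      rcases Nat.lt_succ_iff_lt_or_eq.1 hi with hi | rfl
      · exact ha i hi hiH
      · exact hb

end Sound

/-- Every subgroup of `S₃ × S₃` is conjugate to one in the list. -/
theorem exists_conj_eq_ofMask (H : Subgroup (SymThree × SymThree)) (A : SymThree → SymThree → Bool)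
    (hA : ∀ g h, A g h = true ↔ (g, h) ∈ H) :
    ∃ g h, ∃ L ∈ masks, BoolRel.conj g h A = ofMask L := by
  obtain ⟨a, ha, h1, h2⟩ := exists_isConjMask (H := H) 35 1 le_rfl search_eq_true
    (fun i hi _ => by
      obtain rfl : i = 0 := by omega
      rfl)
    (fun i hi => by
      rw [← Nat.pow_zero 2, Nat.testBit_two_pow, decide_eq_true_iff] at hi
      subst hi
      exact ⟨by omega, H.one_mem⟩)
  rw [isConjMask, List.any_eq_true] at ha
  obtain ⟨x, hx, ha⟩ := ha
  rw [List.any_eq_true] at ha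
  obtain ⟨L, hL, ha⟩ := ha
  rw [List.mem_range] at hx
  rw [Nat.beq_eq] at ha
  refine ⟨elem (x / 6), elem (x % 6), L, hL, ?_⟩
  funext p q
  rw [Bool.eq_iff_iff, BoolRel.conj, hA, ← ha, ofMask, testBit_addConj, Nat.zero_testBit]
  have hp := index_lt p
  have hq := index_lt q
  have key : ∀ y < 36, 6 * index p + index q =
      6 * conjTable (x / 6) (y / 6) + conjTable (x % 6) (y % 6) ↔
      pair y = ((elem (x / 6))⁻¹ * p * elem (x / 6), (elem (x % 6))⁻¹ * q * elem (x % 6)) := by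
    intro y hy
    have c1 := conjTable_lt (x / 6) (by omega) (y / 6) (by omega)
    have c2 := conjTable_lt (x % 6) (by omega) (y % 6) (by omega)
    have e1 := elem_conjTable (x / 6) (by omega) (y / 6) (by omega)
    have e2 := elem_conjTable (x % 6) (by omega) (y % 6) (by omega)
    have : 6 * index p + index q =
        6 * conjTable (x / 6) (y / 6) + conjTable (x % 6) (y % 6) ↔
        index p = conjTable (x / 6) (y / 6) ∧ index q = conjTable (x % 6) (y % 6) := by omega
    rw [this, pair, Prod.mk_inj]
    refine and_congr ⟨fun h => ?_, fun h => ?_⟩ ⟨fun h => ?_, fun h => ?_⟩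
    · rw [← elem_index p, h, e1]; group
    · rw [← index_elem _ c1, e1, h]; congr 1; group
    · rw [← elem_index q, h, e2]; group
    · rw [← index_elem _ c2, e2, h]; congr 1; group
  constructor
  · intro h
    obtain ⟨y, hy, hyp⟩ := exists_pair ((elem (x / 6))⁻¹ * p * elem (x / 6),
      (elem (x % 6))⁻¹ * q * elem (x % 6))
    exact .inr ⟨y, hy, h1 y hy (hyp ▸ h), (key y hy).2 hyp⟩
  · rintro (h | ⟨y, hy, hay, h⟩)
    · exact absurd h (by simp)
    · rw [← (key y hy).1 h]
      exact (h2 y hay).2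

end SymThree

namespace SymThree

/-! ### The images of the transitive bisets in the order -/

/-- The image in `A_ℤ` of a transitive biset, where `d` and `k` are the sizes of the domain and of the
kernel of a stabilizer, and `r` is the size of its range. -/
def image : ℕ → ℕ → ℕ → OrderA ℤ
  | 1, 1, 1 => ⟨!![1,1,2;1,1,2;2,2,4], ![0,0,0], 0, 0, 0, ![8,8,16], 0, 0, 0, 0⟩
  | 1, 1, 2 => ⟨!![1,0,1;1,0,1;2,0,2], ![0,0,0], 0, 0, 0, ![8,0,8], 0, 0, 0, 0⟩
  | 1, 1, 3 => ⟨!![1,1,0;1,1,0;2,2,0], ![-2,-2,-4], 0, 0, 0, ![8,8,0], 0, 0, -16, 0⟩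
  | 1, 1, 6 => ⟨!![1,0,0;1,0,0;2,0,0], ![0,0,0], 0, 0, 0, ![8,0,0], 0, 0, 0, 0⟩
  | 2, 2, 1 => ⟨!![1,1,2;0,0,0;1,1,2], ![0,0,0], 0, 0, 0, ![0,0,0], 0, 0, 0, 0⟩
  | 2, 2, 2 => ⟨!![1,0,1;0,0,0;1,0,1], ![0,0,0], 0, 0, 0, ![0,0,0], 0, 0, 0, 0⟩
  | 2, 2, 3 => ⟨!![1,1,0;0,0,0;1,1,0], ![-2,0,-2], 0, 0, 0, ![0,0,0], 0, 0, 0, 0⟩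
  | 2, 2, 6 => ⟨!![1,0,0;0,0,0;1,0,0], ![0,0,0], 0, 0, 0, ![0,0,0], 0, 0, 0, 0⟩
  | 3, 3, 1 => ⟨!![1,1,2;1,1,2;0,0,0], ![0,0,0], 0, 0, 0, ![4,4,8], 0, 0, 0, 0⟩
  | 3, 3, 2 => ⟨!![1,0,1;1,0,1;0,0,0], ![0,0,0], 0, 0, 0, ![4,0,4], 0, 0, 0, 0⟩
  | 3, 3, 3 => ⟨!![1,1,0;1,1,0;0,0,0], ![-2,-2,0], 0, 0, 0, ![4,4,0], 0, 0, -8, 0⟩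
  | 3, 3, 6 => ⟨!![1,0,0;1,0,0;0,0,0], ![0,0,0], 0, 0, 0, ![4,0,0], 0, 0, 0, 0⟩
  | 6, 6, 1 => ⟨!![1,1,2;0,0,0;0,0,0], ![0,0,0], 0, 0, 0, ![0,0,0], 0, 0, 0, 0⟩
  | 6, 6, 2 => ⟨!![1,0,1;0,0,0;0,0,0], ![0,0,0], 0, 0, 0, ![0,0,0], 0, 0, 0, 0⟩
  | 6, 6, 3 => ⟨!![1,1,0;0,0,0;0,0,0], ![-2,0,0], 0, 0, 0, ![0,0,0], 0, 0, 0, 0⟩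
  | 6, 6, 6 => ⟨!![1,0,0;0,0,0;0,0,0], ![0,0,0], 0, 0, 0, ![0,0,0], 0, 0, 0, 0⟩
  | 2, 1, 2 => ⟨!![1,0,1;0,1,1;1,1,2], ![0,0,0], 1, -2, 0, ![0,8,8], 2, 0, 48, -4⟩
  | 2, 1, 6 => ⟨!![1,0,0;0,1,0;1,1,0], ![0,-2,-2], 1, 0, 0, ![0,8,0], 2, 0, -16, 0⟩
  | 6, 3, 2 => ⟨!![1,0,1;0,1,1;0,0,0], ![0,0,0], 1, -2, 0, ![0,4,4], 4, 0, 96, -8⟩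
  | 6, 3, 6 => ⟨!![1,0,0;0,1,0;0,0,0], ![0,-2,0], 1, 0, 0, ![0,4,0], 4, 0, -8, 0⟩
  | 3, 1, 3 => ⟨!![1,1,0;1,1,0;0,0,2], ![-2,-2,2], 0, 0, 2, ![4,4,4], 0, 0, -4, 0⟩
  | 6, 1, 6 => ⟨!![1,0,0;0,1,0;0,0,1], ![0,0,0], 1, 0, 1, ![0,0,0], 0, 1, 0, 0⟩
  | _, _, _ => 0

/-- The image in `A_ℤ` of the transitive biset with a given stabilizer. -/
def relImage (A : SymThree → SymThree → Bool) : OrderA ℤ :=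
  image (BoolRel.domCard A) (BoolRel.kerCard A) (BoolRel.ranCard A)

theorem relImage_conj (a b : SymThree) (A : SymThree → SymThree → Bool) :
    relImage (BoolRel.conj a b A) = relImage A := by
  rw [relImage, BoolRel.domCard_conj, BoolRel.kerCard_conj, BoolRel.ranCard_conj, relImage]

/-! ### Numerical form of the product formula -/

/-- The sum over the enumeration of the group. -/
def sumSix (f : ℕ → ℕ) : ℕ := f 0 + f 1 + f 2 + f 3 + f 4 + f 5

/-- Whether a property holds for some element of the enumeration of the group. -/
def anySix (f : ℕ → Bool) : Bool := f 0 || f 1 || f 2 || f 3 || f 4 || f 5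

theorem sumSix_eq {F : SymThree → ℕ} {f : ℕ → ℕ} (h : ∀ i < 6, F (elem i) = f i) :
    ∑ g, F g = sumSix f := by
  rw [sum_eq, h 0 (by decide), h 1 (by decide), h 2 (by decide), h 3 (by decide), h 4 (by decide),
    h 5 (by decide), sumSix]

theorem decide_exists_eq {p : SymThree → Prop} [Decidable (∃ g, p g)] {f : ℕ → Bool}
    (h : ∀ i < 6, p (elem i) ↔ f i = true) : decide (∃ g, p g) = anySix f := by
  rw [Bool.eq_iff_iff, decide_eq_true_iff, exists_iff]
  have : (∃ i < 6, p (elem i)) ↔ ∃ i < 6, f i = true :=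
    exists_congr fun i => and_congr_right fun hi => h i hi
  rw [this]
  simp only [anySix, Bool.or_eq_true]
  constructor
  · rintro ⟨i, hi, h⟩
    interval_cases i <;> simp [h]
  · rintro (((((h | h) | h) | h) | h) | h)
    exacts [⟨0, by decide, h⟩, ⟨1, by decide, h⟩, ⟨2, by decide, h⟩, ⟨3, by decide, h⟩,
      ⟨4, by decide, h⟩, ⟨5, by decide, h⟩]

/-- The digit of a mask that belongs to a pair. -/
def digit (m i j : ℕ) : Bool := m.testBit (6 * i + j)

theorem ofMask_elem (L : ℕ) {i j : ℕ} (hi : i < 6) (hj : j < 6) :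
    ofMask L (elem i) (elem j) = digit L i j := by
  rw [ofMask, index_elem i hi, index_elem j hj, digit]

theorem conj_ofMask_elem (L : ℕ) {h i j : ℕ} (hh : h < 6) (hi : i < 6) (hj : j < 6) :
    BoolRel.conj 1 (elem h)⁻¹ (ofMask L) (elem i) (elem j) = digit L i (conjTable h j) := by
  rw [BoolRel.conj, inv_inv, ← elem_conjTable h hh j hj, inv_one, one_mul, mul_one,
    ofMask_elem L hi (conjTable_lt h hh j hj)]

/-- The size of a relation given by a mask. -/
def maskCard (L : ℕ) : ℕ := sumSix fun g => sumSix fun h => (digit L g h).toNat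

/-- The number of composable pairs of elements of a twisted mask and a mask. -/
def maskCompCard (L h M : ℕ) : ℕ :=
  sumSix fun m => (sumSix fun g => (digit L g (conjTable h m)).toNat) *
    sumSix fun k => (digit M m k).toNat

/-- The size of the domain of the composition of a twisted mask and a mask. -/
def maskDomCard (L h M : ℕ) : ℕ :=
  sumSix fun g => (anySix fun k => anySix fun m => digit L g (conjTable h m) && digit M m k).toNat

/-- The size of the kernel of the composition of a twisted mask and a mask. -/
def maskKerCard (L h M : ℕ) : ℕ :=
  sumSix fun g => (anySix fun m => digit L g (conjTable h m) && digit M m 0).toNat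

/-- The size of the range of the composition of a twisted mask and a mask. -/
def maskRanCard (L h M : ℕ) : ℕ :=
  sumSix fun k => (anySix fun g => anySix fun m => digit L g (conjTable h m) && digit M m k).toNat

/-- The three invariants of a relation in octal digits. -/
def code (L h M : ℕ) : ℕ := maskDomCard L h M + 8 * maskKerCard L h M + 64 * maskRanCard L h M

/-- The image of a transitive biset with given invariants. -/
def decode (c : ℕ) : OrderA ℤ := image (c % 8) (c / 8 % 8) (c / 64)

theorem card_ofMask (L : ℕ) : BoolRel.card (ofMask L) = maskCard L :=
  sumSix_eq fun _ hi => sumSix_eq fun _ hj => congrArg Bool.toNat (ofMask_elem L hi hj)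

section

variable (L M : ℕ) {h : ℕ}

theorem compCard_conj_ofMask (hh : h < 6) :
    BoolRel.compCard (BoolRel.conj 1 (elem h)⁻¹ (ofMask L)) (ofMask M) = maskCompCard L h M :=
  sumSix_eq fun _ hi => congrArg₂ (· * ·)
    (sumSix_eq fun _ hj => congrArg Bool.toNat (conj_ofMask_elem L hh hj hi))
    (sumSix_eq fun _ hj => congrArg Bool.toNat (ofMask_elem M hi hj))

theorem comp_conj_ofMask_elem (hh : h < 6) {i k : ℕ} (hi : i < 6) (hk : k < 6) :
    BoolRel.comp (BoolRel.conj 1 (elem h)⁻¹ (ofMask L)) (ofMask M) (elem i) (elem k) =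
      anySix fun m => digit L i (conjTable h m) && digit M m k :=
  decide_exists_eq fun m hm => by
    rw [Bool.and_eq_true, conj_ofMask_elem L hh hi hm, ofMask_elem M hm hk]

theorem relImage_comp_conj_ofMask (hh : h < 6) :
    relImage (BoolRel.comp (BoolRel.conj 1 (elem h)⁻¹ (ofMask L)) (ofMask M)) =
      decode (code L h M) := by
  have le : ∀ f, (∀ i, f i ≤ 1) → sumSix f < 8 := fun f hf => by
    have := hf 0; have := hf 1; have := hf 2; have := hf 3; have := hf 4; have := hf 5
    unfold sumSix
    omega
  have h1 : BoolRel.domCard (BoolRel.comp (BoolRel.conj 1 (elem h)⁻¹ (ofMask L)) (ofMask M)) =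
      maskDomCard L h M := sumSix_eq fun i hi => congrArg Bool.toNat <|
    decide_exists_eq fun k hk => by rw [comp_conj_ofMask_elem L M hh hi hk]
  have h2 : BoolRel.kerCard (BoolRel.comp (BoolRel.conj 1 (elem h)⁻¹ (ofMask L)) (ofMask M)) =
      maskKerCard L h M := sumSix_eq fun i hi => congrArg Bool.toNat <| by
    rw [← comp_conj_ofMask_elem L M hh hi (by decide : 0 < 6)]
    rfl
  have h3 : BoolRel.ranCard (BoolRel.comp (BoolRel.conj 1 (elem h)⁻¹ (ofMask L)) (ofMask M)) =
      maskRanCard L h M := sumSix_eq fun k hk => congrArg Bool.toNat <|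
    decide_exists_eq fun i hi => by rw [comp_conj_ofMask_elem L M hh hi hk]
  have l1 : maskDomCard L h M < 8 := le _ fun i => Bool.toNat_le _
  have l2 : maskKerCard L h M < 8 := le _ fun i => Bool.toNat_le _
  rw [relImage, h1, h2, h3, decode, code]
  congr 1 <;> omega

end

/-- The mask of the diagonal. -/
def diagonalMask : ℕ := 34630287489

theorem ofMask_diagonalMask : ∀ g h, ofMask diagonalMask g h = decide (g = h) := by decide +kernel

theorem relImage_ofMask (L : ℕ) : relImage (ofMask L) = decode (code L 0 diagonalMask) := by
  rw [← relImage_comp_conj_ofMask L diagonalMask (by decide : 0 < 6)]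
  congr 1
  funext g k
  rw [Bool.eq_iff_iff, BoolRel.comp_iff]
  simp [ofMask_diagonalMask, BoolRel.conj, show elem 0 = 1 by decide]

/-- Evaluate the constructor of `a`, then apply `k`. -/
def forceOrder {α : Type} (a : OrderA ℤ) (k : OrderA ℤ → α) : α :=
  match a with
  | ⟨s, t, u, v, w, x, y, z1, z2, z3⟩ => k ⟨s, t, u, v, w, x, y, z1, z2, z3⟩

@[simp] theorem forceOrder_eq {α : Type} (a : OrderA ℤ) (k : OrderA ℤ → α) : forceOrder a k = k a :=
  rfl

/-- Whether a property holds for the three indices of a matrix. -/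
def allThree (f : Fin 3 → Bool) : Bool := f 0 && f 1 && f 2

theorem allThree_iff {f : Fin 3 → Bool} : allThree f = true ↔ ∀ i, f i = true := by
  simp [allThree, Fin.forall_fin_succ, and_assoc]

/-- Whether `n₀ a₀ + ⋯ + n₅ a₅ = n a b`. -/
def isSumEqMul (n0 n1 n2 n3 n4 n5 n : ℕ) (a0 a1 a2 a3 a4 a5 a b : OrderA ℤ) : Bool :=
  (allThree fun i => allThree fun j =>
    n0 * a0.s i j + n1 * a1.s i j + n2 * a2.s i j + n3 * a3.s i j + n4 * a4.s i j + n5 * a5.s i j ==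
      n * (a.s i 0 * b.s 0 j + a.s i 1 * b.s 1 j + a.s i 2 * b.s 2 j)) &&
  (allThree fun i =>
    n0 * a0.t i + n1 * a1.t i + n2 * a2.t i + n3 * a3.t i + n4 * a4.t i + n5 * a5.t i ==
      n * (a.s i 0 * b.t 0 + a.s i 1 * b.t 1 + a.s i 2 * b.t 2 + b.z1 * a.t i)) &&
  (n0 * a0.u + n1 * a1.u + n2 * a2.u + n3 * a3.u + n4 * a4.u + n5 * a5.u == n * (a.u * b.u)) &&
  (n0 * a0.v + n1 * a1.v + n2 * a2.v + n3 * a3.v + n4 * a4.v + n5 * a5.v == n * (a.u * b.v + a.v * b.z1)) &&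
  (n0 * a0.w + n1 * a1.w + n2 * a2.w + n3 * a3.w + n4 * a4.w + n5 * a5.w == n * (a.w * b.w)) &&
  (allThree fun i =>
    n0 * a0.x i + n1 * a1.x i + n2 * a2.x i + n3 * a3.x i + n4 * a4.x i + n5 * a5.x i ==
      n * (a.x 0 * b.s 0 i + a.x 1 * b.s 1 i + a.x 2 * b.s 2 i + a.z1 * b.x i)) &&
  (n0 * a0.y + n1 * a1.y + n2 * a2.y + n3 * a3.y + n4 * a4.y + n5 * a5.y ==
    n * (a.y * b.u + a.z1 * b.y)) &&
  (n0 * a0.z1 + n1 * a1.z1 + n2 * a2.z1 + n3 * a3.z1 + n4 * a4.z1 + n5 * a5.z1 ==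
    n * (a.z1 * b.z1)) &&
  (n0 * a0.z2 + n1 * a1.z2 + n2 * a2.z2 + n3 * a3.z2 + n4 * a4.z2 + n5 * a5.z2 ==
    n * (a.z1 * b.z2 + a.z2 * b.z1 + (a.x 0 * b.t 0 + a.x 1 * b.t 1 + a.x 2 * b.t 2) -
      12 * (a.y * b.v))) &&
  (n0 * a0.z3 + n1 * a1.z3 + n2 * a2.z3 + n3 * a3.z3 + n4 * a4.z3 + n5 * a5.z3 ==
    n * (a.z1 * b.z3 + a.z3 * b.z1 + a.y * b.v))

theorem nsmul_eq_smul {R : Type*} [CommRing R] (n : ℕ) (a : OrderA R) : n • a = (n : R) • a :=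
  (Nat.cast_smul_eq_nsmul R n a).symm

theorem sum_eq_mul_of_isSumEqMul {n0 n1 n2 n3 n4 n5 n : ℕ} {a0 a1 a2 a3 a4 a5 a b : OrderA ℤ} :
    isSumEqMul n0 n1 n2 n3 n4 n5 n a0 a1 a2 a3 a4 a5 a b = true →
      n0 • a0 + n1 • a1 + n2 • a2 + n3 • a3 + n4 • a4 + n5 • a5 = n • (a * b) := by
  simp only [isSumEqMul, Bool.and_eq_true, allThree_iff, beq_iff_eq, and_imp]
  intro hs ht hu hv hw hx hy h1 h2 h3
  simp only [nsmul_eq_smul]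
  ext i j
  · simp only [OrderA.add_s, OrderA.smul_s, OrderA.mul_s, Matrix.add_apply, Matrix.smul_apply,
      smul_eq_mul, Matrix.mul_apply, Fin.sum_univ_three]
    exact hs i j
  · simpa [Matrix.mulVec, dotProduct, Fin.sum_univ_three] using ht i
  · exact hu
  · exact hv
  · exact hw
  · simpa [Matrix.vecMul, dotProduct, Fin.sum_univ_three] using hx i
  · exact hy
  · exact h1
  · simpa [dotProduct, Fin.sum_univ_three] using h2
  · exact h3

/-- The product formula for two subgroups given by masks. -/
def productFormula (L M : ℕ) : Bool :=
  force (maskCompCard L 0 M) fun n0 => force (maskCompCard L 1 M) fun n1 =>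
  force (maskCompCard L 2 M) fun n2 => force (maskCompCard L 3 M) fun n3 =>
  force (maskCompCard L 4 M) fun n4 => force (maskCompCard L 5 M) fun n5 =>
  force (code L 0 M) fun c0 => force (code L 1 M) fun c1 => force (code L 2 M) fun c2 =>
  force (code L 3 M) fun c3 => force (code L 4 M) fun c4 => force (code L 5 M) fun c5 =>
  force (code L 0 diagonalMask) fun c => force (code M 0 diagonalMask) fun d =>
  force (maskCard L * maskCard M) fun n =>
  forceOrder (decode c0) fun a0 => forceOrder (decode c1) fun a1 =>
  forceOrder (decode c2) fun a2 => forceOrder (decode c3) fun a3 =>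
  forceOrder (decode c4) fun a4 => forceOrder (decode c5) fun a5 =>
  forceOrder (decode c) fun a => forceOrder (decode d) fun b =>
    isSumEqMul n0 n1 n2 n3 n4 n5 n a0 a1 a2 a3 a4 a5 a b

set_option maxRecDepth 100000 in
theorem productFormula_eq_true : ∀ L ∈ masks, ∀ M ∈ masks, productFormula L M = true := by
  decide +kernel

theorem sum_compCard_smul_ofMask {L M : ℕ} (hL : L ∈ masks) (hM : M ∈ masks) :
    ∑ h : SymThree, BoolRel.compCard (BoolRel.conj 1 h⁻¹ (ofMask L)) (ofMask M) •
        relImage (BoolRel.comp (BoolRel.conj 1 h⁻¹ (ofMask L)) (ofMask M)) =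
      (BoolRel.card (ofMask L) * BoolRel.card (ofMask M)) •
        (relImage (ofMask L) * relImage (ofMask M)) := by
  have h := productFormula_eq_true L hL M hM
  simp only [productFormula, force_eq, forceOrder_eq] at h
  rw [sum_eq]
  rw [compCard_conj_ofMask L M (by decide : 0 < 6), compCard_conj_ofMask L M (by decide : 1 < 6),
    compCard_conj_ofMask L M (by decide : 2 < 6), compCard_conj_ofMask L M (by decide : 3 < 6),
    compCard_conj_ofMask L M (by decide : 4 < 6), compCard_conj_ofMask L M (by decide : 5 < 6),
    relImage_comp_conj_ofMask L M (by decide : 0 < 6),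
    relImage_comp_conj_ofMask L M (by decide : 1 < 6),
    relImage_comp_conj_ofMask L M (by decide : 2 < 6),
    relImage_comp_conj_ofMask L M (by decide : 3 < 6),
    relImage_comp_conj_ofMask L M (by decide : 4 < 6),
    relImage_comp_conj_ofMask L M (by decide : 5 < 6), card_ofMask, card_ofMask, relImage_ofMask,
    relImage_ofMask]
  exact sum_eq_mul_of_isSumEqMul h

/-- The product formula for two subgroups. -/
theorem sum_compCard_smul (A B : SymThree → SymThree → Bool)
    (hA : ∃ g h, ∃ L ∈ masks, BoolRel.conj g h A = ofMask L)
    (hB : ∃ g h, ∃ L ∈ masks, BoolRel.conj g h B = ofMask L) :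
    ∑ h : SymThree, BoolRel.compCard (BoolRel.conj 1 h⁻¹ A) B •
        relImage (BoolRel.comp (BoolRel.conj 1 h⁻¹ A) B) =
      (BoolRel.card A * BoolRel.card B) • (relImage A * relImage B) := by
  obtain ⟨a, b, L, hL, hAL⟩ := hA
  obtain ⟨c, d, M, hM, hBM⟩ := hB
  have h := sum_compCard_smul_ofMask hL hM
  rw [← hAL, ← hBM, BoolRel.card_conj, BoolRel.card_conj, relImage_conj, relImage_conj] at h
  rw [← h, ← Equiv.sum_comp ((Equiv.mulLeft b⁻¹).trans (Equiv.mulRight c))]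
  refine Finset.sum_congr rfl fun h _ => ?_
  have : BoolRel.conj 1 h⁻¹ (BoolRel.conj a b A) =
      BoolRel.conj a c (BoolRel.conj 1 (b⁻¹ * h * c)⁻¹ A) := by
    rw [BoolRel.conj_conj, BoolRel.conj_conj]
    congr 1
    group
  rw [this, BoolRel.compCard_conj, BoolRel.comp_conj, relImage_conj]
  rfl

end SymThree

namespace SymThree

/-! ### The representation of the double Burnside ring over the integers -/

theorem exists_conj_stabRel {X : Type*} [MulAction SymThree X] [MulAction SymThreeᵐᵒᵖ X]
    [SMulCommClass SymThree SymThreeᵐᵒᵖ X] (x : X) :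
    ∃ g h : SymThree, ∃ L ∈ masks, BoolRel.conj g h (stabRel x) = ofMask L :=
  exists_conj_eq_ofMask (stabSubgroup x) _ fun _ _ => Iff.rfl

/-- The sum of the images of the orbits of a biset, times `36`. -/
noncomputable def scaledImage : BisetClass SymThree → OrderA ℤ :=
  BisetClass.pointSum fun A => BoolRel.card A • relImage A

theorem sum_smul_scaledImage_mul (X Y : Type*) [Fintype X] [MulAction SymThree X]
    [MulAction SymThreeᵐᵒᵖ X] [SMulCommClass SymThree SymThreeᵐᵒᵖ X] [Fintype Y]
    [MulAction SymThree Y] [MulAction SymThreeᵐᵒᵖ Y] [SMulCommClass SymThree SymThreeᵐᵒᵖ Y] :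
    36 • scaledImage (BisetClass.mk SymThree X * BisetClass.mk SymThree Y) =
      scaledImage (BisetClass.mk SymThree X) * scaledImage (BisetClass.mk SymThree Y) := by
  have h1 := BisetClass.pointSum_mul (G := SymThree) relImage X Y
  rw [show Fintype.card SymThree = 6 by decide] at h1
  have h2 : ∀ h : SymThree,
      ∑ x : X, ∑ y : Y, BoolRel.compCard (BoolRel.conj 1 h⁻¹ (stabRel x)) (stabRel y) •
        relImage (BoolRel.comp (BoolRel.conj 1 h⁻¹ (stabRel x)) (stabRel y)) =
      ∑ x : X, ∑ y : Y, BoolRel.compCard (stabRel (G := SymThree) x) (stabRel y) •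
        relImage (BoolRel.comp (stabRel x) (stabRel y)) := fun h => by
    conv_rhs => rw [← Equiv.sum_comp (MulAction.toPerm (op h))]
    refine Finset.sum_congr rfl fun x _ => ?_
    rw [← stabRel_smul, one_smul]
    rfl
  have h3 := Finset.sum_congr rfl fun (h : SymThree) (_ : h ∈ Finset.univ) => h2 h
  rw [Finset.sum_const, Finset.card_univ, show Fintype.card SymThree = 6 by decide, ← h1, smul_smul,
    Finset.sum_comm] at h3
  rw [scaledImage, ← show 6 * 6 = 36 by rfl, ← h3, BisetClass.pointSum_mk, BisetClass.pointSum_mk,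
    Finset.sum_mul_sum]
  refine Finset.sum_congr rfl fun x _ => ?_
  rw [Finset.sum_comm]
  refine Finset.sum_congr rfl fun y _ => ?_
  rw [sum_compCard_smul _ _ (exists_conj_stabRel x) (exists_conj_stabRel y), smul_mul_smul_comm]

theorem scaledImage_mul (a b : BisetClass SymThree) :
    36 • scaledImage (a * b) = scaledImage a * scaledImage b := by
  induction a using BisetClass.ind with | _ M
  induction b using BisetClass.ind with | _ N
  exact sum_smul_scaledImage_mul _ _

theorem relImage_diagonalMask : relImage (ofMask diagonalMask) = 1 := by
  rw [relImage_ofMask, show code diagonalMask 0 diagonalMask = 6 + 8 * 1 + 64 * 6 by decide +kernel]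
  ext i j
  · fin_cases i <;> fin_cases j <;> rfl
  all_goals first | rfl | (fin_cases i <;> rfl)

theorem scaledImage_one : scaledImage 1 = 36 • 1 := by
  change scaledImage (BisetClass.mk SymThree SymThree) = _
  rw [scaledImage, BisetClass.pointSum_mk]
  have h : ∀ x : SymThree, stabRel x = BoolRel.conj x 1 (ofMask diagonalMask) := fun x => by
    funext g k
    rw [Bool.eq_iff_iff, stabRel_iff, BoolRel.conj, ofMask_diagonalMask, decide_eq_true_iff,
      smul_eq_mul, op_smul_eq_mul, mul_assoc, inv_mul_eq_iff_eq_mul]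
    simp
  simp only [h, BoolRel.card_conj, relImage_conj, relImage_diagonalMask, card_ofMask]
  rw [show maskCard diagonalMask = 6 by decide +kernel, Finset.sum_const, smul_smul]
  rfl

/-- Every finite biset for `S₃` is a disjoint union of transitive bisets with a stabilizer from the
list. -/
theorem induction_masks {p : BisetClass SymThree → Prop}
    (empty : ∀ (X : Type) [Finite X] [MulAction SymThree X] [MulAction SymThreeᵐᵒᵖ X]
      [SMulCommClass SymThree SymThreeᵐᵒᵖ X] [IsEmpty X], p (BisetClass.mk SymThree X))
    (coset : ∀ L hL, p (BisetClass.mk SymThree (CosetBiset (maskSubgroup L hL))))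
    (sum : ∀ (X Y : Type) [Finite X] [MulAction SymThree X] [MulAction SymThreeᵐᵒᵖ X]
      [SMulCommClass SymThree SymThreeᵐᵒᵖ X] [Finite Y] [MulAction SymThree Y]
      [MulAction SymThreeᵐᵒᵖ Y] [SMulCommClass SymThree SymThreeᵐᵒᵖ Y],
      p (BisetClass.mk SymThree X) → p (BisetClass.mk SymThree Y) →
        p (BisetClass.mk SymThree (X ⊕ Y)))
    (c : BisetClass SymThree) : p c := by
  induction c using BisetClass.ind with | _ M
  refine BisetClass.induction_transitive empty (fun H => ?_) sum _
  obtain ⟨g, h, L, hL, hgh⟩ := exists_conj_stabRel (CosetBiset.mk H 1 1)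
  have hx : ∀ a b, stabRel (g • op h⁻¹ • CosetBiset.mk H 1 1) a b = true ↔
      (a, b) ∈ maskSubgroup L hL := fun a b => by
    rw [stabRel_smul, inv_inv, hgh]
    rfl
  rw [← BisetClass.mk_eq_mk_iff.2 ⟨CosetBiset.isoOfTransitive _ _ hx fun y => ?_⟩]
  · exact coset L hL
  · obtain ⟨a, b, rfl⟩ := CosetBiset.exists_smul_mk_one H y
    refine ⟨a * g⁻¹, b * h⁻¹, ?_⟩
    rw [← smul_comm g (op (b * h⁻¹)⁻¹) (op h⁻¹ • CosetBiset.mk H 1 1), smul_smul (a * g⁻¹),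
      smul_smul (op (b * h⁻¹)⁻¹), ← MulOpposite.op_mul]
    congr 3 <;> group

theorem card_eq_natCard (H : Subgroup (SymThree × SymThree)) (A : SymThree → SymThree → Bool)
    (hA : ∀ g h, A g h = true ↔ (g, h) ∈ H) : BoolRel.card A = Nat.card H := by
  classical
  rw [BoolRel.card, ← Fintype.sum_prod_type' fun g h => (A g h).toNat, Nat.card_eq_fintype_card,
    Fintype.card_subtype, Finset.card_filter]
  refine Finset.sum_congr rfl fun q _ => ?_
  rw [Bool.toNat, Bool.cond_eq_ite]
  exact if_congr (hA _ _) rfl rfl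

theorem scaledImage_coset (L : ℕ) (hL : L ∈ masks) :
    scaledImage (BisetClass.mk SymThree (CosetBiset (maskSubgroup L hL))) =
      36 • relImage (ofMask L) := by
  have := Fintype.ofFinite (CosetBiset (maskSubgroup L hL))
  rw [scaledImage, BisetClass.pointSum_mk]
  have h : ∀ x : CosetBiset (maskSubgroup L hL), ∃ a b, stabRel x = BoolRel.conj a b (ofMask L) := by
    intro x
    obtain ⟨a, b, rfl⟩ := CosetBiset.exists_smul_mk_one _ x
    refine ⟨a, b, ?_⟩
    rw [stabRel_smul, inv_inv]
    congr 1
    funext g h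
    rw [Bool.eq_iff_iff, CosetBiset.stabRel_mk_one]
    rfl
  have h' : ∀ x : CosetBiset (maskSubgroup L hL), BoolRel.card (stabRel (G := SymThree) x) •
      relImage (stabRel x) = BoolRel.card (ofMask L) • relImage (ofMask L) := fun x => by
    obtain ⟨a, b, hx⟩ := h x
    rw [hx, BoolRel.card_conj, relImage_conj]
  simp only [h']
  rw [Finset.sum_const, smul_smul, card_eq_natCard (maskSubgroup L hL) _ fun _ _ => Iff.rfl,
    Finset.card_univ, ← Nat.card_eq_fintype_card]
  have := Subgroup.card_eq_card_quotient_mul_card_subgroup (maskSubgroup L hL)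
  rw [Nat.card_eq_fintype_card, show Fintype.card (SymThree × SymThree) = 36 by decide] at this
  rw [this]
  rfl

theorem nsmul_injective {R : Type*} [CommRing R] [IsDomain R] {n : ℕ} (hn : (n : R) ≠ 0) :
    Function.Injective fun a : OrderA R => n • a := by
  intro a b h
  simp only [nsmul_eq_smul] at h
  ext i j
  · exact mul_left_cancel₀ hn (congrFun (congrFun (congrArg OrderA.s h) i) j)
  · exact mul_left_cancel₀ hn (congrFun (congrArg OrderA.t h) i)
  · exact mul_left_cancel₀ hn (congrArg OrderA.u h)
  · exact mul_left_cancel₀ hn (congrArg OrderA.v h)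
  · exact mul_left_cancel₀ hn (congrArg OrderA.w h)
  · exact mul_left_cancel₀ hn (congrFun (congrArg OrderA.x h) i)
  · exact mul_left_cancel₀ hn (congrArg OrderA.y h)
  · exact mul_left_cancel₀ hn (congrArg OrderA.z1 h)
  · exact mul_left_cancel₀ hn (congrArg OrderA.z2 h)
  · exact mul_left_cancel₀ hn (congrArg OrderA.z3 h)

theorem smul_left_injective : Function.Injective fun a : OrderA ℤ => 36 • a :=
  nsmul_injective (by decide)

theorem exists_smul_eq_scaledImage (c : BisetClass SymThree) : ∃ a, 36 • a = scaledImage c := by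
  induction c using induction_masks with
  | empty X =>
    have := Fintype.ofFinite X
    exact ⟨0, by rw [scaledImage, BisetClass.pointSum_mk, Fintype.sum_empty, smul_zero]⟩
  | coset L hL => exact ⟨_, (scaledImage_coset L hL).symm⟩
  | sum X Y hX hY =>
    obtain ⟨a, ha⟩ := hX
    obtain ⟨b, hb⟩ := hY
    exact ⟨a + b, by rw [scaledImage, BisetClass.pointSum_sum, smul_add, ha, hb]; rfl⟩

/-- The image of a biset in `A_ℤ`: the sum of the images of its orbits. -/
noncomputable def bisetImage : BisetClass SymThree →* OrderA ℤ where
  toFun c := (exists_smul_eq_scaledImage c).choose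
  map_one' := smul_left_injective <| by
    change 36 • _ = 36 • _
    rw [(exists_smul_eq_scaledImage 1).choose_spec, scaledImage_one]
  map_mul' a b := smul_left_injective <| smul_left_injective <| by
    change 36 • 36 • _ = 36 • 36 • _
    rw [(exists_smul_eq_scaledImage (a * b)).choose_spec, scaledImage_mul, ← mul_smul_comm,
      ← smul_mul_assoc, (exists_smul_eq_scaledImage a).choose_spec,
      (exists_smul_eq_scaledImage b).choose_spec]

theorem smul_bisetImage (c : BisetClass SymThree) : 36 • bisetImage c = scaledImage c :=
  (exists_smul_eq_scaledImage c).choose_spec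

theorem bisetImage_coset (L : ℕ) (hL : L ∈ masks) :
    bisetImage (BisetClass.mk SymThree (CosetBiset (maskSubgroup L hL))) = relImage (ofMask L) :=
  smul_left_injective <| by
    change 36 • _ = 36 • _
    rw [smul_bisetImage, scaledImage_coset]

theorem bisetImage_sum (X Y : Type*) [Finite X] [MulAction SymThree X] [MulAction SymThreeᵐᵒᵖ X]
    [SMulCommClass SymThree SymThreeᵐᵒᵖ X] [Finite Y] [MulAction SymThree Y]
    [MulAction SymThreeᵐᵒᵖ Y] [SMulCommClass SymThree SymThreeᵐᵒᵖ Y] :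
    bisetImage (BisetClass.mk SymThree (X ⊕ Y)) =
      bisetImage (BisetClass.mk SymThree X) + bisetImage (BisetClass.mk SymThree Y) :=
  smul_left_injective <| by
    change 36 • _ = 36 • _
    rw [smul_add, smul_bisetImage, smul_bisetImage, smul_bisetImage, scaledImage,
      BisetClass.pointSum_sum]

end SymThree

namespace OrderA

/-- The ring homomorphism between the orders that is induced by a homomorphism of the coefficients. -/
def mapRingHom {R S : Type*} [CommRing R] [CommRing S] (f : R →+* S) : OrderA R →+* OrderA S where
  toFun a := ⟨a.s.map f, f ∘ a.t, f a.u, f a.v, f a.w, f ∘ a.x, f a.y, f a.z1, f a.z2, f a.z3⟩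
  map_zero' := by ext <;> simp
  map_one' := by
    ext i j
    · simp [Matrix.one_apply, apply_ite f]
    all_goals simp
  map_add' a b := by ext <;> simp
  map_mul' a b := by
    ext <;> simp [Matrix.mul_apply, Matrix.mulVec, Matrix.vecMul, dotProduct, map_ofNat f]

variable (R : Type*) [CommRing R]

/-- The parametrization of `Λ` by `R ^ 22`. -/
def ofParams : (Fin 22 → R) →ₗ[R] OrderA R where
  toFun q :=
    { s := !![q 0, q 1, q 2; q 3, q 4, q 5; q 6, q 7, q 8]
      t := ![2 * q 9, 2 * q 10, 2 * q 11]
      u := q 12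
      v := 2 * q 13
      w := q 18 + 2 * q 19 + 2 * q 20 + 4 * q 21
      x := ![4 * q 14, 4 * q 15, 4 * q 16]
      y := 2 * q 17
      z1 := q 18
      z2 := 4 * q 19 + 4 * q 20
      z3 := 4 * q 19 }
  map_add' p q := by
    ext i j
    · fin_cases i <;> fin_cases j <;> rfl
    · fin_cases i <;> simp [mul_add]
    rotate_left 3
    · fin_cases i <;> simp [mul_add]
    all_goals simp <;> ring
  map_smul' r q := by
    ext i j
    · fin_cases i <;> fin_cases j <;> rfl
    · fin_cases i <;> simp [mul_left_comm]
    rotate_left 3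
    · fin_cases i <;> simp [mul_left_comm]
    all_goals simp <;> ring

theorem ofParams_mem (q : Fin 22 → R) : ofParams R q ∈ Lambda R := by
  refine ⟨⟨q 21, ?_⟩, ⟨q 20, ?_⟩, ⟨q 19, rfl⟩, fun i => ?_, ⟨q 17, rfl⟩, fun i => ?_, ⟨q 13, rfl⟩⟩
  · simp only [ofParams, LinearMap.coe_mk, AddHom.coe_mk]
    ring
  · simp only [ofParams, LinearMap.coe_mk, AddHom.coe_mk]
    ring
  · fin_cases i <;> exact dvd_mul_right _ _
  · fin_cases i <;> exact dvd_mul_right _ _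

variable {R}

theorem exists_ofParams_eq [IsDomain R] (h2 : (2 : R) ≠ 0) {a : OrderA R} (ha : a ∈ Lambda R) :
    ∃ q, ofParams R q = a := by
  obtain ⟨⟨k, hk⟩, ⟨d, hd⟩, ⟨c, hc⟩, hx, ⟨y, hy⟩, ht, ⟨v, hv⟩⟩ := ha
  choose x hx using hx
  choose t ht using ht
  have hw : a.w = a.z1 + 2 * c + 2 * d + 4 * k :=
    mul_left_cancel₀ h2 (by linear_combination hk + hd + hc)
  refine ⟨![a.s 0 0, a.s 0 1, a.s 0 2, a.s 1 0, a.s 1 1, a.s 1 2, a.s 2 0, a.s 2 1, a.s 2 2,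
    t 0, t 1, t 2, a.u, v, x 0, x 1, x 2, y, a.z1, c, d, k], ?_⟩
  ext i j
  · fin_cases i <;> fin_cases j <;> rfl
  · fin_cases i <;> exact (ht _).symm
  · rfl
  · exact hv.symm
  · exact hw.symm
  · fin_cases i <;> exact (hx _).symm
  · exact hy.symm
  · rfl
  · change 4 * c + 4 * d = a.z2
    linear_combination -hd - hc
  · exact hc.symm

theorem ofParams_injective [IsDomain R] (h2 : (2 : R) ≠ 0) : Function.Injective (ofParams R) := by
  have h4 : (4 : R) ≠ 0 := by
    rw [show (4 : R) = 2 * 2 by norm_num]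
    exact mul_ne_zero h2 h2
  intro p q h
  have hs : ∀ i j, (ofParams R p).s i j = (ofParams R q).s i j := fun i j => by rw [h]
  have ht : ∀ i, (ofParams R p).t i = (ofParams R q).t i := fun i => by rw [h]
  have hx : ∀ i, (ofParams R p).x i = (ofParams R q).x i := fun i => by rw [h]
  have h18 : p 18 = q 18 := congrArg OrderA.z1 h
  have h19 : p 19 = q 19 := mul_left_cancel₀ h4 (congrArg OrderA.z3 h)
  have h20 : p 20 = q 20 := mul_left_cancel₀ h4 <| by
    have : 4 * p 19 + 4 * p 20 = 4 * q 19 + 4 * q 20 := congrArg OrderA.z2 h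
    linear_combination this - 4 * h19
  have h21 : p 21 = q 21 := mul_left_cancel₀ h4 <| by
    have : p 18 + 2 * p 19 + 2 * p 20 + 4 * p 21 = q 18 + 2 * q 19 + 2 * q 20 + 4 * q 21 :=
      congrArg OrderA.w h
    linear_combination this - h18 - 2 * h19 - 2 * h20
  funext i
  fin_cases i
  exacts [hs 0 0, hs 0 1, hs 0 2, hs 1 0, hs 1 1, hs 1 2, hs 2 0, hs 2 1, hs 2 2,
    mul_left_cancel₀ h2 (ht 0), mul_left_cancel₀ h2 (ht 1), mul_left_cancel₀ h2 (ht 2),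
    congrArg OrderA.u h, mul_left_cancel₀ h2 (congrArg OrderA.v h),
    mul_left_cancel₀ h4 (hx 0), mul_left_cancel₀ h4 (hx 1), mul_left_cancel₀ h4 (hx 2),
    mul_left_cancel₀ h2 (congrArg OrderA.y h), h18, h19, h20, h21]

theorem mapRingHom_ofParams {S : Type*} [CommRing S] (f : R →+* S) (q : Fin 22 → R) :
    mapRingHom f (ofParams R q) = ofParams S (f ∘ q) := by
  ext i j
  · fin_cases i <;> fin_cases j <;> rfl
  · fin_cases i <;> simp [mapRingHom, ofParams, map_ofNat f]
  rotate_left 3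
  · fin_cases i <;> simp [mapRingHom, ofParams, map_ofNat f]
  all_goals simp [mapRingHom, ofParams, map_ofNat f]

end OrderA

namespace SymThree

/-- The parameters of the images of the transitive bisets. -/
def imageParams : Matrix (Fin 22) (Fin 22) ℤ :=
  ![![1, 1, 2, 1, 1, 2, 2, 2, 4, 0, 0, 0, 0, 0, 2, 2, 4, 0, 0, 0, 0, 0],
    ![1, 0, 1, 1, 0, 1, 2, 0, 2, 0, 0, 0, 0, 0, 2, 0, 2, 0, 0, 0, 0, 0],
    ![1, 1, 0, 1, 1, 0, 2, 2, 0, -1, -1, -2, 0, 0, 2, 2, 0, 0, 0, 0, -4, 2],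
    ![1, 0, 0, 1, 0, 0, 2, 0, 0, 0, 0, 0, 0, 0, 2, 0, 0, 0, 0, 0, 0, 0],
    ![1, 1, 2, 0, 0, 0, 1, 1, 2, 0, 0, 0, 0, 0, 0, 0, 0, 0, 0, 0, 0, 0],
    ![1, 0, 1, 0, 0, 0, 1, 0, 1, 0, 0, 0, 0, 0, 0, 0, 0, 0, 0, 0, 0, 0],
    ![1, 1, 0, 0, 0, 0, 1, 1, 0, -1, 0, -1, 0, 0, 0, 0, 0, 0, 0, 0, 0, 0],
    ![1, 0, 0, 0, 0, 0, 1, 0, 0, 0, 0, 0, 0, 0, 0, 0, 0, 0, 0, 0, 0, 0],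
    ![1, 1, 2, 1, 1, 2, 0, 0, 0, 0, 0, 0, 0, 0, 1, 1, 2, 0, 0, 0, 0, 0],
    ![1, 0, 1, 1, 0, 1, 0, 0, 0, 0, 0, 0, 0, 0, 1, 0, 1, 0, 0, 0, 0, 0],
    ![1, 1, 0, 1, 1, 0, 0, 0, 0, -1, -1, 0, 0, 0, 1, 1, 0, 0, 0, 0, -2, 1],
    ![1, 0, 0, 1, 0, 0, 0, 0, 0, 0, 0, 0, 0, 0, 1, 0, 0, 0, 0, 0, 0, 0],
    ![1, 1, 2, 0, 0, 0, 0, 0, 0, 0, 0, 0, 0, 0, 0, 0, 0, 0, 0, 0, 0, 0],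
    ![1, 0, 1, 0, 0, 0, 0, 0, 0, 0, 0, 0, 0, 0, 0, 0, 0, 0, 0, 0, 0, 0],
    ![1, 1, 0, 0, 0, 0, 0, 0, 0, -1, 0, 0, 0, 0, 0, 0, 0, 0, 0, 0, 0, 0],
    ![1, 0, 0, 0, 0, 0, 0, 0, 0, 0, 0, 0, 0, 0, 0, 0, 0, 0, 0, 0, 0, 0],
    ![1, 0, 1, 0, 1, 1, 1, 1, 2, 0, 0, 0, 1, -1, 0, 2, 2, 1, 0, -1, 13, -6],
    ![1, 0, 0, 0, 1, 0, 1, 1, 0, 0, -1, -1, 1, 0, 0, 2, 0, 1, 0, 0, -4, 2],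
    ![1, 0, 1, 0, 1, 1, 0, 0, 0, 0, 0, 0, 1, -1, 0, 1, 1, 2, 0, -2, 26, -12],
    ![1, 0, 0, 0, 1, 0, 0, 0, 0, 0, -1, 0, 1, 0, 0, 1, 0, 2, 0, 0, -2, 1],
    ![1, 1, 0, 1, 1, 0, 0, 0, 2, -1, -1, 1, 0, 0, 1, 1, 1, 0, 0, 0, -1, 1],
    ![1, 0, 0, 0, 1, 0, 0, 0, 1, 0, 0, 0, 1, 0, 0, 0, 0, 0, 1, 0, 0, 0]]

/-- The inverse of the matrix `imageParams`. -/
def imageParamsInv : Matrix (Fin 22) (Fin 22) ℤ :=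
  ![![0, 0, 0, 0, 0, 0, 0, 0, 0, 0, 0, 0, 0, 0, 0, 1, 0, 0, 0, 0, 0, 0],
    ![0, 0, 0, 0, 0, 0, 0, 0, 0, 0, 0, 0, 1, -2, 0, 1, 0, 0, 0, 0, 0, 0],
    ![0, 0, 0, 0, 0, 0, 0, 0, 0, 0, 0, 0, 0, 1, 0, -1, 0, 0, 0, 0, 0, 0],
    ![0, 0, 0, -1, 0, 0, 0, 2, 0, 0, 0, 2, 0, 0, 0, -3, 0, 0, 0, 0, 0, 0],
    ![-1, 2, 0, -1, 2, -4, 0, 2, 2, -4, 0, 2, -3, 6, 0, -3, 0, 0, 0, 0, 0, 0],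
    ![0, -1, 0, 1, 0, 2, 0, -2, 0, 2, 0, -2, 0, -3, 0, 3, 0, 0, 0, 0, 0, 0],
    ![0, 0, 0, 0, 0, 0, 0, 1, 0, 0, 0, 0, 0, 0, 0, -1, 0, 0, 0, 0, 0, 0],
    ![0, 0, 0, 0, 1, -2, 0, 1, 0, 0, 0, 0, -1, 2, 0, -1, 0, 0, 0, 0, 0, 0],
    ![0, 0, 0, 0, 0, 1, 0, -1, 0, 0, 0, 0, 0, -1, 0, 1, 0, 0, 0, 0, 0, 0],
    ![0, 0, 0, 0, 0, 0, 0, 0, 0, 0, 0, 0, 1, -2, -1, 2, 0, 0, 0, 0, 0, 0],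
    ![-1, 2, 1, -2, 2, -4, -2, 4, 2, -4, -2, 4, -3, 6, 3, -6, 0, 0, 0, 0, 0, 0],
    ![0, 0, 0, 0, 1, -2, -1, 2, 0, 0, 0, 0, -1, 2, 1, -2, 0, 0, 0, 0, 0, 0],
    ![0, 0, -2, 2, 0, 0, 2, -4, 0, 0, 1, -1, 0, 0, -1, 2, 0, 2, 0, -1, 0, 0],
    ![2, -2, -2, 2, -2, 4, 2, -4, -1, 1, 1, -1, 1, -2, -1, 2, -2, 2, 1, -1, 0, 0],
    ![0, 0, 0, 1, 0, 0, 0, -2, 0, 0, 0, -1, 0, 0, 0, 2, 0, 0, 0, 0, 0, 0],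
    ![1, -2, 0, 1, -2, 4, 0, -2, -1, 2, 0, -1, 2, -4, 0, 2, 0, 0, 0, 0, 0, 0],
    ![0, 1, 0, -1, 0, -2, 0, 2, 0, -1, 0, 1, 0, 2, 0, -2, 0, 0, 0, 0, 0, 0],
    ![0, 0, 1, -1, 0, 0, -1, 2, 0, 0, -1, 1, 0, 0, 1, -2, 0, -1, 0, 1, 0, 0],
    ![1, -2, 2, -1, -2, 3, -2, 3, -2, 4, -1, -1, 3, -5, 1, -1, 0, -2, 0, 1, 0, 1],
    ![5, -12, -5, 12, -12, 24, 12, -24, -5, 12, 4, -12, 12, -24, -12, 24, 1, -1, -1, 1, 1, 0],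
    ![0, -1, 0, 1, -1, 2, 1, -2, 0, 1, -1, -1, 1, -2, -1, 2, 0, 0, 0, 0, 1, 0],
    ![-1, 0, 1, 0, 0, 0, 0, 0, 1, 0, -3, 0, 0, 0, 0, 0, 0, 0, 0, 0, 2, 0]]

set_option maxRecDepth 100000 in
theorem imageParams_mul_inv : imageParams * imageParamsInv = 1 := by
  decide +kernel

/-- The subgroups in the list. -/
def mask (i : Fin 22) : ℕ := masks[i]

theorem mask_mem (i : Fin 22) : mask i ∈ masks := List.getElem_mem _

theorem exists_mask_eq {L : ℕ} (hL : L ∈ masks) : ∃ i, mask i = L := by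
  obtain ⟨i, hi, rfl⟩ := List.getElem_of_mem hL
  exact ⟨⟨i, hi⟩, rfl⟩

instance : DecidableEq (OrderA ℤ) := fun _ _ => decidable_of_iff _ OrderA.ext_iff.symm

theorem relImage_mask (i : Fin 22) :
    relImage (ofMask (mask i)) = OrderA.ofParams ℤ (imageParams i) := by
  rw [relImage_ofMask]
  revert i
  decide +kernel

end SymThree

namespace SymThree

/-! ### The isomorphism of the double Burnside algebra with the order -/

section Burnside

variable (R : Type*) [CommRing R]

/-- The class of a biset in the double Burnside algebra. -/
noncomputable def burnsideOf (c : BisetClass SymThree) : DoubleBurnside R SymThree :=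
  (burnsideIdeal R SymThree).ringCon.mkₐ R (MonoidAlgebra.of R _ c)

theorem burnsideOf_sum (X Y : Type*) [Finite X] [MulAction SymThree X] [MulAction SymThreeᵐᵒᵖ X]
    [SMulCommClass SymThree SymThreeᵐᵒᵖ X] [Finite Y] [MulAction SymThree Y]
    [MulAction SymThreeᵐᵒᵖ Y] [SMulCommClass SymThree SymThreeᵐᵒᵖ Y] :
    burnsideOf R (BisetClass.mk SymThree (X ⊕ Y)) =
      burnsideOf R (BisetClass.mk SymThree X) + burnsideOf R (BisetClass.mk SymThree Y) := by
  have h := burnsideRelations_mem R (G := SymThree) X Y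
  rw [← sub_eq_zero, ← sub_sub, burnsideOf, burnsideOf, burnsideOf, ← map_sub, ← map_sub,
    ← map_zero ((burnsideIdeal R SymThree).ringCon.mkₐ R)]
  refine (RingCon.eq _).2 ((TwoSidedIdeal.mem_iff _ _).1 ?_)
  exact (TwoSidedIdeal.mem_mk' _ _ _ _ _ _ _).2 h

/-- The class of the transitive biset with a given stabilizer. -/
noncomputable def burnsideCoset (i : Fin 22) : DoubleBurnside R SymThree :=
  burnsideOf R (BisetClass.mk SymThree (CosetBiset (maskSubgroup (mask i) (mask_mem i))))

theorem burnsideOf_mem_span (c : BisetClass SymThree) :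
    burnsideOf R c ∈ Submodule.span R (Set.range (burnsideCoset R)) := by
  induction c using induction_masks with
  | empty X =>
    have e : BisetIso SymThree X (X ⊕ X) :=
      { toEquiv := Equiv.equivOfIsEmpty _ _
        map_left := fun _ x => isEmptyElim x
        map_right := fun _ x => isEmptyElim x }
    have h := burnsideOf_sum R X X
    rw [← BisetClass.mk_eq_mk_iff.2 ⟨e⟩, left_eq_add] at h
    rw [h]
    exact zero_mem _
  | coset L hL =>
    obtain ⟨i, rfl⟩ := exists_mask_eq hL
    exact Submodule.subset_span ⟨i, rfl⟩
  | sum X Y hX hY =>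
    rw [burnsideOf_sum]
    exact add_mem hX hY

theorem exists_eq_sum_burnsideCoset (b : DoubleBurnside R SymThree) :
    ∃ c : Fin 22 → R, b = ∑ i, c i • burnsideCoset R i := by
  obtain ⟨a, rfl⟩ := (burnsideIdeal R SymThree).ringCon.mkₐ_surjective (α := R) b
  suffices (burnsideIdeal R SymThree).ringCon.mkₐ R a ∈
      Submodule.span R (Set.range (burnsideCoset R)) by
    obtain ⟨c, hc⟩ := (Submodule.mem_span_range_iff_exists_fun R).1 this
    exact ⟨c, hc.symm⟩
  induction a using MonoidAlgebra.induction_on with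
  | of c => exact burnsideOf_mem_span R c
  | add a b ha hb =>
    rw [map_add]
    exact add_mem ha hb
  | smul r a ha =>
    rw [map_smul]
    exact Submodule.smul_mem _ r ha

/-- The representation of the monoid algebra on the isomorphism classes of bisets. -/
noncomputable def monoidAlgebraToOrder : MonoidAlgebra R (BisetClass SymThree) →ₐ[R] OrderA R :=
  MonoidAlgebra.lift R (OrderA R) (BisetClass SymThree)
    ((OrderA.mapRingHom (Int.castRingHom R)).toMonoidHom.comp bisetImage)

theorem monoidAlgebraToOrder_of (c : BisetClass SymThree) :
    monoidAlgebraToOrder R (MonoidAlgebra.of R _ c) =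
      OrderA.mapRingHom (Int.castRingHom R) (bisetImage c) :=
  MonoidAlgebra.lift_of _ _

theorem burnsideIdeal_le_ker :
    burnsideIdeal R SymThree ≤ TwoSidedIdeal.ker (monoidAlgebraToOrder R) := by
  intro a hI
  have ha : a ∈ burnsideRelations R SymThree := (TwoSidedIdeal.mem_mk' _ _ _ _ _ _ _).1 hI
  clear hI
  rw [TwoSidedIdeal.mem_ker]
  change a ∈ LinearMap.ker (monoidAlgebraToOrder R).toLinearMap
  revert a
  change burnsideRelations R SymThree ≤ _
  rw [burnsideRelations, Submodule.span_le]
  rintro _ ⟨M, N, rfl⟩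
  rw [SetLike.mem_coe, LinearMap.mem_ker, AlgHom.toLinearMap_apply, map_sub, map_sub,
    monoidAlgebraToOrder_of, monoidAlgebraToOrder_of, monoidAlgebraToOrder_of, bisetImage_sum,
    map_add]
  abel

/-- The representation of the double Burnside algebra. -/
noncomputable def burnsideToOrder : DoubleBurnside R SymThree →ₐ[R] OrderA R :=
  (burnsideIdeal R SymThree).ringCon.liftₐ (monoidAlgebraToOrder R)
    (TwoSidedIdeal.ringCon_le_iff.1 (burnsideIdeal_le_ker R))

theorem burnsideToOrder_coset (i : Fin 22) :
    burnsideToOrder R (burnsideCoset R i) = OrderA.ofParams R fun j => (imageParams i j : R) := by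
  change monoidAlgebraToOrder R (MonoidAlgebra.of R _ _) = _
  rw [monoidAlgebraToOrder_of, bisetImage_coset, relImage_mask, OrderA.mapRingHom_ofParams]
  rfl

theorem burnsideToOrder_sum (c : Fin 22 → R) :
    burnsideToOrder R (∑ i, c i • burnsideCoset R i) =
      OrderA.ofParams R (Matrix.vecMul c (imageParams.map (Int.castRingHom R))) := by
  rw [map_sum]
  simp only [map_smul, burnsideToOrder_coset]
  simp only [← map_smul]
  rw [← map_sum (OrderA.ofParams R)]
  congr 1

theorem burnsideToOrder_mem (b : DoubleBurnside R SymThree) : burnsideToOrder R b ∈ Lambda R := by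
  obtain ⟨c, rfl⟩ := exists_eq_sum_burnsideCoset R b
  rw [burnsideToOrder_sum]
  exact OrderA.ofParams_mem R _

theorem map_imageParams_mul_inv :
    imageParams.map (Int.castRingHom R) * imageParamsInv.map (Int.castRingHom R) = 1 := by
  rw [← Matrix.map_mul, imageParams_mul_inv, Matrix.map_one _ (map_zero _) (map_one _)]

variable {R} [IsDomain R]

theorem burnsideToOrder_injective (h2 : (2 : R) ≠ 0) : Function.Injective (burnsideToOrder R) := by
  rw [injective_iff_map_eq_zero]
  intro b hb
  obtain ⟨c, rfl⟩ := exists_eq_sum_burnsideCoset R b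
  rw [burnsideToOrder_sum, ← map_zero (OrderA.ofParams R)] at hb
  have hc := congrArg (Matrix.vecMul · (imageParamsInv.map (Int.castRingHom R)))
    (OrderA.ofParams_injective h2 hb)
  simp only [Matrix.vecMul_vecMul, map_imageParams_mul_inv, Matrix.vecMul_one,
    Matrix.zero_vecMul] at hc
  rw [hc]
  exact Finset.sum_eq_zero fun i _ => zero_smul R (burnsideCoset R i)

theorem exists_burnsideToOrder_eq (h2 : (2 : R) ≠ 0) {a : OrderA R} (ha : a ∈ Lambda R) :
    ∃ b, burnsideToOrder R b = a := by
  obtain ⟨q, rfl⟩ := OrderA.exists_ofParams_eq h2 ha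
  refine ⟨∑ i, Matrix.vecMul q (imageParamsInv.map (Int.castRingHom R)) i • burnsideCoset R i, ?_⟩
  rw [burnsideToOrder_sum, Matrix.vecMul_vecMul,
    mul_eq_one_comm.1 (map_imageParams_mul_inv R), Matrix.vecMul_one]

/-- The double Burnside algebra of `S₃` is isomorphic to the order `Λ`. -/
noncomputable def burnsideEquivLambda (h2 : (2 : R) ≠ 0) :
    DoubleBurnside R SymThree ≃ₐ[R] Lambda R :=
  AlgEquiv.ofBijective ((burnsideToOrder R).codRestrict (Lambda R) (burnsideToOrder_mem R))
    ⟨fun _ _ h => burnsideToOrder_injective h2 (congrArg Subtype.val h), fun a => by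
      obtain ⟨b, hb⟩ := exists_burnsideToOrder_eq h2 a.2
      exact ⟨b, Subtype.ext hb⟩⟩

end Burnside

end SymThree

theorem two_ne_zero_zLocTwo : (2 : ZLocTwo) ≠ 0 := by
  have h : (algebraMap ℤ ZLocTwo) 2 ≠ algebraMap ℤ ZLocTwo 0 := fun h =>
    absurd (IsLocalization.injective ZLocTwo (Ideal.primeCompl_le_nonZeroDivisors (Ideal.span {(2 : ℤ)})) h) (by decide)
  simpa using h

theorem proposition5p6 :
    Nonempty (DoubleBurnside ZLocTwo (Equiv.Perm (Fin 3)) ≃ₐ[ZLocTwo] Lambda ZLocTwo) ∧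
    (∃ φ : Lambda.Corner ZLocTwo ≃ₐ[ZLocTwo] Psi.PsiQuot ZLocTwo,
      φ (Lambda.Corner.e3 ZLocTwo) =
        Psi.toQuot ZLocTwo (PathAlgebra.vertex ZLocTwo PsiVertex.e3) ∧
      φ (Lambda.Corner.e4 ZLocTwo) =
        Psi.toQuot ZLocTwo (PathAlgebra.vertex ZLocTwo PsiVertex.e4) ∧
      φ (Lambda.Corner.e5 ZLocTwo) =
        Psi.toQuot ZLocTwo (PathAlgebra.vertex ZLocTwo PsiVertex.e5) ∧
      φ (Lambda.Corner.t1 ZLocTwo) = Psi.toQuot ZLocTwo (Psi.t1 ZLocTwo) ∧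
      φ (Lambda.Corner.t2 ZLocTwo) = Psi.toQuot ZLocTwo (Psi.t2 ZLocTwo) ∧
      φ (Lambda.Corner.t3 ZLocTwo) = Psi.toQuot ZLocTwo (Psi.t3 ZLocTwo) ∧
      φ (Lambda.Corner.t4 ZLocTwo) = Psi.toQuot ZLocTwo (Psi.t4 ZLocTwo) ∧
      φ (Lambda.Corner.t7 ZLocTwo) = Psi.toQuot ZLocTwo (Psi.t7 ZLocTwo)) ∧
    IsMoritaEquivalent ZLocTwo (DoubleBurnside ZLocTwo (Equiv.Perm (Fin 3)))
      (Lambda.Corner ZLocTwo) ∧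
    IsMoritaEquivalent ZLocTwo (DoubleBurnside ZLocTwo (Equiv.Perm (Fin 3)))
      (Psi.PsiQuot ZLocTwo) := by
  have h2 := two_ne_zero_zLocTwo
  have e := SymThree.burnsideEquivLambda h2
  have f := Lambda.Corner.equivPsiQuot ZLocTwo h2
  have hc : IsMoritaEquivalent ZLocTwo (DoubleBurnside ZLocTwo (Equiv.Perm (Fin 3)))
      (Lambda.Corner ZLocTwo) :=
    (IsMoritaEquivalent.of_algEquiv _ e).trans _ (Lambda.isMoritaEquivalent_corner ZLocTwo)
  refine ⟨⟨e⟩, ⟨Lambda.Corner.equivPsiQuot ZLocTwo h2, ?_⟩, hc,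
    hc.trans _ (IsMoritaEquivalent.of_algEquiv _ f)⟩
  simp only [Lambda.Corner.equivPsiQuot_eq_iff, Lambda.Corner.ofPathAlgebra_vertex,
    Lambda.Corner.ofPathAlgebra_t1, Lambda.Corner.ofPathAlgebra_t2, Lambda.Corner.ofPathAlgebra_t3,
    Lambda.Corner.ofPathAlgebra_t4, Lambda.Corner.ofPathAlgebra_t7]
  exact ⟨rfl, rfl, rfl, trivial, trivial, trivial, trivial, trivial⟩
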